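/- Let $d \ge 2$, $T > 0$ and $0 \le \alpha < \tfrac12$. Let $L^2_\alpha$ be the space of (measurable) vector fields $f : \mathbb{R}^d \to \mathbb{R}^d$ with $\|f\|_{L^2_\alpha} := \sup_{r \ge 1} r^{-(\alpha + d/2)} \|f\|_{L^2(B_r)} < \infty$, where $B_r = B(0,r)$. A cut-off function is a radial $C^\infty$ function $\chi$ on $\mathbb{R}^d$ with $0 \le \chi \le 1$, $\chi(x) = 1$ for $|x| \le 1$ and $\mathrm{supp}(\chi) \subset B(0,2)$. With $D = -i\nabla$, let $\mathcal S'_h$ be the space of $f \in \mathcal S'(\mathbb{R}^d)$ such that $\chi(\lambda D) f \to 0$ in $\mathcal S'$ as $\lambda \to \infty$, for a fixed cut-off function $\chi$. Vector-valued distributions are treated componentwise. $\mathcal D([0,T) \times \mathbb{R}^d)$ denotes the restrictions to $t \ge 0$ of smooth functions with compact support in $(-\infty,T) \times \mathbb{R}^d$. Let $E$ be the fundamental solution of the Laplace operator, $-\Delta E = \delta_0$ (so $E(x) = -\frac{1}{2\pi} \log|x|$ if $d = 2$ and $E(x) = C(d)|x|^{2-d}$ if $d \ge 3$). Let $\chi',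 \theta$ be cut-off functions and let $\psi \in \mathcal S$ be such that $\widehat\psi = \chi'$. For $u, v \in L^2_\alpha$ set $$\nabla \bar\Pi(u \otimes v) := \big(\mathrm{Id} - \chi'(D)\big) \nabla (-\Delta)^{-1} \nabla^2 : (u \otimes v) + \Gamma * (u \otimes v) \in \mathcal S', \qquad \Gamma := \nabla^3 \psi * (\theta E) + \psi * \nabla^3\big((1-\theta)E\big).$$ Let $u_0 \in L^2_\alpha$ be divergence-free and let $u \in C^0([0,T); L^2_\alpha)$ be a weak solution of the Euler equations with initial datum $u_0$: $\mathrm{div}(u) = 0$ in $\mathcal D'((0,T) \times \mathbb{R}^d)$, and for every $\phi \in \mathcal D([0,T) \times \mathbb{R}^d; \mathbb{R}^d)$ with $\mathrm{div}(\phi) = 0$, $$\int_0^T \!\! \int \big\{ u \cdot \partial_t \phi + u \otimes u : \nabla \phi \big\} \, dx \, dt + \int u_0 \cdot \phi(0,x) \, dx = 0 .$$ Let $F_\pi := \delta_0(t) \otimes u_0(x) - \partial_t u - \mathrm{div}(u \otimes u)$ be its pressure force, that is, for every $\phi \in \mathcal D([0,T) \times \mathbb{R}^d; \mathbb{R}^d)$,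 $$\langle F_\pi, \phi \rangle = \int u_0 \cdot \phi(0,x) \, dx + \int_0^T \!\! \int \big\{ u \cdot \partial_t \phi + u \otimes u : \nabla \phi \big\} \, dx \, dt .$$ Then, for every choice of the cut-off functions $\chi, \chi', \theta$, the following conditions are equivalent: (i) $F_\pi = \nabla \bar\Pi(u \otimes u)$ in $\mathcal D'([0,T) \times \mathbb{R}^d)$; (ii) $u(t) - u(0) \in \mathcal S'_h$ for all $t \in [0,T)$, and $u(0) = u_0$; (iii) $F_\pi \in C^0([0,T); \mathcal S')$, and $F_\pi(t) \in \mathcal S'_h$ for all $t \in [0,T)$. -/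

import Mathlib

open MeasureTheory Filter Topology Set
open scoped SchwartzMap ContDiff FourierTransform Distributions

noncomputable section

/-- The Euclidean space `ℝ^d`. -/
abbrev Space (d : ℕ) : Type := EuclideanSpace ℝ (Fin d)

/-! ### Morrey spaces -/

/-- The Morrey norm `‖f‖_{L²_α} = sup_{r ≥ 1} r^{-(α + d/2)} ‖f‖_{L²(B_r)}`, with values in `[0,∞]`. -/
def morreyENorm {d : ℕ} (α : ℝ) (f : Space d → Space d) : ENNReal :=
  ⨆ (r : ℝ) (_ : 1 ≤ r),
    eLpNorm f 2 (volume.restrict (Metric.ball 0 r)) / ENNReal.ofReal (r ^ (α + (d : ℝ) / 2))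

/-- The vector field `f` belongs to `L²_α(ℝ^d; ℝ^d)`. -/
def MemMorrey {d : ℕ} (α : ℝ) (f : Space d → Space d) : Prop :=
  AEStronglyMeasurable f volume ∧ morreyENorm α f < ⊤

/-- `u ∈ C⁰([0,T); L²_α)`. -/
def ContinuousInMorrey {d : ℕ} (T α : ℝ) (u : ℝ → Space d → Space d) : Prop :=
  (∀ t ∈ Ico 0 T, MemMorrey α (u t)) ∧
    ∀ t ∈ Ico 0 T, Tendsto (fun s => morreyENorm α (u s - u t)) (𝓝[Ico 0 T] t) (𝓝 0)

/-! ### Cut-off functions, tempered distributions given by functions, the space `S'_h` -/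

/-- The cut-off functions: smooth, radial, `0 ≤ χ ≤ 1`, equal to `1` on the unit ball and supported
in `B(0,2)`. -/
structure IsCutoff {d : ℕ} (χ : Space d → ℝ) : Prop where
  smooth : ContDiff ℝ ∞ χ
  radial : ∀ x y, ‖x‖ = ‖y‖ → χ x = χ y
  nonneg : ∀ x, 0 ≤ χ x
  le_one : ∀ x, χ x ≤ 1
  eq_one : ∀ x, ‖x‖ ≤ 1 → χ x = 1
  support : tsupport χ ⊆ Metric.ball 0 2

/-- `f` is integrable against some negative power of `1 + |x|²`. -/
def HasPolyIntegrability {d : ℕ} (f : Space d → ℂ) : Prop :=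
  ∃ N : ℕ, Integrable (fun x => ((((1 + ‖x‖ ^ 2) ^ N)⁻¹ : ℝ) : ℂ) * f x) volume

open Classical in
/-- The tempered distribution `φ ↦ ∫ φ f` defined by a function `f` (and `0` if `f` is not integrable
against any negative power of `1 + |x|²`); see `ofFun_apply`. -/
def ofFun {d : ℕ} (f : Space d → ℂ) : 𝓢'(Space d, ℂ) :=
  if h : HasPolyIntegrability f then
    TemperedDistribution.smulLeftCLM ℂ
      (fun x : Space d => (((1 + ‖x‖ ^ 2) ^ h.choose : ℝ) : ℂ))
      (Lp.toTemperedDistribution h.choose_spec.toL1)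
  else 0

theorem ofFun_apply {d : ℕ} {f : Space d → ℂ} (h : HasPolyIntegrability f) (φ : 𝓢(Space d, ℂ)) :
    ofFun f φ = ∫ x, φ x * f x := by
  have hg : Function.HasTemperateGrowth
      (fun x : Space d => (((1 + ‖x‖ ^ 2) ^ h.choose : ℝ) : ℂ)) := by
    have h1 : Function.HasTemperateGrowth (fun x : Space d => (1 + ‖x‖ ^ 2) ^ h.choose) :=
      ((Function.HasTemperateGrowth.const 1).add (Function.hasTemperateGrowth_norm_sq (Space d))).pow _
    exact Function.HasTemperateGrowth.comp Function.Complex.hasTemperateGrowth_ofReal h1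
  rw [ofFun, dif_pos h, TemperedDistribution.smulLeftCLM_apply_apply,
    Lp.toTemperedDistribution_apply]
  refine integral_congr_ae ?_
  filter_upwards [h.choose_spec.coeFn_toL1] with x hx
  rw [hx, SchwartzMap.smulLeftCLM_apply_apply hg]
  have hne : (((1 + ‖x‖ ^ 2) ^ h.choose : ℝ) : ℂ) ≠ 0 := by
    rw [Ne, Complex.ofReal_eq_zero]; positivity
  rw [smul_eq_mul, smul_eq_mul, Complex.ofReal_inv, mul_right_comm, mul_comm _ (φ x)]
  generalize (((1 + ‖x‖ ^ 2) ^ h.choose : ℝ) : ℂ) = c at hne ⊢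
  field_simp

/-- The Fourier multiplier `χ(λD)`, where `D = -i∇`. Mathlib's Fourier transform has the phase
`e^{-2πi⟨x,ξ⟩}`, so that `D` corresponds to multiplication by `2πξ`. -/
def lowFreq {d : ℕ} (χ : Space d → ℝ) (lam : ℝ) : 𝓢'(Space d, ℂ) →L[ℂ] 𝓢'(Space d, ℂ) :=
  TemperedDistribution.fourierMultiplierCLM ℂ
    (fun ξ : Space d => ((χ ((lam * (2 * Real.pi)) • ξ) : ℝ) : ℂ))

/-- Chemin's space `S'_h`: `χ(λD) f → 0` in `S'` as `λ → ∞`. -/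
def MemSh {d : ℕ} (χ : Space d → ℝ) (f : 𝓢'(Space d, ℂ)) : Prop :=
  Tendsto (fun lam : ℝ => lowFreq χ lam f) atTop (𝓝 0)

/-! ### The pressure operator -/

/-- The partial derivative `∂_j f`. -/
def pderivAt {d : ℕ} {F : Type} [NormedAddCommGroup F] [NormedSpace ℝ F] (j : Fin d)
    (f : Space d → F) : Space d → F :=
  fun x => fderiv ℝ f x (EuclideanSpace.single j 1)

/-- The fundamental solution `E` of the Laplace operator, `-ΔE = δ₀`: `E(x) = -log|x| / (2π)` if
`d = 2`, and `E(x) = |x|^{2-d} / ((d-2) |S^{d-1}|)` if `d ≥ 3`, where `|S^{d-1}| = d |B_1|`. -/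
def fundSol (d : ℕ) (x : Space d) : ℝ :=
  if d = 2 then -(1 / (2 * Real.pi)) * Real.log ‖x‖
  else 1 / (((d : ℝ) - 2) * (d * volume.real (Metric.ball (0 : Space d) 1))) *
    ‖x‖ ^ (2 - (d : ℤ))

/-- The Schwartz function `ψ` with `∫ e^{-i⟨x,ξ⟩} ψ(x) dx = χ(ξ)`. -/
def cutoffKernel {d : ℕ} (χ : Space d → ℝ) : Space d → ℂ :=
  𝓕⁻ (fun ξ : Space d => ((χ ((2 * Real.pi) • ξ) : ℝ) : ℂ))

/-- The components of the kernel `Γ = ∇³ψ * (θE) + ψ * ∇³((1-θ)E)`. -/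
def pressureKernel {d : ℕ} (χ θ : Space d → ℝ) (l j k : Fin d) (x : Space d) : ℂ :=
  (∫ y, pderivAt l (pderivAt j (pderivAt k (cutoffKernel χ))) (x - y) *
      ((θ y * fundSol d y : ℝ) : ℂ)) +
    ∫ y, cutoffKernel χ (x - y) *
      ((pderivAt l (pderivAt j (pderivAt k (fun z => (1 - θ z) * fundSol d z))) y : ℝ) : ℂ)

/-- The symbol of `(Id - χ(D)) ∂_l (-Δ)^{-1} ∂_j ∂_k`, namely `(1 - χ(η)) (iη_l)(iη_j)(iη_k) / |η|²`
where `η = 2πξ` and `ξ` is the frequency variable of Mathlib's Fourier transform. -/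
def highFreqSymbol {d : ℕ} (χ : Space d → ℝ) (l j k : Fin d) (ξ : Space d) : ℂ :=
  let η : Space d := (2 * Real.pi) • ξ
  ((1 - χ η : ℝ) : ℂ) * ((Complex.I * (η l : ℂ)) * (Complex.I * (η j : ℂ)) *
    (Complex.I * (η k : ℂ)) / ((‖η‖ ^ 2 : ℝ) : ℂ))

/-- The `l`-th component of the pressure operator
`(Id - χ(D)) ∇ (-Δ)^{-1} ∇² : (u ⊗ v) + Γ * (u ⊗ v)`. -/
def pressureOp {d : ℕ} (χ θ : Space d → ℝ) (u v : Space d → Space d) (l : Fin d) :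
    𝓢'(Space d, ℂ) :=
  ∑ j, ∑ k,
    (TemperedDistribution.fourierMultiplierCLM ℂ (highFreqSymbol χ l j k)
        (ofFun fun x => ((u x j * v x k : ℝ) : ℂ)) +
      ofFun fun x => ∫ y, pressureKernel χ θ l j k (x - y) * ((u y j * v y k : ℝ) : ℂ))

/-! ### Weak solutions of the Euler equations -/

/-- The set `(-∞,T) × ℝ^d`. The elements of `D([0,T) × ℝ^d)` are the restrictions to `t ≥ 0` of the
test functions on this open set. -/
def beforeTime (d : ℕ) (T : ℝ) : TopologicalSpace.Opens (ℝ × Space d) :=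
  ⟨{p | p.1 < T}, isOpen_lt continuous_fst continuous_const⟩

/-- The open set `(0,T) × ℝ^d`. -/
def openSlab (d : ℕ) (T : ℝ) : TopologicalSpace.Opens (ℝ × Space d) :=
  ⟨{p | 0 < p.1 ∧ p.1 < T},
    (isOpen_lt continuous_const continuous_fst).inter (isOpen_lt continuous_fst continuous_const)⟩

/-- `div f = 0` in `D'(ℝ^d)`. -/
def WeaklyDivFree {d : ℕ} (f : Space d → Space d) : Prop :=
  ∀ q : 𝓓((⊤ : TopologicalSpace.Opens (Space d)), ℝ), ∫ x, fderiv ℝ q x (f x) = 0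

/-- `div u = 0` in `D'((0,T) × ℝ^d)`. -/
def WeaklyDivFreeInTime {d : ℕ} (T : ℝ) (u : ℝ → Space d → Space d) : Prop :=
  ∀ q : 𝓓(openSlab d T, ℝ),
    ∫ t in Ico 0 T, ∫ x, fderiv ℝ (fun y => q (t, y)) x (u t x) = 0

/-- The pressure force `F_π = δ₀(t) ⊗ u₀ - ∂ₜu - div(u ⊗ u)` as a functional on the test fields
`φ ∈ D([0,T) × ℝ^d; ℝ^d)`:
`⟨F_π, φ⟩ = ∫ u₀ · φ(0) dx + ∫_0^T ∫ (u · ∂ₜφ + u ⊗ u : ∇φ) dx dt`. -/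
def pressureForce {d : ℕ} (T : ℝ) (u : ℝ → Space d → Space d) (u₀ : Space d → Space d)
    (φ : 𝓓(beforeTime d T, Space d)) : ℝ :=
  (∫ x, inner ℝ (u₀ x) (φ (0, x))) +
    ∫ t in Ico 0 T, ∫ x,
      (inner ℝ (u t x) (deriv (fun s => φ (s, x)) t) +
        inner ℝ (u t x) (fderiv ℝ (fun y => φ (t, y)) x (u t x)))

/-- `u` is a weak solution of the Euler equations on `[0,T)` with initial datum `u₀`: it is
divergence-free, and the momentum equation holds against all divergence-free test fields in
`D([0,T) × ℝ^d; ℝ^d)`. -/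
structure IsWeakEulerSolution {d : ℕ} (T : ℝ) (u : ℝ → Space d → Space d)
    (u₀ : Space d → Space d) : Prop where
  div_free : WeaklyDivFreeInTime T u
  momentum : ∀ φ : 𝓓(beforeTime d T, Space d),
    (∀ t ∈ Ico 0 T, ∀ x, ∑ j, pderivAt j (fun y => φ (t, y) j) x = 0) →
      pressureForce T u u₀ φ = 0

/-- The `l`-th component of the test field `φ` at time `t`, as a Schwartz function of `x`. -/
def testSlice {d : ℕ} {T : ℝ} (φ : 𝓓(beforeTime d T, Space d)) (t : ℝ) (l : Fin d) :
    𝓢(Space d, ℂ) :=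
  HasCompactSupport.toSchwartzMap (f := fun x => ((φ (t, x) l : ℝ) : ℂ))
    (by
      refine HasCompactSupport.of_support_subset_isCompact
        (K := Prod.snd '' tsupport φ) (φ.hasCompactSupport.isCompact.image continuous_snd) ?_
      intro x hx
      refine ⟨(t, x), subset_tsupport _ ?_, rfl⟩
      intro h
      simp [h] at hx)
    (by
      have h1 : ContDiff ℝ ∞ (fun x : Space d => φ (t, x)) :=
        φ.contDiff.comp (contDiff_const.prodMk contDiff_id)
      exact Complex.ofRealCLM.contDiff.comp ((EuclideanSpace.proj (𝕜 := ℝ) l).contDiff.comp h1))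

/-- The equality `F_π = G` in `D'([0,T) × ℝ^d)`, for a family `G(t) ∈ S'(ℝ^d)^d`:
`⟨F_π, φ⟩ = ∫_0^T ⟨G(t), φ(t)⟩ dt` for all test fields `φ`. -/
def PressureForceEq {d : ℕ} (T : ℝ) (u : ℝ → Space d → Space d) (u₀ : Space d → Space d)
    (G : ℝ → Fin d → 𝓢'(Space d, ℂ)) : Prop :=
  ∀ φ : 𝓓(beforeTime d T, Space d),
    ((pressureForce T u u₀ φ : ℝ) : ℂ) = ∫ t in Ico 0 T, ∑ l, G t l (testSlice φ t l)

end

/-! Let `p_{ljk} = (iη_l)(iη_j)(iη_k)/|η|²` be the symbol of `∂_l (-Δ)⁻¹ ∂_j ∂_k`. It is homogeneous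
of degree 1 and not smooth at the origin, so its transpose `pressureFun l j k` maps a Schwartz
function to a continuous function that decays only like `|x|^{-d-1}`. This is exactly enough. For `α
< 1/2` a dyadic decomposition embeds `L²_α` into `L²((1+|x|)^{-d-1} dx)`, so that products `u_j u_k`
pair absolutely with `pressureFun l j k φ`. Splitting the symbol by `χ'` gives `pressureOp` tested
against `φ` as the sum of these pairings (`pressureOp_apply`); in particular it does not depend on
`χ'` and `θ`. The analytic input is that the Fourier transform of `Γ` is `χ'(η) p_{ljk}`
(`fourier_pressureKernel`), which rests on `-ΔE = δ₀` (`integral_fundSol_mul_laplacian`).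

Three properties of this pairing carry the theorem. Algebra: it vanishes on divergence-free test
fields (`pressurePair_of_divFree`) and agrees with `u ⊗ u : ∇φ` on gradients
(`pressurePair_gradient`). Low frequencies: replacing `φ` by its low-frequency part replaces `Γ` by
`λ^{-d-1} Γ(x/λ)`, which is bounded by `C(1+|x|)^{-d-1}` and by `C/λ`. Dominated convergence puts
the pressure force in `S'_h` (`memSh_pressureOp`). The term `div(u ⊗ u)` is covered as well, since a
first derivative is a trace of the operators `p_{mmk}`. Uniqueness: if a field annihilates gradients
and divergence-free fields, testing with `Δq e_m - ∇∂_m q` shows that its components are harmonic,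
and a harmonic element of `S'_h` is zero (`eq_zero_of_annihilates`).

(1) implies (3) by taking the pressure operator as the force. For (3) implies (1), the difference
between `F(t)` and the pressure operator annihilates divergence-free fields by the momentum equation
and gradients because `u` and `u₀` are divergence-free; hence it vanishes. For (1) and (2), the
equation is integrated in time: `u(t) - u(0)` equals minus the integral of `∇Π + div(u ⊗ u)`, and
this integral always lies in `S'_h`. So (1) gives (2) directly, and under (2) the residual of the
integrated equation lies in `S'_h` and is killed by the same uniqueness argument. Differentiating
against moving test fields then recovers (1). -/

noncomputable section

/-! ### Polynomial weights and convolution estimates -/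

/-- The weight `(1 + |x|)^{-N}`. -/
def decayWeight {d : ℕ} (N : ℕ) (x : Space d) : ℝ := ((1 + ‖x‖) ^ N)⁻¹

theorem decayWeight_pos {d : ℕ} (N : ℕ) (x : Space d) : 0 < decayWeight N x := by
  unfold decayWeight; positivity

theorem decayWeight_nonneg {d : ℕ} (N : ℕ) (x : Space d) : 0 ≤ decayWeight N x :=
  (decayWeight_pos N x).le

theorem decayWeight_le_one {d : ℕ} (N : ℕ) (x : Space d) : decayWeight N x ≤ 1 :=
  inv_le_one_of_one_le₀ (one_le_pow₀ (by linarith [norm_nonneg x]))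

theorem decayWeight_add {d : ℕ} (N M : ℕ) (x : Space d) :
    decayWeight (N + M) x = decayWeight N x * decayWeight M x := by
  simp [decayWeight, pow_add, mul_comm]

theorem continuous_decayWeight {d : ℕ} (N : ℕ) : Continuous (decayWeight (d := d) N) := by
  unfold decayWeight
  refine Continuous.inv₀ (by fun_prop) fun x => by positivity

/-- This is `1 + |y| ≤ (1 + |a|)(1 + |b|)` raised to a power; it transfers decay from one variable
to another in every convolution estimate. -/
theorem decayWeight_mul_le {d : ℕ} (N : ℕ) (a b y : Space d) (h : ‖y‖ ≤ ‖a‖ + ‖b‖) :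
    decayWeight N a * decayWeight N b ≤ decayWeight N y := by
  unfold decayWeight
  rw [← mul_inv, ← mul_pow]
  gcongr
  nlinarith [norm_nonneg a, norm_nonneg b, mul_nonneg (norm_nonneg a) (norm_nonneg b)]

theorem decayWeight_sub_mul_le {d : ℕ} (N : ℕ) (x y : Space d) :
    decayWeight N (x - y) * decayWeight N x ≤ decayWeight N y := by
  refine decayWeight_mul_le N _ _ _ ?_
  calc ‖y‖ = ‖x - (x - y)‖ := by rw [sub_sub_cancel]
    _ ≤ ‖x‖ + ‖x - y‖ := norm_sub_le _ _
    _ = _ := add_comm _ _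

theorem integrable_decayWeight {d : ℕ} {N : ℕ} (h : d < N) :
    Integrable (decayWeight (d := d) N) volume := by
  have h1 := integrable_one_add_norm (E := Space d) (μ := volume) (r := (N : ℝ))
    (by rw [finrank_euclideanSpace_fin]; exact_mod_cast h)
  refine h1.congr (Eventually.of_forall fun x => ?_)
  simp only [decayWeight]
  rw [Real.rpow_neg (by positivity), Real.rpow_natCast]

/-- A continuous seminorm of a Schwartz function `φ` that bounds `(1 + |x|)^N |φ(x)|`. -/
def schwartzDecay {d : ℕ} (N : ℕ) (φ : 𝓢(Space d, ℂ)) : ℝ :=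
  2 ^ N * (Finset.Iic (N, 0)).sup (fun m : ℕ × ℕ => SchwartzMap.seminorm ℂ m.1 m.2) φ

theorem schwartzDecay_nonneg {d : ℕ} (N : ℕ) (φ : 𝓢(Space d, ℂ)) : 0 ≤ schwartzDecay N φ := by
  unfold schwartzDecay
  exact mul_nonneg (by positivity) (apply_nonneg _ _)

theorem continuous_schwartzDecay {d : ℕ} (N : ℕ) : Continuous (schwartzDecay (d := d) N) := by
  unfold schwartzDecay
  refine continuous_const.mul ?_
  refine Seminorm.continuous_of_le (q := ∑ m ∈ Finset.Iic (N, 0),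
    schwartzSeminormFamily ℂ (Space d) ℂ m) ?_ ?_
  · have : ∀ m ∈ Finset.Iic (N, 0), Continuous (schwartzSeminormFamily ℂ (Space d) ℂ m) :=
      fun m _ => (schwartz_withSeminorms ℂ (Space d) ℂ).continuous_seminorm m
    have h2 : (⇑(∑ m ∈ Finset.Iic (N, 0), schwartzSeminormFamily ℂ (Space d) ℂ m) :
        𝓢(Space d, ℂ) → ℝ) = fun φ => ∑ m ∈ Finset.Iic (N, 0),
          schwartzSeminormFamily ℂ (Space d) ℂ m φ := by
      ext φ
      induction Finset.Iic (N, 0) using Finset.induction_on with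
      | empty => simp
      | insert a s ha ih => rw [Finset.sum_insert ha, Finset.sum_insert ha, ← ih]; rfl
    rw [h2]
    exact continuous_finsetSum _ this
  · exact Seminorm.finset_sup_le_sum _ _

theorem schwartzDecay_zero {d : ℕ} (N : ℕ) : schwartzDecay N (0 : 𝓢(Space d, ℂ)) = 0 := by
  unfold schwartzDecay; rw [map_zero, mul_zero]

theorem norm_le_schwartzDecay {d : ℕ} (N : ℕ) (φ : 𝓢(Space d, ℂ)) (x : Space d) :
    ‖φ x‖ ≤ schwartzDecay N φ * decayWeight N x := by
  have h := SchwartzMap.one_add_le_sup_seminorm_apply (𝕜 := ℂ) (m := (N, 0)) (k := N) (n := 0)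
    le_rfl le_rfl φ x
  rw [norm_iteratedFDeriv_zero] at h
  unfold decayWeight
  rw [← div_eq_mul_inv, le_div_iff₀ (by positivity), mul_comm]
  exact h

/-- The total mass of the weight `(1 + |x|)^{-d-1}`. -/
def weightMass (d : ℕ) : ℝ := ∫ x : Space d, decayWeight (d + 1) x

theorem weightMass_nonneg (d : ℕ) : 0 ≤ weightMass d :=
  integral_nonneg fun x => decayWeight_nonneg _ x

/-- Of the `N + (d + 1)` powers of decay of `φ`, `N` are spent to turn the weight at `x - y` into a
weight at `y`, and `d + 1` remain to integrate in `x`. -/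
theorem norm_kernel_mul_le {d N : ℕ} {K φ : Space d → ℂ} {C D : ℝ} (hC : 0 ≤ C)
    (hK : ∀ z, ‖K z‖ ≤ C * decayWeight N z)
    (hφ : ∀ x, ‖φ x‖ ≤ D * decayWeight (N + (d + 1)) x) (x y : Space d) :
    ‖K (x - y) * φ x‖ ≤ C * D * decayWeight N y * decayWeight (d + 1) x := by
  have hD : 0 ≤ D := by
    have := (norm_nonneg _).trans (hφ 0)
    exact nonneg_of_mul_nonneg_left this (decayWeight_pos _ _)
  calc ‖K (x - y) * φ x‖ = ‖K (x - y)‖ * ‖φ x‖ := norm_mul _ _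
    _ ≤ (C * decayWeight N (x - y)) * (D * decayWeight (N + (d + 1)) x) := by
        gcongr
        · exact mul_nonneg hC (decayWeight_nonneg _ _)
        · exact hK _
        · exact hφ x
    _ = C * D * (decayWeight N (x - y) * decayWeight N x) * decayWeight (d + 1) x := by
        rw [decayWeight_add]; ring
    _ ≤ _ := by
        have := decayWeight_nonneg (d + 1) x
        have := decayWeight_sub_mul_le N x y
        gcongr

/-- Convolution with a Schwartz-type function preserves polynomial decay. -/
theorem norm_integral_kernel_mul_le {d N : ℕ} {K φ : Space d → ℂ} {C D : ℝ} (hC : 0 ≤ C)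
    (hK : ∀ z, ‖K z‖ ≤ C * decayWeight N z)
    (hφ : ∀ x, ‖φ x‖ ≤ D * decayWeight (N + (d + 1)) x) (y : Space d) :
    ‖∫ x, K (x - y) * φ x‖ ≤ C * D * weightMass d * decayWeight N y := by
  calc ‖∫ x, K (x - y) * φ x‖
      ≤ ∫ x, C * D * decayWeight N y * decayWeight (d + 1) x :=
        norm_integral_le_of_norm_le ((integrable_decayWeight (Nat.lt_succ_self d)).const_mul _)
          (Eventually.of_forall fun x => norm_kernel_mul_le hC hK hφ x y)
    _ = _ := by rw [integral_const_mul, weightMass]; ring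

theorem aestronglyMeasurable_of_weight {d N : ℕ} {f : Space d → ℂ}
    (hf : AEStronglyMeasurable (fun y => (decayWeight N y : ℂ) * f y) volume) :
    AEStronglyMeasurable f volume := by
  have h1 : AEStronglyMeasurable (fun y : Space d =>
      ((decayWeight N y : ℂ))⁻¹ * ((decayWeight N y : ℂ) * f y)) volume := by
    refine AEStronglyMeasurable.mul (Measurable.aestronglyMeasurable ?_) hf
    have := (continuous_decayWeight (d := d) N).measurable
    fun_prop
  refine h1.congr (Eventually.of_forall fun y => ?_)
  have : (decayWeight N y : ℂ) ≠ 0 := by exact_mod_cast (decayWeight_pos N y).ne'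
  simp only
  field_simp

/-- The majorant separates the variables, so joint integrability reduces to that of the weight in
`x` and of the weighted `f` in `y`. -/
theorem integrable_kernel_prod {d N : ℕ} {K φ f : Space d → ℂ} {C D : ℝ} (hC : 0 ≤ C)
    (hKm : Continuous K) (hφm : Continuous φ)
    (hK : ∀ z, ‖K z‖ ≤ C * decayWeight N z)
    (hφ : ∀ x, ‖φ x‖ ≤ D * decayWeight (N + (d + 1)) x)
    (hf : Integrable (fun y => (decayWeight N y : ℂ) * f y) volume) :
    Integrable (fun p : Space d × Space d => φ p.1 * (K (p.1 - p.2) * f p.2))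
      (volume.prod volume) := by
  have hfm := aestronglyMeasurable_of_weight hf.1
  have hb : Integrable (fun p : Space d × Space d => (C * D * decayWeight (d + 1) p.1) *
      ‖(decayWeight N p.2 : ℂ) * f p.2‖) (volume.prod volume) :=
    Integrable.mul_prod ((integrable_decayWeight (Nat.lt_succ_self d)).const_mul (C * D)) hf.norm
  refine hb.mono' ?_ (Eventually.of_forall fun p => ?_)
  · refine AEStronglyMeasurable.mul (by fun_prop) (AEStronglyMeasurable.mul (by fun_prop) ?_)
    exact hfm.comp_snd
  · have := norm_kernel_mul_le hC hK hφ p.1 p.2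
    calc ‖φ p.1 * (K (p.1 - p.2) * f p.2)‖ = ‖K (p.1 - p.2) * φ p.1‖ * ‖f p.2‖ := by
          simp only [norm_mul]; ring
      _ ≤ (C * D * decayWeight N p.2 * decayWeight (d + 1) p.1) * ‖f p.2‖ := by gcongr
      _ = _ := by
          rw [norm_mul, Complex.norm_real, Real.norm_of_nonneg (decayWeight_nonneg _ _)]; ring

/-- Fubini's theorem for the pairing of a convolution with a rapidly decreasing function. -/
theorem integral_mul_convolution {d N : ℕ} {K φ f : Space d → ℂ} {C D : ℝ} (hC : 0 ≤ C)
    (hKm : Continuous K) (hφm : Continuous φ)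
    (hK : ∀ z, ‖K z‖ ≤ C * decayWeight N z)
    (hφ : ∀ x, ‖φ x‖ ≤ D * decayWeight (N + (d + 1)) x)
    (hf : Integrable (fun y => (decayWeight N y : ℂ) * f y) volume) :
    ∫ x, φ x * ∫ y, K (x - y) * f y = ∫ y, f y * ∫ x, K (x - y) * φ x := by
  have h := integral_integral_swap (f := fun x y => φ x * (K (x - y) * f y))
    (integrable_kernel_prod hC hKm hφm hK hφ hf)
  calc ∫ x, φ x * ∫ y, K (x - y) * f y = ∫ x, ∫ y, φ x * (K (x - y) * f y) := by
        simp_rw [integral_const_mul]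
    _ = ∫ y, ∫ x, φ x * (K (x - y) * f y) := h
    _ = _ := by
        congr 1; ext y
        rw [← integral_const_mul]
        congr 1; ext x
        ring

theorem integrable_mul_convolution {d N : ℕ} {K φ f : Space d → ℂ} {C D : ℝ} (hC : 0 ≤ C)
    (hKm : Continuous K) (hφm : Continuous φ)
    (hK : ∀ z, ‖K z‖ ≤ C * decayWeight N z)
    (hφ : ∀ x, ‖φ x‖ ≤ D * decayWeight (N + (d + 1)) x)
    (hf : Integrable (fun y => (decayWeight N y : ℂ) * f y) volume) :
    Integrable (fun x => φ x * ∫ y, K (x - y) * f y) volume := by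
  refine (integrable_kernel_prod hC hKm hφm hK hφ hf).integral_prod_left.congr
    (Eventually.of_forall fun x => ?_)
  simp only [integral_const_mul]

theorem hasPolyIntegrability_of_weight {d N : ℕ} {f : Space d → ℂ}
    (hf : Integrable (fun y => (decayWeight N y : ℂ) * f y) volume) :
    HasPolyIntegrability f := by
  have hfm := aestronglyMeasurable_of_weight hf.1
  refine ⟨N, (hf.norm.const_mul (2 ^ N)).mono' ?_ (Eventually.of_forall fun y => ?_)⟩
  · refine AEStronglyMeasurable.mul (Continuous.aestronglyMeasurable ?_) hfm
    refine Complex.continuous_ofReal.comp (Continuous.inv₀ (by fun_prop) fun x => by positivity)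
  · rw [norm_mul, norm_mul, Complex.norm_real, Complex.norm_real,
      Real.norm_of_nonneg (by positivity), Real.norm_of_nonneg (decayWeight_nonneg _ _),
      ← mul_assoc]
    gcongr
    unfold decayWeight
    rw [← div_eq_mul_inv, inv_eq_one_div, div_le_div_iff₀ (by positivity) (by positivity), one_mul,
      ← mul_pow]
    gcongr
    nlinarith [sq_nonneg (‖y‖ - 1)]

/-! ### Homogeneous functions -/

/-- The function `g` is smooth away from the origin and positively homogeneous of degree `k`. -/
structure IsHomogeneous {d : ℕ} {F : Type} [NormedAddCommGroup F] [NormedSpace ℝ F]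
    (k : ℤ) (g : Space d → F) : Prop where
  smooth : ContDiffOn ℝ ∞ g {0}ᶜ
  map_smul : ∀ r : ℝ, 0 < r → ∀ x, x ≠ 0 → g (r • x) = r ^ k • g x

namespace IsHomogeneous

variable {d : ℕ} {F G : Type} [NormedAddCommGroup F] [NormedSpace ℝ F] [NormedAddCommGroup G]
  [NormedSpace ℝ G] {k : ℤ} {g : Space d → F}

theorem exists_bound (hg : IsHomogeneous k g) :
    ∃ C : ℝ, 0 ≤ C ∧ ∀ x, x ≠ 0 → ‖g x‖ ≤ C * ‖x‖ ^ k := by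
  have hc : IsCompact (Metric.sphere (0 : Space d) 1) := isCompact_sphere 0 1
  have hcont : ContinuousOn g (Metric.sphere (0 : Space d) 1) :=
    hg.smooth.continuousOn.mono fun x hx => by
      intro h
      rw [mem_singleton_iff] at h
      simp [h] at hx
  obtain ⟨C, hC⟩ := hc.exists_bound_of_continuousOn hcont
  refine ⟨max C 0, le_max_right _ _, fun x hx => ?_⟩
  have hx' : 0 < ‖x‖ := norm_pos_iff.2 hx
  have h1 : g x = ‖x‖ ^ k • g (‖x‖⁻¹ • x) := by
    rw [← hg.map_smul _ hx' _ (by simp [hx]), smul_smul, mul_inv_cancel₀ hx'.ne', one_smul]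
  have h2 := hC (‖x‖⁻¹ • x) (by simp [norm_smul, hx'.ne'])
  rw [h1, norm_smul, norm_zpow, norm_norm, mul_comm]
  gcongr
  exact h2.trans (le_max_left _ _)

/-- The additive constant `c r` disappears on differentiation. It is allowed because the logarithm
in dimension 2 is homogeneous only up to such a constant. -/
theorem fderiv_of_eq {h : Space d → F} (hs : ContDiffOn ℝ ∞ h {0}ᶜ) (c : ℝ → F)
    (hh : ∀ r : ℝ, 0 < r → ∀ x, x ≠ 0 → h (r • x) = r ^ k • h x + c r) :
    IsHomogeneous (k - 1) (fderiv ℝ h) := by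
  refine ⟨?_, fun r hr x hx => ?_⟩
  · exact hs.fderiv_of_isOpen isOpen_compl_singleton (by simp)
  · have h1 : (fun y => h (r • y)) =ᶠ[𝓝 x] fun y => r ^ k • h y + c r := by
      filter_upwards [isOpen_compl_singleton.mem_nhds hx] with y hy using hh r hr y hy
    have h2 := h1.fderiv_eq (𝕜 := ℝ)
    rw [fderiv_comp_smul, fderiv_add_const] at h2
    have h3 : fderiv ℝ (fun y => r ^ k • h y) x = r ^ k • fderiv ℝ h x :=
      congrFun (fderiv_const_smul_field (r ^ k)) x
    rw [h3] at h2
    have hr' := hr.ne'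
    calc fderiv ℝ h (r • x) = r⁻¹ • (r • fderiv ℝ h (r • x)) := by
          rw [smul_smul, inv_mul_cancel₀ hr', one_smul]
      _ = _ := by rw [h2, smul_smul, zpow_sub_one₀ hr', mul_comm]

theorem fderiv (hg : IsHomogeneous k g) : IsHomogeneous (k - 1) (fderiv ℝ g) :=
  fderiv_of_eq hg.smooth (fun _ => 0) fun r hr x hx => by rw [hg.map_smul r hr x hx, add_zero]

theorem clm_comp (hg : IsHomogeneous k g) (L : F →L[ℝ] G) : IsHomogeneous k (fun x => L (g x)) :=
  ⟨L.contDiff.comp_contDiffOn hg.smooth, fun r hr x hx => by rw [hg.map_smul r hr x hx, _root_.map_smul]⟩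

/-- Each derivative lowers the degree by one and changes the target space, so the induction has to
quantify over `F`, `k` and `g`. -/
theorem exists_bound_iteratedFDeriv (n : ℕ) : ∀ {F : Type} [NormedAddCommGroup F]
    [NormedSpace ℝ F] {k : ℤ} {g : Space d → F}, IsHomogeneous k g →
    ∃ C : ℝ, 0 ≤ C ∧ ∀ x, x ≠ 0 → ‖iteratedFDeriv ℝ n g x‖ ≤ C * ‖x‖ ^ (k - n) := by
  induction n with
  | zero =>
    intro F _ _ k g hg
    obtain ⟨C, hC, h⟩ := hg.exists_bound
    exact ⟨C, hC, fun x hx => by simpa using h x hx⟩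
  | succ n ih =>
    intro F _ _ k g hg
    obtain ⟨C, hC, h⟩ := ih hg.fderiv
    refine ⟨C, hC, fun x hx => ?_⟩
    rw [← norm_iteratedFDeriv_fderiv]
    have := h x hx
    rwa [show k - 1 - (n : ℤ) = k - ((n + 1 : ℕ) : ℤ) by push_cast; ring] at this

theorem mul {f g : Space d → ℝ} {l : ℤ} (hf : IsHomogeneous k f) (hg : IsHomogeneous l g) :
    IsHomogeneous (k + l) (fun x => f x * g x) := by
  refine ⟨hf.smooth.mul hg.smooth, fun r hr x hx => ?_⟩
  rw [hf.map_smul r hr x hx, hg.map_smul r hr x hx, zpow_add₀ hr.ne']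
  simp only [smul_eq_mul]; ring

theorem hasTemperateGrowth_of_eq (hg : IsHomogeneous k g) {f : Space d → F} (hf : ContDiff ℝ ∞ f)
    {R : ℝ} (hR : 0 < R) (h : ∀ x, R ≤ ‖x‖ → f =ᶠ[𝓝 x] g) : f.HasTemperateGrowth := by
  refine ⟨hf, fun n => ?_⟩
  obtain ⟨C, hC, hCb⟩ := exists_bound_iteratedFDeriv n hg
  obtain ⟨M, hM⟩ := (isCompact_closedBall (0 : Space d) R).exists_bound_of_continuousOn
    (f := fun x => iteratedFDeriv ℝ n f x)
    ((hf.continuous_iteratedFDeriv (by exact_mod_cast le_top)).continuousOn)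
  have hM0 : 0 ≤ M := (norm_nonneg _).trans (hM 0 (by simp [hR.le]))
  have hmin : 0 < min R 1 := lt_min hR one_pos
  -- `M` covers the ball of radius `R`. Outside it `|x|^{k-n}` is at most a polynomial when `k ≥ n`,
  -- and at most a negative power of `min R 1` otherwise; one of the two truncated exponents is
  -- always zero.
  refine ⟨(k - n).toNat, M + C * (min R 1) ^ (-((n - k).toNat : ℤ)), fun x => ?_⟩
  have hone : (1 : ℝ) ≤ (1 + ‖x‖) ^ (k - n).toNat := one_le_pow₀ (by linarith [norm_nonneg x])
  have hp : 0 ≤ C * (min R 1) ^ (-((n - k).toNat : ℤ)) := by positivity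
  rcases le_total ‖x‖ R with hx | hx
  · have := hM x (by simpa using hx)
    nlinarith
  · have hx0 : 0 < ‖x‖ := hR.trans_le hx
    have hxne : x ≠ 0 := norm_pos_iff.1 hx0
    rw [(h x hx).iteratedFDeriv ℝ n |>.eq_of_nhds]
    refine (hCb x hxne).trans ?_
    have key : ‖x‖ ^ (k - n) ≤ (min R 1) ^ (-((n - k).toNat : ℤ)) * (1 + ‖x‖) ^ (k - n).toNat := by
      rcases le_total (n : ℤ) k with hk | hk
      · have h1 : ((k - n).toNat : ℤ) = k - n := Int.toNat_of_nonneg (by omega)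
        have h2 : (n - k).toNat = 0 := by omega
        have h3 : ‖x‖ ^ (k - n) = ‖x‖ ^ (k - n).toNat := by rw [← zpow_natCast, h1]
        rw [h2, h3]
        simp only [Nat.cast_zero, neg_zero, zpow_zero, one_mul]
        gcongr
        linarith
      · have h1 : ((n - k).toNat : ℤ) = n - k := Int.toNat_of_nonneg (by omega)
        have h2 : (k - n).toNat = 0 := by omega
        rw [h2, pow_zero, mul_one, show k - (n : ℤ) = -((n - k).toNat : ℤ) by omega, zpow_neg,
          zpow_neg, zpow_natCast, zpow_natCast]
        gcongr
        exact (min_le_left _ _).trans hx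
    calc C * ‖x‖ ^ (k - n)
        ≤ C * ((min R 1) ^ (-((n - k).toNat : ℤ)) * (1 + ‖x‖) ^ (k - n).toNat) := by gcongr
      _ = C * (min R 1) ^ (-((n - k).toNat : ℤ)) * (1 + ‖x‖) ^ (k - n).toNat := by ring
      _ ≤ _ := by gcongr; linarith

/-- Compactness controls the ball of radius `R`; outside it `(1 + |x|)/|x| ≤ 1 + R⁻¹` compares the
homogeneous and inhomogeneous weights. -/
theorem exists_decay_of_eq {m : ℕ} (hg : IsHomogeneous (-(m : ℤ)) g) {f : Space d → F}
    (hf : Continuous f) {R : ℝ} (hR : 0 < R) (h : ∀ x, R ≤ ‖x‖ → f x = g x) :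
    ∃ C : ℝ, 0 ≤ C ∧ ∀ x, ‖f x‖ ≤ C * decayWeight m x := by
  obtain ⟨C, hC, hCb⟩ := hg.exists_bound
  obtain ⟨M, hM⟩ := (isCompact_closedBall (0 : Space d) R).exists_bound_of_continuousOn
    hf.continuousOn
  have hM0 : 0 ≤ M := (norm_nonneg _).trans (hM 0 (by simp [hR.le]))
  refine ⟨M * (1 + R) ^ m + C * (1 + R⁻¹) ^ m, by positivity, fun x => ?_⟩
  rw [decayWeight, ← div_eq_mul_inv, le_div_iff₀ (by positivity)]
  rcases le_total ‖x‖ R with hx | hx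
  · have := hM x (by simpa using hx)
    calc ‖f x‖ * (1 + ‖x‖) ^ m ≤ M * (1 + R) ^ m := by gcongr
      _ ≤ _ := le_add_of_nonneg_right (by positivity)
  · have hx0 : 0 < ‖x‖ := hR.trans_le hx
    have := hCb x (norm_pos_iff.1 hx0)
    rw [h x hx]
    calc ‖g x‖ * (1 + ‖x‖) ^ m ≤ (C * ‖x‖ ^ (-(m : ℤ))) * (1 + ‖x‖) ^ m := by gcongr
      _ = C * ((1 + ‖x‖) / ‖x‖) ^ m := by
          rw [zpow_neg, zpow_natCast, div_pow]; field_simp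
      _ ≤ C * (1 + R⁻¹) ^ m := by
          gcongr
          rw [add_div, div_self hx0.ne', add_comm, one_div]
          gcongr
      _ ≤ _ := le_add_of_nonneg_left (by positivity)

end IsHomogeneous

theorem isHomogeneous_norm_zpow (d : ℕ) (k : ℤ) :
    IsHomogeneous k (fun x : Space d => ‖x‖ ^ k) := by
  refine ⟨fun x hx => ?_, fun r hr x hx => ?_⟩
  · have hx' : x ≠ 0 := hx
    have h1 : ContDiffAt ℝ ∞ (fun x : Space d => ‖x‖) x := contDiffAt_norm ℝ hx'
    have h2 : ContDiffAt ℝ ∞ (fun x : Space d => ‖x‖ ^ k) x := by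
      have hne : ‖x‖ ≠ 0 := norm_ne_zero_iff.2 hx'
      cases k with
      | ofNat n => simpa using h1.pow n
      | negSucc n => 
        simp only [zpow_negSucc]
        exact (h1.pow (n + 1)).inv (pow_ne_zero _ hne)
    exact h2.contDiffWithinAt
  · rw [norm_smul, Real.norm_of_nonneg hr.le, mul_zpow, smul_eq_mul]

theorem isHomogeneous_coord {d : ℕ} (l : Fin d) : IsHomogeneous 1 (fun x : Space d => x l) :=
  ⟨(EuclideanSpace.proj (𝕜 := ℝ) l).contDiff.contDiffOn, fun r _ x _ => by simp⟩

/-! ### The fundamental solution away from the origin -/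

theorem exists_fundSol_smul {d : ℕ} :
    ∃ c : ℝ → ℝ, ∀ r : ℝ, 0 < r → ∀ x : Space d, x ≠ 0 →
      fundSol d (r • x) = r ^ (2 - (d : ℤ)) • fundSol d x + c r := by
  by_cases hd : d = 2
  · subst hd
    refine ⟨fun r => -(1 / (2 * Real.pi)) * Real.log r, fun r hr x hx => ?_⟩
    have := norm_ne_zero_iff.2 hx
    simp only [fundSol, if_true, norm_smul, Real.norm_of_nonneg hr.le]
    rw [Real.log_mul hr.ne' this]
    simp; ring
  · refine ⟨fun _ => 0, fun r hr x hx => ?_⟩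
    simp only [fundSol, if_neg hd, norm_smul, Real.norm_of_nonneg hr.le, mul_zpow, smul_eq_mul]
    ring

theorem contDiffOn_fundSol (d : ℕ) : ContDiffOn ℝ ∞ (fundSol d) {0}ᶜ := by
  by_cases hd : d = 2
  · have : fundSol d = fun x => -(1 / (2 * Real.pi)) * Real.log ‖x‖ := by
      ext x; simp [fundSol, hd]
    rw [this]
    intro x hx
    exact (contDiffAt_const.mul ((contDiffAt_norm ℝ hx).log (norm_ne_zero_iff.2 hx))).contDiffWithinAt
  · have : fundSol d = fun x => 1 / (((d : ℝ) - 2) *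
        (d * volume.real (Metric.ball (0 : Space d) 1))) * ‖x‖ ^ (2 - (d : ℤ)) := by
      ext x; simp [fundSol, hd]
    rw [this]
    exact contDiffOn_const.mul (isHomogeneous_norm_zpow d _).smooth

theorem isHomogeneous_fderiv_fundSol (d : ℕ) :
    IsHomogeneous (1 - (d : ℤ)) (fderiv ℝ (fundSol d)) := by
  obtain ⟨c, hc⟩ := exists_fundSol_smul (d := d)
  have := IsHomogeneous.fderiv_of_eq (contDiffOn_fundSol d) c hc
  rwa [show (2 - (d : ℤ) - 1) = 1 - d by ring] at this

theorem isHomogeneous_pderivAt {d : ℕ} {F : Type} [NormedAddCommGroup F] [NormedSpace ℝ F]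
    {k : ℤ} {g : Space d → F} (h : IsHomogeneous k (fderiv ℝ g)) (j : Fin d) :
    IsHomogeneous k (pderivAt j g) :=
  h.clm_comp (ContinuousLinearMap.apply ℝ F (EuclideanSpace.single j (1 : ℝ)))

/-- Three derivatives bring the degree from `2 - d` to `-(d + 1)`. This rate is the origin of the
weight used throughout. -/
theorem isHomogeneous_pderiv_fundSol {d : ℕ} (l j k : Fin d) :
    IsHomogeneous (-((d + 1 : ℕ) : ℤ)) (pderivAt l (pderivAt j (pderivAt k (fundSol d)))) := by
  have h := isHomogeneous_pderivAt (isHomogeneous_pderivAt (isHomogeneous_pderivAt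
    (isHomogeneous_fderiv_fundSol d) k).fderiv j).fderiv l
  rwa [show (1 - (d : ℤ) - 1 - 1) = -((d + 1 : ℕ) : ℤ) by push_cast; ring] at h

/-! ### Cut-off functions and removal of a singularity at the origin. -/

theorem IsCutoff.eq_zero {d : ℕ} {χ : Space d → ℝ} (hχ : IsCutoff χ) {x : Space d}
    (hx : 2 ≤ ‖x‖) : χ =ᶠ[𝓝 x] 0 := by
  rw [← notMem_tsupport_iff_eventuallyEq]
  intro h
  have := hχ.support h
  rw [mem_ball_zero_iff] at this
  linarith

theorem IsCutoff.eventually_eq_one {d : ℕ} {χ : Space d → ℝ} (hχ : IsCutoff χ) {x : Space d}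
    (hx : ‖x‖ < 1) : χ =ᶠ[𝓝 x] 1 := by
  filter_upwards [(isOpen_lt continuous_norm continuous_const).mem_nhds hx] with y hy
  exact hχ.eq_one y (le_of_lt hy)

theorem IsCutoff.hasCompactSupport {d : ℕ} {χ : Space d → ℝ} (hχ : IsCutoff χ) :
    HasCompactSupport χ :=
  (isCompact_closedBall (0 : Space d) 2).of_isClosed_subset (isClosed_tsupport _)
    (hχ.support.trans Metric.ball_subset_closedBall)

/-- A function that is smooth off the origin becomes smooth after removing a neighbourhood of the
origin with a cut-off function. -/
theorem IsCutoff.contDiff_one_sub_smul {d : ℕ} {F : Type} [NormedAddCommGroup F] [NormedSpace ℝ F]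
    {χ : Space d → ℝ} (hχ : IsCutoff χ) {g : Space d → F} (hg : ContDiffOn ℝ ∞ g {0}ᶜ) :
    ContDiff ℝ ∞ (fun x => (1 - χ x) • g x) := by
  rw [contDiff_iff_contDiffAt]
  intro x
  by_cases hx : x = 0
  · have h1 : (fun x => (1 - χ x) • g x) =ᶠ[𝓝 x] fun _ => 0 := by
      filter_upwards [hχ.eventually_eq_one (x := x) (by simp [hx])] with y hy
      simp [hy]
    exact contDiffAt_const.congr_of_eventuallyEq h1
  · exact (contDiffAt_const.sub hχ.smooth.contDiffAt).smul
      (hg.contDiffAt (isOpen_compl_singleton.mem_nhds hx))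

theorem IsCutoff.one_sub_smul_eventuallyEq {d : ℕ} {F : Type} [NormedAddCommGroup F]
    [NormedSpace ℝ F] {χ : Space d → ℝ} (hχ : IsCutoff χ) (g : Space d → F) {x : Space d}
    (hx : 2 ≤ ‖x‖) : (fun x => (1 - χ x) • g x) =ᶠ[𝓝 x] g := by
  filter_upwards [hχ.eq_zero hx] with y hy
  simp [hy]

theorem IsCutoff.hasTemperateGrowth_one_sub_smul {d : ℕ} {F : Type} [NormedAddCommGroup F]
    [NormedSpace ℝ F] {χ : Space d → ℝ} (hχ : IsCutoff χ) {k : ℤ} {g : Space d → F}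
    (hg : IsHomogeneous k g) : (fun x => (1 - χ x) • g x).HasTemperateGrowth :=
  hg.hasTemperateGrowth_of_eq (hχ.contDiff_one_sub_smul hg.smooth) two_pos
    fun _ hx => hχ.one_sub_smul_eventuallyEq g hx

/-- The fundamental solution with the singularity at the origin removed. -/
def regularFundSol {d : ℕ} (θ : Space d → ℝ) (z : Space d) : ℝ := (1 - θ z) * fundSol d z

theorem contDiff_regularFundSol {d : ℕ} {θ : Space d → ℝ} (hθ : IsCutoff θ) :
    ContDiff ℝ ∞ (regularFundSol θ) :=
  hθ.contDiff_one_sub_smul (contDiffOn_fundSol d)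

theorem regularFundSol_eventuallyEq {d : ℕ} {θ : Space d → ℝ} (hθ : IsCutoff θ) {x : Space d}
    (hx : 2 ≤ ‖x‖) : regularFundSol θ =ᶠ[𝓝 x] fundSol d :=
  hθ.one_sub_smul_eventuallyEq (fundSol d) hx

theorem pderivAt_congr {d : ℕ} {F : Type} [NormedAddCommGroup F] [NormedSpace ℝ F] (j : Fin d)
    {f g : Space d → F} {x : Space d} (h : f =ᶠ[𝓝 x] g) : pderivAt j f =ᶠ[𝓝 x] pderivAt j g := by
  filter_upwards [h.fderiv (𝕜 := ℝ)] with y hy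
  simp [pderivAt, hy]

theorem contDiff_pderivAt {d : ℕ} {F : Type} [NormedAddCommGroup F] [NormedSpace ℝ F] (j : Fin d)
    {f : Space d → F} (hf : ContDiff ℝ ∞ f) : ContDiff ℝ ∞ (pderivAt j f) :=
  (hf.fderiv_right (m := ∞) (by simp)).clm_apply contDiff_const

theorem exists_decay_pderiv_regularFundSol {d : ℕ} {θ : Space d → ℝ} (hθ : IsCutoff θ)
    (l j k : Fin d) : ∃ C : ℝ, 0 ≤ C ∧ ∀ x,
      ‖pderivAt l (pderivAt j (pderivAt k (regularFundSol θ))) x‖ ≤ C * decayWeight (d + 1) x := by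
  refine (isHomogeneous_pderiv_fundSol l j k).exists_decay_of_eq
    (contDiff_pderivAt l (contDiff_pderivAt j (contDiff_pderivAt k
      (contDiff_regularFundSol hθ)))).continuous two_pos fun x hx => ?_
  exact (pderivAt_congr l (pderivAt_congr j (pderivAt_congr k
    (regularFundSol_eventuallyEq hθ hx)))).eq_of_nhds

/-! ### The fundamental solution of the Laplace operator -/

/-- The volume of the unit ball of `ℝ^d`. -/
def unitBallVolume (d : ℕ) : ℝ := volume.real (Metric.ball (0 : Space d) 1)

theorem unitBallVolume_pos (d : ℕ) : 0 < unitBallVolume d :=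
  ENNReal.toReal_pos (Metric.measure_ball_pos volume _ one_pos).ne' measure_ball_lt_top.ne

/-- The fundamental solution as a function of `|x|^2`. -/
def fundProfile (d : ℕ) (s : ℝ) : ℝ :=
  if d = 2 then -(1 / (4 * Real.pi)) * Real.log s
  else 1 / (((d : ℝ) - 2) * (d * unitBallVolume d)) * s ^ ((2 - (d : ℝ)) / 2)

theorem fundProfile_norm_sq {d : ℕ} {x : Space d} (hx : x ≠ 0) :
    fundProfile d (‖x‖ ^ 2) = fundSol d x := by
  unfold fundProfile fundSol unitBallVolume
  split_ifs with h
  · rw [Real.log_pow]; push_cast; ring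
  · congr 1
    have hx' : 0 < ‖x‖ := norm_pos_iff.2 hx
    rw [← Real.rpow_natCast ‖x‖ 2, ← Real.rpow_mul hx'.le, ← Real.rpow_intCast]
    congr 1
    push_cast; ring

/-- After one derivative the logarithmic and the power case have the same formula, since `d |B_1| =
2π` for `d = 2`. The two cases need not be separated in the Laplacian computation. -/
theorem hasDerivAt_fundProfile {d : ℕ} (hd : 2 ≤ d) {s : ℝ} (hs : 0 < s) :
    HasDerivAt (fundProfile d) (-(1 / (2 * (d * unitBallVolume d))) * s ^ (-(d : ℝ) / 2)) s := by
  have hV := unitBallVolume_pos d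
  by_cases h : d = 2
  · subst h
    have hfun : fundProfile 2 = fun s => -(1 / (4 * Real.pi)) * Real.log s := by
      ext s; simp [fundProfile]
    have hpi : unitBallVolume 2 = Real.pi := by
      unfold unitBallVolume
      rw [Measure.real, EuclideanSpace.volume_ball_fin_two]
      simp [Real.pi_pos.le]
    rw [hfun, hpi]
    refine ((Real.hasDerivAt_log hs.ne').const_mul _).congr_deriv ?_
    norm_num
    rw [Real.rpow_neg_one]
    ring
  · have hfun : fundProfile d = fun s => 1 / (((d : ℝ) - 2) * (d * unitBallVolume d)) *
        s ^ ((2 - (d : ℝ)) / 2) := by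
      ext s; simp [fundProfile, h]
    have hd' : (2 : ℝ) < d := by exact_mod_cast lt_of_le_of_ne hd (Ne.symm h)
    have h2 : (d : ℝ) - 2 ≠ 0 := by linarith
    rw [hfun]
    refine ((Real.hasDerivAt_rpow_const (p := (2 - (d : ℝ)) / 2) (Or.inl hs.ne')).const_mul
      _).congr_deriv ?_
    rw [show (2 - (d : ℝ)) / 2 - 1 = -(d : ℝ) / 2 by ring]
    field_simp
    ring

/-- The exponent `(1 - d)/2` is worse than the true one by half a power, which absorbs the logarithm
for `d = 2`; with `s = |x|²` it becomes `|x|^{1-d}`, still locally integrable. -/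
theorem exists_fundProfile_bound {d : ℕ} (hd : 2 ≤ d) :
    ∃ C : ℝ, 0 ≤ C ∧ ∀ s : ℝ, 0 < s → |fundProfile d s| ≤ C * (s ^ ((1 - (d : ℝ)) / 2) + s) := by
  have hV := unitBallVolume_pos d
  by_cases h : d = 2
  · subst h
    refine ⟨1 / (4 * Real.pi) * 2, by positivity, fun s hs => ?_⟩
    have hfun : fundProfile 2 s = -(1 / (4 * Real.pi)) * Real.log s := by simp [fundProfile]
    rw [hfun, abs_mul, abs_neg, abs_of_nonneg (by positivity), mul_assoc]
    gcongr
    have hr : (0 : ℝ) < s ^ ((1 - ((2 : ℕ) : ℝ)) / 2) := by positivity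
    rw [abs_le]
    constructor
    · have h1 := Real.log_le_sub_one_of_pos hr
      rw [Real.log_rpow hs] at h1
      push_cast at h1 ⊢
      norm_num at h1 ⊢
      linarith
    · have h1 := Real.log_le_sub_one_of_pos hs
      linarith
  · have hd' : (2 : ℝ) < d := by exact_mod_cast lt_of_le_of_ne hd (Ne.symm h)
    have h2 : 0 < (d : ℝ) - 2 := by linarith
    refine ⟨1 / (((d : ℝ) - 2) * (d * unitBallVolume d)), by positivity, fun s hs => ?_⟩
    have hfun : fundProfile d s = 1 / (((d : ℝ) - 2) * (d * unitBallVolume d)) *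
        s ^ ((2 - (d : ℝ)) / 2) := by simp [fundProfile, h]
    rw [hfun, abs_of_nonneg (by positivity)]
    gcongr
    rcases le_total s 1 with hs1 | hs1
    · have := Real.rpow_le_rpow_of_exponent_ge hs hs1
        (show (1 - (d : ℝ)) / 2 ≤ (2 - (d : ℝ)) / 2 by linarith)
      linarith
    · have := Real.rpow_le_one_of_one_le_of_nonpos hs1
        (show (2 - (d : ℝ)) / 2 ≤ 0 by linarith)
      have : (0 : ℝ) ≤ s ^ ((1 - (d : ℝ)) / 2) := by positivity
      linarith

/-- The function `|x|^{1-d} + 1 + |x|^2` that dominates the regularized fundamental solutions. -/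
def fundMajorant (d : ℕ) (x : Space d) : ℝ := ‖x‖ ^ (1 - (d : ℝ)) + (1 + ‖x‖ ^ 2)

/-- The singular power is decreasing, so shifting `|x|²` upwards only helps. The resulting bound is
uniform in `ε` and serves as majorant in the limit `ε → 0`. -/
theorem norm_fundProfile_add_le {d : ℕ} (hd : 2 ≤ d) {C : ℝ} (hC : 0 ≤ C)
    (hb : ∀ s : ℝ, 0 < s → |fundProfile d s| ≤ C * (s ^ ((1 - (d : ℝ)) / 2) + s))
    {x : Space d} (hx : x ≠ 0) {ε : ℝ} (hε : 0 ≤ ε) (hε1 : ε ≤ 1) :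
    |fundProfile d (‖x‖ ^ 2 + ε)| ≤ C * fundMajorant d x := by
  have hx' : 0 < ‖x‖ := norm_pos_iff.2 hx
  refine (hb _ (by positivity)).trans ?_
  unfold fundMajorant
  have hd' : (2 : ℝ) ≤ d := by exact_mod_cast hd
  have h1 : (‖x‖ ^ 2 + ε) ^ ((1 - (d : ℝ)) / 2) ≤ ‖x‖ ^ (1 - (d : ℝ)) := by
    calc (‖x‖ ^ 2 + ε) ^ ((1 - (d : ℝ)) / 2) ≤ (‖x‖ ^ 2) ^ ((1 - (d : ℝ)) / 2) :=
          Real.rpow_le_rpow_of_nonpos (by positivity) (by linarith) (by linarith)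
      _ = _ := by
          rw [← Real.rpow_natCast ‖x‖ 2, ← Real.rpow_mul hx'.le]
          congr 1; push_cast; ring
  exact mul_le_mul_of_nonneg_left (by linarith) hC

/-- In polar coordinates the Jacobian `r^{d-1}` cancels the singularity exactly. -/
theorem integrable_norm_rpow_mul_decayWeight {d : ℕ} (hd : 2 ≤ d) :
    Integrable (fun x : Space d => ‖x‖ ^ (1 - (d : ℝ)) * decayWeight (d + 3) x) volume := by
  have : Nonempty (Fin d) := ⟨⟨0, by omega⟩⟩
  have : Nontrivial (Space d) := inferInstance
  have h := integrable_fun_norm_addHaar (E := Space d) (volume : Measure (Space d))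
    (f := fun r => r ^ (1 - (d : ℝ)) * ((1 + r) ^ (d + 3))⁻¹)
  refine h.2 ?_
  rw [finrank_euclideanSpace_fin]
  have h1 : IntegrableOn (fun r : ℝ => (1 + ‖r‖) ^ (-((d + 3 : ℕ) : ℝ))) (Ioi 0) volume :=
    (integrable_one_add_norm (E := ℝ) (μ := volume) (r := ((d + 3 : ℕ) : ℝ))
      (by rw [Module.finrank_self]; push_cast; linarith [(Nat.cast_nonneg d : (0 : ℝ) ≤ d)])).integrableOn
  refine h1.congr_fun (fun r hr => ?_) measurableSet_Ioi
  have hr' : (0 : ℝ) < r := hr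
  simp only [smul_eq_mul]
  rw [Real.norm_of_nonneg hr'.le, Real.rpow_neg (by positivity), Real.rpow_natCast, ← mul_assoc,
    ← Real.rpow_natCast r, ← Real.rpow_add hr', Nat.cast_sub (by omega)]
  simp

/-- Two of the `d + 3` powers absorb the growth `1 + |x|²` and the other `d + 1` make the integral
converge. -/
theorem integrable_fundMajorant {d : ℕ} (hd : 2 ≤ d) :
    Integrable (fun x : Space d => fundMajorant d x * decayWeight (d + 3) x) volume := by
  have h2 : Integrable (fun x : Space d => (1 + ‖x‖ ^ 2) * decayWeight (d + 3) x) volume := by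
    refine (integrable_decayWeight (d := d) (Nat.lt_succ_self d)).mono' ?_
      (Eventually.of_forall fun x => ?_)
    · exact (Continuous.mul (by fun_prop) (continuous_decayWeight _)).aestronglyMeasurable
    · have h0 := decayWeight_nonneg (d + 3) x
      rw [Real.norm_of_nonneg (by positivity), show d + 3 = (d + 1) + 2 by rfl, decayWeight_add]
      have h3 : (1 + ‖x‖ ^ 2) * decayWeight 2 x ≤ 1 := by
        unfold decayWeight
        rw [← div_eq_mul_inv, div_le_one (by positivity)]
        nlinarith [norm_nonneg x]
      calc (1 + ‖x‖ ^ 2) * (decayWeight (d + 1) x * decayWeight 2 x)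
          = decayWeight (d + 1) x * ((1 + ‖x‖ ^ 2) * decayWeight 2 x) := by ring
        _ ≤ decayWeight (d + 1) x * 1 := by
            gcongr; exact decayWeight_nonneg _ _
        _ = _ := mul_one _
  refine ((integrable_norm_rpow_mul_decayWeight hd).add h2).congr (Eventually.of_forall fun x => ?_)
  simp [fundMajorant, add_mul]

theorem ae_ne_zero {d : ℕ} (hd : 2 ≤ d) : ∀ᵐ x : Space d, x ≠ 0 := by
  have : Nonempty (Fin d) := ⟨⟨0, by omega⟩⟩
  have : Nontrivial (Space d) := inferInstance
  exact Measure.ae_ne volume 0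

theorem measurable_fundSol (d : ℕ) : Measurable (fundSol d) := by
  unfold fundSol
  split_ifs
  · fun_prop
  · exact measurable_const.mul (measurable_norm.pow_const _)

theorem exists_fundSol_bound {d : ℕ} (hd : 2 ≤ d) :
    ∃ C : ℝ, 0 ≤ C ∧ ∀ x : Space d, x ≠ 0 → |fundSol d x| ≤ C * fundMajorant d x := by
  obtain ⟨C, hC, hb⟩ := exists_fundProfile_bound hd
  refine ⟨C, hC, fun x hx => ?_⟩
  have := norm_fundProfile_add_le hd hC hb hx le_rfl zero_le_one
  rwa [add_zero, fundProfile_norm_sq hx] at this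

theorem integrable_decayWeight_mul_fundSol {d : ℕ} (hd : 2 ≤ d) :
    Integrable (fun y : Space d => (decayWeight (d + 3) y : ℂ) * (fundSol d y : ℂ)) volume := by
  obtain ⟨C, hC, hb⟩ := exists_fundSol_bound hd
  refine ((integrable_fundMajorant hd).const_mul C).mono' ?_ ?_
  · have := (continuous_decayWeight (d := d) (d + 3)).measurable
    have := measurable_fundSol d
    exact Measurable.aestronglyMeasurable (by fun_prop)
  · filter_upwards [ae_ne_zero hd] with x hx
    rw [norm_mul, Complex.norm_real, Complex.norm_real,
      Real.norm_of_nonneg (decayWeight_nonneg _ _), mul_comm, ← mul_assoc]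
    have := decayWeight_nonneg (d + 3) x
    gcongr
    exact hb x hx

/-! #### The regularized fundamental solution -/

/-- The regularization `x ↦ E(√(|x|² + c⁻²))` of the fundamental solution. -/
def smoothFundSol (d : ℕ) (c : ℝ) (x : Space d) : ℝ := fundProfile d (‖x‖ ^ 2 + (c ^ 2)⁻¹)

theorem hasFDerivAt_smoothFundSol {d : ℕ} (hd : 2 ≤ d) {c : ℝ} (hc : 0 < c) (x : Space d) :
    HasFDerivAt (smoothFundSol d c)
      ((-(1 / (d * unitBallVolume d)) * (‖x‖ ^ 2 + (c ^ 2)⁻¹) ^ (-(d : ℝ) / 2)) •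
        innerSL ℝ x) x := by
  have h1 : HasFDerivAt (fun x : Space d => ‖x‖ ^ 2 + (c ^ 2)⁻¹) (2 • innerSL ℝ x) x :=
    (hasStrictFDerivAt_norm_sq x).hasFDerivAt.add_const _
  have h2 := (hasDerivAt_fundProfile hd (s := ‖x‖ ^ 2 + (c ^ 2)⁻¹) (by positivity)).comp_hasFDerivAt
    x h1
  refine h2.congr_fderiv ?_
  have := unitBallVolume_pos d
  have hd' : (0 : ℝ) < d := by exact_mod_cast (by omega : 0 < d)
  ext v
  simp only [smul_apply, innerSL_apply_apply, nsmul_eq_mul, smul_eq_mul]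
  push_cast
  field_simp

theorem hasTemperateGrowth_norm_sq_add_rpow {d : ℕ} {c : ℝ} (hc : 0 < c) (p : ℝ) :
    (fun x : Space d => (‖x‖ ^ 2 + (c ^ 2)⁻¹) ^ p).HasTemperateGrowth := by
  have h1 := (Function.hasTemperateGrowth_one_add_norm_sq_rpow (Space d) p).comp
    (ContinuousLinearMap.hasTemperateGrowth (c • ContinuousLinearMap.id ℝ (Space d)))
  have h2 : (fun x : Space d => (‖x‖ ^ 2 + (c ^ 2)⁻¹) ^ p) =
      fun x => ((c ^ 2)⁻¹) ^ p * ((fun x : Space d => (1 + ‖x‖ ^ 2) ^ p) ∘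
        (c • ContinuousLinearMap.id ℝ (Space d))) x := by
    ext x
    simp only [Function.comp, smul_apply, ContinuousLinearMap.id_apply]
    rw [← Real.mul_rpow (by positivity) (by positivity), norm_smul, Real.norm_of_nonneg hc.le]
    congr 1
    field_simp
    ring
  rw [h2]
  exact (Function.HasTemperateGrowth.const _).mul h1

theorem fderiv_smoothFundSol_apply {d : ℕ} (hd : 2 ≤ d) {c : ℝ} (hc : 0 < c) (v : Space d) :
    (fun x => fderiv ℝ (smoothFundSol d c) x v) =
      fun x => -(1 / (d * unitBallVolume d)) * (‖x‖ ^ 2 + (c ^ 2)⁻¹) ^ (-(d : ℝ) / 2) *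
        inner ℝ x v := by
  ext x
  rw [(hasFDerivAt_smoothFundSol hd hc x).fderiv]
  simp

theorem hasTemperateGrowth_smoothFundSol {d : ℕ} (hd : 2 ≤ d) {c : ℝ} (hc : 0 < c) :
    (smoothFundSol d c).HasTemperateGrowth := by
  obtain ⟨C, hC, hb⟩ := exists_fundProfile_bound hd
  have hd' : (2 : ℝ) ≤ d := by exact_mod_cast hd
  have hdiff : Differentiable ℝ (smoothFundSol d c) := fun x =>
    (hasFDerivAt_smoothFundSol hd hc x).differentiableAt
  refine Function.HasTemperateGrowth.of_fderiv (k := 2)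
    (C := C * (((c ^ 2)⁻¹) ^ ((1 - (d : ℝ)) / 2) + (1 + (c ^ 2)⁻¹))) ?_ hdiff fun x => ?_
  · have h1 : fderiv ℝ (smoothFundSol d c) = fun x =>
        (-(1 / (d * unitBallVolume d)) * (‖x‖ ^ 2 + (c ^ 2)⁻¹) ^ (-(d : ℝ) / 2)) • innerSL ℝ x := by
      ext1 x
      exact (hasFDerivAt_smoothFundSol hd hc x).fderiv
    rw [h1]
    exact ((Function.HasTemperateGrowth.const _).mul
      (hasTemperateGrowth_norm_sq_add_rpow hc _)).smul (ContinuousLinearMap.hasTemperateGrowth _)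
  · have hc2 : 0 < (c ^ 2)⁻¹ := by positivity
    refine (hb _ (by positivity)).trans ?_
    rw [mul_assoc]
    gcongr
    have h1 : (‖x‖ ^ 2 + (c ^ 2)⁻¹) ^ ((1 - (d : ℝ)) / 2) ≤ ((c ^ 2)⁻¹) ^ ((1 - (d : ℝ)) / 2) :=
      Real.rpow_le_rpow_of_nonpos hc2 (by nlinarith [norm_nonneg x]) (by linarith)
    have h2 : (0 : ℝ) < ((c ^ 2)⁻¹) ^ ((1 - (d : ℝ)) / 2) := by positivity
    have h3 : (1 : ℝ) ≤ (1 + ‖x‖) ^ 2 := one_le_pow₀ (by linarith [norm_nonneg x])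
    nlinarith [norm_nonneg x]

theorem inner_single_one {d : ℕ} (x : Space d) (j : Fin d) :
    inner ℝ x (EuclideanSpace.single j (1 : ℝ)) = x j := by
  simp [EuclideanSpace.inner_single_right]

/-- The regularized solution is designed for this: its Laplacian is minus the dilation `c^d k(cx)`
of one fixed positive kernel, an approximate identity as `c → ∞`. -/
theorem sum_pderiv_smoothFundSol {d : ℕ} (hd : 2 ≤ d) {c : ℝ} (hc : 0 < c) (x : Space d) :
    ∑ j, pderivAt j (pderivAt j (smoothFundSol d c)) x =
      -(c ^ d * ((unitBallVolume d)⁻¹ * (1 + ‖c • x‖ ^ 2) ^ (-(d : ℝ) / 2 - 1))) := by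
  have hV := unitBallVolume_pos d
  have hd' : (0 : ℝ) < d := by exact_mod_cast (by omega : 0 < d)
  have hs : 0 < ‖x‖ ^ 2 + (c ^ 2)⁻¹ := by positivity
  have h1 : ∀ j, pderivAt j (pderivAt j (smoothFundSol d c)) x =
      -(1 / (d * unitBallVolume d)) * ((‖x‖ ^ 2 + (c ^ 2)⁻¹) ^ (-(d : ℝ) / 2) -
        d * (x j) ^ 2 * (‖x‖ ^ 2 + (c ^ 2)⁻¹) ^ (-(d : ℝ) / 2 - 1)) := by
    intro j
    have e1 : pderivAt j (smoothFundSol d c) = fun x => -(1 / (d * unitBallVolume d)) *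
        (‖x‖ ^ 2 + (c ^ 2)⁻¹) ^ (-(d : ℝ) / 2) * x j := by
      refine (fderiv_smoothFundSol_apply hd hc _).trans ?_
      ext x; rw [inner_single_one]
    rw [e1]
    have h2 : HasFDerivAt (fun x : Space d => ‖x‖ ^ 2 + (c ^ 2)⁻¹) (2 • innerSL ℝ x) x :=
      (hasStrictFDerivAt_norm_sq x).hasFDerivAt.add_const _
    have h3 := (Real.hasDerivAt_rpow_const (p := -(d : ℝ) / 2) (Or.inl hs.ne')).comp_hasFDerivAt x h2
    have h4 : HasFDerivAt (fun x : Space d => x j)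
        (EuclideanSpace.proj j : Space d →L[ℝ] ℝ) x :=
      (EuclideanSpace.proj (𝕜 := ℝ) j : Space d →L[ℝ] ℝ).hasFDerivAt
    have h5 := (h3.const_mul (-(1 / (d * unitBallVolume d)))).mul h4
    have h6 := h5.fderiv
    simp only [Function.comp_def] at h6
    unfold pderivAt
    erw [h6]
    simp [inner_single_one]
    ring
  simp_rw [h1]
  rw [← Finset.mul_sum, Finset.sum_sub_distrib, ← Finset.sum_mul, ← Finset.mul_sum,
    ← EuclideanSpace.real_norm_sq_eq]
  simp only [Finset.sum_const, Finset.card_univ, Fintype.card_fin, nsmul_eq_mul]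
  have h7 : (‖x‖ ^ 2 + (c ^ 2)⁻¹) ^ (-(d : ℝ) / 2) =
      (‖x‖ ^ 2 + (c ^ 2)⁻¹) * (‖x‖ ^ 2 + (c ^ 2)⁻¹) ^ (-(d : ℝ) / 2 - 1) := by
    rw [Real.rpow_sub_one hs.ne']; field_simp
  have h8 : (1 + ‖c • x‖ ^ 2) ^ (-(d : ℝ) / 2 - 1) =
      (c ^ (d + 2))⁻¹ * (‖x‖ ^ 2 + (c ^ 2)⁻¹) ^ (-(d : ℝ) / 2 - 1) := by
    have : 1 + ‖c • x‖ ^ 2 = c ^ 2 * (‖x‖ ^ 2 + (c ^ 2)⁻¹) := by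
      rw [norm_smul, Real.norm_of_nonneg hc.le]; field_simp; ring
    rw [this, Real.mul_rpow (by positivity) hs.le]
    congr 1
    rw [← Real.rpow_natCast c 2, ← Real.rpow_mul hc.le, ← Real.rpow_natCast c (d + 2),
      ← Real.rpow_neg hc.le]
    congr 1; push_cast; ring
  rw [h7, h8]
  generalize (‖x‖ ^ 2 + (c ^ 2)⁻¹) ^ (-(d : ℝ) / 2 - 1) = A
  field_simp
  ring

/-! ### Integration by parts of functions of temperate growth against Schwartz functions. -/

theorem hasTemperateGrowth_pderivAt {d : ℕ} {f : Space d → ℝ} (hf : f.HasTemperateGrowth)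
    (j : Fin d) : (pderivAt j f).HasTemperateGrowth := by
  have h1 : (fderiv ℝ f).HasTemperateGrowth := by
    refine ⟨hf.1.fderiv_right (m := ∞) (by simp), fun n => ?_⟩
    obtain ⟨k, C, h⟩ := hf.2 (n + 1)
    exact ⟨k, C, fun x => by rw [norm_iteratedFDeriv_fderiv]; exact h x⟩
  exact (ContinuousLinearMap.hasTemperateGrowth
    (ContinuousLinearMap.apply ℝ ℝ (EuclideanSpace.single j (1 : ℝ) : Space d))).comp h1

/-- The partial derivative of a Schwartz function. -/
def schwartzPderiv {d : ℕ} (j : Fin d) : 𝓢(Space d, ℂ) →L[ℂ] 𝓢(Space d, ℂ) :=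
  LineDeriv.lineDerivOpCLM ℂ 𝓢(Space d, ℂ) (EuclideanSpace.single j (1 : ℝ))

theorem coe_schwartzPderiv {d : ℕ} (j : Fin d) (φ : 𝓢(Space d, ℂ)) :
    ⇑(schwartzPderiv j φ) = pderivAt j φ := by
  ext x
  exact SchwartzMap.lineDerivOp_apply_eq_fderiv _ φ x

theorem integrable_temperate_mul {d : ℕ} {f : Space d → ℝ} (hf : f.HasTemperateGrowth)
    (φ : 𝓢(Space d, ℂ)) : Integrable (fun x => (f x : ℂ) * φ x) volume := by
  have hg : (fun x => (f x : ℂ)).HasTemperateGrowth :=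
    Function.HasTemperateGrowth.comp Function.Complex.hasTemperateGrowth_ofReal hf
  refine (SchwartzMap.smulLeftCLM ℂ (fun x => (f x : ℂ)) φ).integrable.congr
    (Eventually.of_forall fun x => ?_)
  rw [SchwartzMap.smulLeftCLM_apply_apply hg, smul_eq_mul]

/-- Integration by parts against a Schwartz function. -/
theorem integral_temperate_mul_pderiv {d : ℕ} {f : Space d → ℝ} (hf : f.HasTemperateGrowth)
    (φ : 𝓢(Space d, ℂ)) (j : Fin d) :
    ∫ x, (f x : ℂ) * schwartzPderiv j φ x = -∫ x, ((pderivAt j f x : ℝ) : ℂ) * φ x := by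
  have hd : Differentiable ℝ f := hf.1.differentiable (by simp)
  have h1 : ∀ x, fderiv ℝ (fun x => (f x : ℂ)) x (EuclideanSpace.single j 1) =
      ((pderivAt j f x : ℝ) : ℂ) := fun x => by
    have := (Complex.ofRealCLM.hasFDerivAt.comp x (hd x).hasFDerivAt).fderiv
    simp only [Function.comp_def, Complex.ofRealCLM_apply] at this
    rw [this]; rfl
  have h := integral_mul_fderiv_eq_neg_fderiv_mul_of_integrable (μ := volume)
    (f := fun x => (f x : ℂ)) (g := φ) (v := EuclideanSpace.single j (1 : ℝ)) ?_ ?_ ?_ ?_ ?_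
  · simp_rw [h1] at h
    rw [coe_schwartzPderiv]
    exact h
  · simp_rw [h1]
    exact integrable_temperate_mul (hasTemperateGrowth_pderivAt hf j) φ
  · have := integrable_temperate_mul hf (schwartzPderiv j φ)
    rwa [coe_schwartzPderiv] at this
  · exact integrable_temperate_mul hf φ
  · exact fun x _ => (Complex.ofRealCLM.differentiableAt).comp x (hd x)
  · exact fun x _ => φ.differentiableAt

/-- The Laplacian of a Schwartz function. -/
def schwartzLaplacian {d : ℕ} : 𝓢(Space d, ℂ) →L[ℂ] 𝓢(Space d, ℂ) :=
  ∑ j, schwartzPderiv j ∘L schwartzPderiv j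

theorem schwartzLaplacian_apply {d : ℕ} (φ : 𝓢(Space d, ℂ)) :
    schwartzLaplacian φ = ∑ j, schwartzPderiv j (schwartzPderiv j φ) := by
  simp [schwartzLaplacian]

theorem schwartzLaplacian_apply_apply {d : ℕ} (φ : 𝓢(Space d, ℂ)) (x : Space d) :
    schwartzLaplacian φ x = ∑ j, schwartzPderiv j (schwartzPderiv j φ) x := by
  rw [schwartzLaplacian_apply]; simp

theorem integral_temperate_mul_laplacian {d : ℕ} {f : Space d → ℝ} (hf : f.HasTemperateGrowth)
    (φ : 𝓢(Space d, ℂ)) :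
    ∫ x, (f x : ℂ) * schwartzLaplacian φ x =
      ∫ x, ((∑ j, pderivAt j (pderivAt j f) x : ℝ) : ℂ) * φ x := by
  simp_rw [schwartzLaplacian_apply_apply, Complex.ofReal_sum, Finset.mul_sum, Finset.sum_mul]
  rw [integral_finsetSum _ fun j _ => integrable_temperate_mul hf _,
    integral_finsetSum _ fun j _ => integrable_temperate_mul
      (hasTemperateGrowth_pderivAt (hasTemperateGrowth_pderivAt hf j) j) _]
  refine Finset.sum_congr rfl fun j _ => ?_
  rw [integral_temperate_mul_pderiv hf,
    integral_temperate_mul_pderiv (hasTemperateGrowth_pderivAt hf j), neg_neg]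

/-- The radial integrand has the explicit primitive `r^d (1 + r²)^{-d/2} / d`, which tends to `1/d`.
-/
theorem integral_fundKernel {d : ℕ} (hd : 2 ≤ d) :
    ∫ x : Space d, (unitBallVolume d)⁻¹ * (1 + ‖x‖ ^ 2) ^ (-(d : ℝ) / 2 - 1) = 1 := by
  have : Nonempty (Fin d) := ⟨⟨0, by omega⟩⟩
  have : Nontrivial (Space d) := inferInstance
  have hd' : (0 : ℝ) < d := by exact_mod_cast (by omega : 0 < d)
  have hV := unitBallVolume_pos d
  have h := integral_fun_norm_addHaar (E := Space d) (volume : Measure (Space d))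
    (f := fun r => (unitBallVolume d)⁻¹ * (1 + r ^ 2) ^ (-(d : ℝ) / 2 - 1))
  rw [h, finrank_euclideanSpace_fin]
  have h1 : ∫ r in Ioi (0 : ℝ), r ^ (d - 1) * (1 + r ^ 2) ^ (-(d : ℝ) / 2 - 1) = (d : ℝ)⁻¹ := by
    have hderiv : ∀ r ∈ Ici (0 : ℝ), HasDerivAt
        (fun r : ℝ => (d : ℝ)⁻¹ * (r ^ d * (1 + r ^ 2) ^ (-(d : ℝ) / 2)))
        (r ^ (d - 1) * (1 + r ^ 2) ^ (-(d : ℝ) / 2 - 1)) r := by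
      intro r hr
      have hs : 0 < 1 + r ^ 2 := by positivity
      have e1 : HasDerivAt (fun r : ℝ => 1 + r ^ 2) (2 * r) r := by
        simpa using (hasDerivAt_pow 2 r).const_add 1
      have e2 := ((hasDerivAt_pow d r).mul (e1.rpow_const (p := -(d : ℝ) / 2)
        (Or.inl hs.ne'))).const_mul ((d : ℝ)⁻¹)
      refine e2.congr_deriv ?_
      obtain ⟨m, rfl⟩ : ∃ m, d = m + 1 := ⟨d - 1, by omega⟩
      rw [Nat.add_sub_cancel, pow_succ r m,
        show (1 + r ^ 2) ^ (-((m + 1 : ℕ) : ℝ) / 2) = (1 + r ^ 2) *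
          (1 + r ^ 2) ^ (-((m + 1 : ℕ) : ℝ) / 2 - 1) by rw [Real.rpow_sub_one hs.ne']; field_simp]
      field_simp
      ring
    have hlim : Tendsto (fun r : ℝ => (d : ℝ)⁻¹ * (r ^ d * (1 + r ^ 2) ^ (-(d : ℝ) / 2))) atTop
        (𝓝 ((d : ℝ)⁻¹ * 1)) := by
      refine Tendsto.const_mul _ ?_
      have t1 : Tendsto (fun r : ℝ => (r ^ 2)⁻¹ + 1) atTop (𝓝 (0 + 1)) :=
        ((tendsto_pow_atTop two_ne_zero).inv_tendsto_atTop).add_const 1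
      have t2 := (t1.rpow_const (p := -(d : ℝ) / 2) (Or.inl (by norm_num)))
      rw [zero_add, Real.one_rpow] at t2
      refine t2.congr' ?_
      filter_upwards [eventually_gt_atTop 0] with r hr
      have e3 : (1 + r ^ 2) = r ^ 2 * ((r ^ 2)⁻¹ + 1) := by field_simp
      rw [e3, Real.mul_rpow (by positivity) (by positivity), ← mul_assoc,
        ← Real.rpow_natCast r 2, ← Real.rpow_mul hr.le, ← Real.rpow_natCast r d, ← Real.rpow_add hr]
      push_cast
      rw [show (d : ℝ) + 2 * (-(d : ℝ) / 2) = 0 by ring, Real.rpow_zero, one_mul]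
    rw [integral_Ioi_of_hasDerivAt_of_nonneg' hderiv (fun r hr => by
      have : (0 : ℝ) < r := hr
      positivity) hlim]
    simp
    omega
  have h2 : ∫ y in Ioi (0 : ℝ), y ^ (d - 1) •
      ((unitBallVolume d)⁻¹ * (1 + y ^ 2) ^ (-(d : ℝ) / 2 - 1)) =
      (unitBallVolume d)⁻¹ * (d : ℝ)⁻¹ := by
    rw [← h1, ← integral_const_mul]
    congr 1; ext y; simp only [smul_eq_mul]; ring
  rw [h2]
  change d • unitBallVolume d • ((unitBallVolume d)⁻¹ * (d : ℝ)⁻¹) = 1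
  simp only [nsmul_eq_mul, smul_eq_mul]
  field_simp

theorem tendsto_fundKernel {d : ℕ} :
    Tendsto (fun x : Space d => ‖x‖ ^ d *
      ((unitBallVolume d)⁻¹ * (1 + ‖x‖ ^ 2) ^ (-(d : ℝ) / 2 - 1))) (Bornology.cobounded _) (𝓝 0) := by
  have hV := unitBallVolume_pos d
  have h1 : Tendsto (fun x : Space d => (unitBallVolume d)⁻¹ * (‖x‖ ^ 2)⁻¹)
      (Bornology.cobounded _) (𝓝 ((unitBallVolume d)⁻¹ * 0)) :=
    (((tendsto_pow_atTop two_ne_zero).comp tendsto_norm_cobounded_atTop).inv_tendsto_atTop).const_mul _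
  rw [mul_zero] at h1
  refine squeeze_zero' (Eventually.of_forall fun x => by positivity) ?_ h1
  filter_upwards [tendsto_norm_cobounded_atTop.eventually_gt_atTop 0] with x hx
  rw [mul_left_comm]
  gcongr
  calc ‖x‖ ^ d * (1 + ‖x‖ ^ 2) ^ (-(d : ℝ) / 2 - 1)
      ≤ ‖x‖ ^ d * (‖x‖ ^ 2) ^ (-(d : ℝ) / 2 - 1) := by
        refine mul_le_mul_of_nonneg_left ?_ (by positivity)
        refine Real.rpow_le_rpow_of_nonpos (by positivity) (by linarith) ?_
        have : (0 : ℝ) ≤ d := Nat.cast_nonneg d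
        linarith
    _ = (‖x‖ ^ 2)⁻¹ := by
        rw [← Real.rpow_natCast ‖x‖ 2, ← Real.rpow_mul hx.le, ← Real.rpow_natCast ‖x‖ d,
          ← Real.rpow_add hx, ← Real.rpow_neg hx.le]
        congr 1; push_cast; ring

/-- `-ΔE = δ₀` in the sense of tempered distributions. -/
theorem integral_fundSol_mul_laplacian {d : ℕ} (hd : 2 ≤ d) (φ : 𝓢(Space d, ℂ)) :
    ∫ x, (fundSol d x : ℂ) * schwartzLaplacian φ x = -φ 0 := by
  have hV := unitBallVolume_pos d
  -- With the Laplacian moved onto the regularized solution, the integral is minus an average of `φ`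
  -- against an approximate identity.
  have lim1 : Tendsto (fun c : ℝ => ∫ x, (smoothFundSol d c x : ℂ) * schwartzLaplacian φ x) atTop
      (𝓝 (-φ 0)) := by
    have h := (tendsto_integral_comp_smul_smul_of_integrable (μ := (volume : Measure (Space d)))
      (φ := fun x : Space d => (unitBallVolume d)⁻¹ * (1 + ‖x‖ ^ 2) ^ (-(d : ℝ) / 2 - 1))
      (fun x => by positivity) (integral_fundKernel hd)
      (by rw [finrank_euclideanSpace_fin]; exact tendsto_fundKernel)
      φ.integrable φ.continuous.continuousAt).neg
    refine h.congr' ?_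
    filter_upwards [eventually_gt_atTop 0] with c hc
    rw [integral_temperate_mul_laplacian (hasTemperateGrowth_smoothFundSol hd hc), ← integral_neg]
    congr 1; ext x
    rw [sum_pderiv_smoothFundSol hd hc, finrank_euclideanSpace_fin, Complex.real_smul]
    push_cast; ring
  -- The same integrals converge to the one with `E` by dominated convergence; `c ≥ 1` makes the
  -- shift `c⁻²` at most 1, as the majorant requires.
  have lim2 : Tendsto (fun c : ℝ => ∫ x, (smoothFundSol d c x : ℂ) * schwartzLaplacian φ x) atTop
      (𝓝 (∫ x, (fundSol d x : ℂ) * schwartzLaplacian φ x)) := by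
    obtain ⟨C, hC, hb⟩ := exists_fundProfile_bound hd
    set ψ := schwartzLaplacian φ
    refine tendsto_integral_filter_of_dominated_convergence
      (fun x => C * schwartzDecay (d + 3) ψ * (fundMajorant d x * decayWeight (d + 3) x))
      ?_ ?_ ((integrable_fundMajorant hd).const_mul _) ?_
    · filter_upwards [eventually_gt_atTop 0] with c hc
      exact (integrable_temperate_mul (hasTemperateGrowth_smoothFundSol hd hc) _).1
    · filter_upwards [eventually_ge_atTop 1] with c hc
      filter_upwards [ae_ne_zero hd] with x hx
      rw [norm_mul, Complex.norm_real, Real.norm_eq_abs]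
      have h1 : |smoothFundSol d c x| ≤ C * fundMajorant d x :=
        norm_fundProfile_add_le hd hC hb hx (by positivity)
          (inv_le_one_of_one_le₀ (one_le_pow₀ hc))
      calc |smoothFundSol d c x| * ‖ψ x‖
          ≤ (C * fundMajorant d x) * (schwartzDecay (d + 3) ψ * decayWeight (d + 3) x) := by
            gcongr
            · exact (abs_nonneg _).trans h1
            · exact norm_le_schwartzDecay _ _ _
        _ = _ := by ring
    · filter_upwards [ae_ne_zero hd] with x hx
      refine Tendsto.mul_const _ ?_
      refine (Complex.continuous_ofReal.tendsto _).comp ?_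
      rw [← fundProfile_norm_sq hx]
      have hx' : 0 < ‖x‖ ^ 2 := by have := norm_pos_iff.2 hx; positivity
      refine ((hasDerivAt_fundProfile hd hx').continuousAt.tendsto).comp ?_
      have : Tendsto (fun c : ℝ => ‖x‖ ^ 2 + (c ^ 2)⁻¹) atTop (𝓝 (‖x‖ ^ 2 + 0)) :=
        ((tendsto_pow_atTop two_ne_zero).inv_tendsto_atTop).const_add _
      rwa [add_zero] at this
  exact tendsto_nhds_unique lim2 lim1

/-! ### Fourier multipliers acting on Schwartz functions -/

/-- The transpose `φ ↦ 𝓕 (m · 𝓕⁻ φ)` of the Fourier multiplier of symbol `m`, for a symbol of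
temperate growth. -/
def transMult {d : ℕ} (m : Space d → ℂ) : 𝓢(Space d, ℂ) →L[ℂ] 𝓢(Space d, ℂ) :=
  FourierTransform.fourierCLM ℂ 𝓢(Space d, ℂ) ∘L SchwartzMap.smulLeftCLM ℂ m ∘L
    FourierTransform.fourierInvCLM ℂ 𝓢(Space d, ℂ)

theorem transMult_apply {d : ℕ} (m : Space d → ℂ) (φ : 𝓢(Space d, ℂ)) :
    transMult m φ = 𝓕 (SchwartzMap.smulLeftCLM ℂ m (𝓕⁻ φ)) := rfl

theorem fourierMultiplier_apply_eq_transMult {d : ℕ} (m : Space d → ℂ) (f : 𝓢'(Space d, ℂ))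
    (φ : 𝓢(Space d, ℂ)) :
    TemperedDistribution.fourierMultiplierCLM ℂ m f φ = f (transMult m φ) := rfl

/-- The function `𝓕 (m · 𝓕⁻ φ)` for a symbol that need not be smooth. -/
def symbolFun {d : ℕ} (m : Space d → ℂ) (φ : 𝓢(Space d, ℂ)) : Space d → ℂ :=
  𝓕 (fun ξ => m ξ * (𝓕⁻ φ : 𝓢(Space d, ℂ)) ξ)

theorem coe_transMult {d : ℕ} {m : Space d → ℂ} (hm : m.HasTemperateGrowth) (φ : 𝓢(Space d, ℂ)) :
    ⇑(transMult m φ) = symbolFun m φ := by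
  rw [transMult_apply, SchwartzMap.fourier_coe, symbolFun]
  congr 1
  ext ξ
  rw [SchwartzMap.smulLeftCLM_apply_apply hm, smul_eq_mul]

theorem symbolFun_congr {d : ℕ} {m m' : Space d → ℂ} (h : m =ᵐ[volume] m')
    (φ : 𝓢(Space d, ℂ)) : symbolFun m φ = symbolFun m' φ := by
  ext y
  refine Real.fourier_congr_ae ?_ y
  filter_upwards [h] with ξ hξ
  rw [hξ]

theorem symbolFun_eq_integral {d : ℕ} (m : Space d → ℂ) (φ : 𝓢(Space d, ℂ)) (y : Space d) :
    symbolFun m φ y = ∫ ξ, Real.fourierChar (-inner ℝ ξ y) •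
      (m ξ * (𝓕⁻ φ : 𝓢(Space d, ℂ)) ξ) := Real.fourier_eq _ _

theorem symbolFun_sum {d : ℕ} {ι : Type*} (s : Finset ι) (m : ι → Space d → ℂ)
    (φ : ι → 𝓢(Space d, ℂ))
    (h : ∀ i ∈ s, Integrable (fun ξ => m i ξ * (𝓕⁻ (φ i) : 𝓢(Space d, ℂ)) ξ) volume)
    (y : Space d) :
    ∑ i ∈ s, symbolFun (m i) (φ i) y =
      𝓕 (fun ξ => ∑ i ∈ s, m i ξ * (𝓕⁻ (φ i) : 𝓢(Space d, ℂ)) ξ) y := by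
  simp_rw [symbolFun_eq_integral]
  rw [Real.fourier_eq, ← integral_finsetSum]
  · simp_rw [Finset.smul_sum]
  · intro i hi
    exact (Real.fourierIntegral_convergent_iff y).2 (h i hi)

theorem symbolFun_add {d : ℕ} {m m' : Space d → ℂ} {φ : 𝓢(Space d, ℂ)}
    (h : Integrable (fun ξ => m ξ * (𝓕⁻ φ : 𝓢(Space d, ℂ)) ξ) volume)
    (h' : Integrable (fun ξ => m' ξ * (𝓕⁻ φ : 𝓢(Space d, ℂ)) ξ) volume) (y : Space d) :
    symbolFun (fun ξ => m ξ + m' ξ) φ y = symbolFun m φ y + symbolFun m' φ y := by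
  simp_rw [symbolFun_eq_integral]
  rw [← integral_add]
  · simp_rw [add_mul, smul_add]
  · exact (Real.fourierIntegral_convergent_iff y).2 h
  · exact (Real.fourierIntegral_convergent_iff y).2 h'

theorem fourier_comp_sub {d : ℕ} (K : Space d → ℂ) (y ξ : Space d) :
    𝓕 (fun x => K (x - y)) ξ = Real.fourierChar (-inner ℝ y ξ) • 𝓕 K ξ := by
  have h := VectorFourier.fourierIntegral_comp_add_right Real.fourierChar
    (volume : Measure (Space d)) (innerₗ (Space d)) K (-y)
  have h2 := congrFun h ξ
  simpa [sub_eq_add_neg, Function.comp_def] using! h2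

/-- Convolution with an integrable kernel is the Fourier multiplier by the transform of the
kernel. -/
theorem integral_kernel_mul_eq_symbolFun {d : ℕ} {K m : Space d → ℂ} (hK : Integrable K volume)
    (hm : 𝓕 K =ᵐ[volume] m) (φ : 𝓢(Space d, ℂ)) (y : Space d) :
    ∫ x, K (x - y) * φ x = symbolFun m φ y := by
  -- `φ` is written as the transform of `𝓕⁻ φ` and the transform is moved onto the translated
  -- kernel, where the translation becomes the character of `symbolFun`.
  have h := VectorFourier.integral_fourierIntegral_smul_eq_flip (μ := (volume : Measure (Space d)))
    (ν := (volume : Measure (Space d))) (e := Real.fourierChar) (L := innerₗ (Space d))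
    (f := fun x => K (x - y)) (g := (𝓕⁻ φ : 𝓢(Space d, ℂ))) Real.continuous_fourierChar
    (by exact continuous_inner) (hK.comp_sub_right y) (𝓕⁻ φ : 𝓢(Space d, ℂ)).integrable
  have e1 : ∀ x, VectorFourier.fourierIntegral Real.fourierChar volume (innerₗ (Space d)).flip
      (𝓕⁻ φ : 𝓢(Space d, ℂ)) x = φ x := by
    intro x
    have : (𝓕 (𝓕⁻ φ : 𝓢(Space d, ℂ)) : 𝓢(Space d, ℂ)) x = φ x := by
      rw [FourierTransform.fourier_fourierInv_eq]
    rw [← this, flip_innerₗ]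
    rfl
  simp_rw [e1] at h
  simp only [smul_eq_mul] at h
  rw [← h, symbolFun_eq_integral]
  refine integral_congr_ae ?_
  filter_upwards [hm] with ξ hξ
  have e2 := fourier_comp_sub K y ξ
  rw [hξ] at e2
  have e3 : VectorFourier.fourierIntegral Real.fourierChar volume (innerₗ (Space d))
      (fun x => K (x - y)) ξ = 𝓕 (fun x => K (x - y)) ξ := rfl
  rw [e3, e2, real_inner_comm, Circle.smul_def, Circle.smul_def, smul_eq_mul, smul_eq_mul, mul_assoc]

/-! ### The symbols -/

/-- The symbol `iη_l` of `∂_l`, where `η = 2πξ`. -/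
def derivSymbol {d : ℕ} (l : Fin d) (ξ : Space d) : ℂ :=
  Complex.I * ((((2 * Real.pi) • ξ : Space d) l : ℝ) : ℂ)

/-- The symbol `(iη_l)(iη_j)(iη_k) / |η|²` of `∂_l (-Δ)^{-1} ∂_j ∂_k`. -/
def pressureSymbol {d : ℕ} (l j k : Fin d) (ξ : Space d) : ℂ :=
  derivSymbol l ξ * derivSymbol j ξ * derivSymbol k ξ / ((‖(2 * Real.pi) • ξ‖ ^ 2 : ℝ) : ℂ)

/-- The symbol `χ(λη)` of `χ(λD)`. -/
def cutoffSymbol {d : ℕ} (χ : Space d → ℝ) (lam : ℝ) (ξ : Space d) : ℂ :=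
  ((χ ((lam * (2 * Real.pi)) • ξ) : ℝ) : ℂ)

/-- The complementary factor, `cutoffSymbol χ 1` times the pressure symbol, will be the Fourier
transform of `Γ`. -/
theorem highFreqSymbol_eq {d : ℕ} (χ : Space d → ℝ) (l j k : Fin d) (ξ : Space d) :
    highFreqSymbol χ l j k ξ = (1 - cutoffSymbol χ 1 ξ) * pressureSymbol l j k ξ := by
  simp only [highFreqSymbol, cutoffSymbol, pressureSymbol, derivSymbol, one_mul]
  push_cast
  ring

theorem hasTemperateGrowth_derivSymbol {d : ℕ} (l : Fin d) :
    (derivSymbol l).HasTemperateGrowth := by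
  have h : derivSymbol l = ⇑((Complex.I • Complex.ofRealCLM) ∘L
      (EuclideanSpace.proj (𝕜 := ℝ) l : Space d →L[ℝ] ℝ) ∘L
      ((2 * Real.pi) • ContinuousLinearMap.id ℝ (Space d))) := by
    ext ξ
    simp [derivSymbol]
    ring
  rw [h]
  exact ContinuousLinearMap.hasTemperateGrowth _

theorem schwartzPderiv_fourier {d : ℕ} (j : Fin d) (f : 𝓢(Space d, ℂ)) :
    schwartzPderiv j (𝓕 f) = -𝓕 (SchwartzMap.smulLeftCLM ℂ (derivSymbol j) f) := by
  have h := SchwartzMap.lineDerivOp_fourier_eq f (EuclideanSpace.single j (1 : ℝ))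
  change schwartzPderiv j (𝓕 f) = _ at h
  rw [h, ← FourierTransform.fourier_neg]
  congr 1
  ext ξ
  have h1 : (fun x : Space d => inner ℝ x (EuclideanSpace.single j (1 : ℝ))).HasTemperateGrowth := by
    fun_prop
  rw [neg_apply, SchwartzMap.smulLeftCLM_apply_apply (hasTemperateGrowth_derivSymbol j),
    smul_apply, SchwartzMap.smulLeftCLM_apply_apply h1, inner_single_one]
  simp [derivSymbol]
  ring

theorem fourierInv_schwartzPderiv {d : ℕ} (j : Fin d) (φ : 𝓢(Space d, ℂ)) (ξ : Space d) :
    (𝓕⁻ (schwartzPderiv j φ) : 𝓢(Space d, ℂ)) ξ =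
      -(derivSymbol j ξ * (𝓕⁻ φ : 𝓢(Space d, ℂ)) ξ) := by
  have h := schwartzPderiv_fourier j (𝓕⁻ φ)
  rw [FourierTransform.fourier_fourierInv_eq] at h
  rw [h, FourierTransform.fourierInv_neg, FourierTransform.fourierInv_fourier_eq,
    neg_apply, SchwartzMap.smulLeftCLM_apply_apply (hasTemperateGrowth_derivSymbol j),
    smul_eq_mul]

theorem fourier_schwartzPderiv {d : ℕ} (j : Fin d) (φ : 𝓢(Space d, ℂ)) (ξ : Space d) :
    (𝓕 (schwartzPderiv j φ) : 𝓢(Space d, ℂ)) ξ =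
      derivSymbol j ξ * (𝓕 φ : 𝓢(Space d, ℂ)) ξ := by
  have h := SchwartzMap.fourier_lineDerivOp_eq φ (EuclideanSpace.single j (1 : ℝ))
  change 𝓕 (schwartzPderiv j φ) = _ at h
  have h1 : (fun x : Space d => inner ℝ x (EuclideanSpace.single j (1 : ℝ))).HasTemperateGrowth := by
    fun_prop
  rw [h, smul_apply, SchwartzMap.smulLeftCLM_apply_apply h1, inner_single_one]
  simp [derivSymbol]
  ring

theorem hasTemperateGrowth_cutoffSymbol {d : ℕ} {χ : Space d → ℝ} (hχ : IsCutoff χ) {lam : ℝ}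
    (hl : lam ≠ 0) : (cutoffSymbol χ lam).HasTemperateGrowth ∧
      HasCompactSupport (cutoffSymbol χ lam) ∧ ContDiff ℝ ∞ (cutoffSymbol χ lam) := by
  have hc : lam * (2 * Real.pi) ≠ 0 := mul_ne_zero hl (by positivity)
  have h1 : ContDiff ℝ ∞ (cutoffSymbol χ lam) :=
    Complex.ofRealCLM.contDiff.comp (hχ.smooth.comp (contDiff_const_smul _))
  have h2 : HasCompactSupport (cutoffSymbol χ lam) := by
    have := (hχ.hasCompactSupport.comp_smul hc).comp_left (g := Complex.ofReal) Complex.ofReal_zero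
    exact this
  exact ⟨h2.hasTemperateGrowth h1, h2, h1⟩

/-- `x_l x_j x_k |x|^{-2}` is homogeneous of degree 1 and the factor `1 - χ` removes its only
singularity. Without temperate growth `fourierMultiplierCLM` would not be the intended operator. -/
theorem hasTemperateGrowth_highFreqSymbol {d : ℕ} {χ : Space d → ℝ} (hχ : IsCutoff χ)
    (l j k : Fin d) : (highFreqSymbol χ l j k).HasTemperateGrowth := by
  have h1 : IsHomogeneous (1 + 1 + 1 + -2 : ℤ) (fun x : Space d => x l * x j * x k * ‖x‖ ^ (-2 : ℤ)) :=
    (((isHomogeneous_coord l).mul (isHomogeneous_coord j)).mul (isHomogeneous_coord k)).mul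
      (isHomogeneous_norm_zpow d _)
  have h2 := hχ.hasTemperateGrowth_one_sub_smul h1
  have h3 := (Function.Complex.hasTemperateGrowth_ofReal.comp h2).comp
    (ContinuousLinearMap.hasTemperateGrowth ((2 * Real.pi) • ContinuousLinearMap.id ℝ (Space d)))
  have h4 : highFreqSymbol χ l j k = fun ξ => (Complex.I ^ 3) *
      ((Complex.ofReal ∘ fun x : Space d => (1 - χ x) • (x l * x j * x k * ‖x‖ ^ (-2 : ℤ))) ∘
        ((2 * Real.pi) • ContinuousLinearMap.id ℝ (Space d))) ξ := by
    ext ξ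
    simp only [highFreqSymbol, Function.comp, smul_apply, ContinuousLinearMap.id_apply, smul_eq_mul,
      zpow_neg]
    rw [show ((2 : ℤ)) = ((2 : ℕ) : ℤ) by rfl, zpow_natCast]
    push_cast
    ring
  rw [h4]
  exact (Function.HasTemperateGrowth.const _).mul h3

/-- The symbol `(1 - χ(λη)) / |η|²`. -/
def invLaplaceSymbol {d : ℕ} (χ : Space d → ℝ) (lam : ℝ) (ξ : Space d) : ℂ :=
  (1 - cutoffSymbol χ lam ξ) / ((‖(2 * Real.pi) • ξ‖ ^ 2 : ℝ) : ℂ)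

theorem hasTemperateGrowth_invLaplaceSymbol {d : ℕ} {χ : Space d → ℝ} (hχ : IsCutoff χ) {lam : ℝ}
    (hl : lam ≠ 0) : (invLaplaceSymbol χ lam).HasTemperateGrowth := by
  have h2 := hχ.hasTemperateGrowth_one_sub_smul (isHomogeneous_norm_zpow d (-2))
  have h3 := (Function.Complex.hasTemperateGrowth_ofReal.comp h2).comp
    (ContinuousLinearMap.hasTemperateGrowth
      ((lam * (2 * Real.pi)) • ContinuousLinearMap.id ℝ (Space d)))
  have h4 : invLaplaceSymbol χ lam = fun ξ => ((lam ^ 2 : ℝ) : ℂ) *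
      ((Complex.ofReal ∘ fun x : Space d => (1 - χ x) • (‖x‖ ^ (-2 : ℤ))) ∘
        ((lam * (2 * Real.pi)) • ContinuousLinearMap.id ℝ (Space d))) ξ := by
    ext ξ
    simp only [invLaplaceSymbol, cutoffSymbol, Function.comp, smul_apply,
      ContinuousLinearMap.id_apply, smul_eq_mul, zpow_neg]
    have e : ‖(lam * (2 * Real.pi)) • ξ‖ ^ 2 = lam ^ 2 * ‖(2 * Real.pi) • ξ‖ ^ 2 := by
      rw [mul_smul, norm_smul, mul_pow, Real.norm_eq_abs, sq_abs]
    rw [show ((2 : ℤ)) = ((2 : ℕ) : ℤ) by rfl, zpow_natCast, e, mul_inv]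
    have : (lam : ℂ) ≠ 0 := by exact_mod_cast hl
    push_cast
    field_simp
  rw [h4]
  exact (Function.HasTemperateGrowth.const _).mul h3

/-! ### The kernel `Γ` -/

/-- For the part of `Γ` near the origin: `θE` has all moments but no pointwise bound, so the decay
comes entirely from the Schwartz factor. -/
theorem norm_convolution_le_of_moment {d N : ℕ} {K f : Space d → ℂ} {C : ℝ} (hC : 0 ≤ C)
    (hK : ∀ z, ‖K z‖ ≤ C * decayWeight N z)
    (hf : Integrable (fun y => (1 + ‖y‖) ^ N * ‖f y‖) volume) (x : Space d) :
    ‖∫ y, K (x - y) * f y‖ ≤ C * (∫ y, (1 + ‖y‖) ^ N * ‖f y‖) * decayWeight N x := by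
  calc ‖∫ y, K (x - y) * f y‖ ≤ ∫ y, C * decayWeight N x * ((1 + ‖y‖) ^ N * ‖f y‖) := by
        refine norm_integral_le_of_norm_le (hf.const_mul _) (Eventually.of_forall fun y => ?_)
        have h1 : decayWeight N (x - y) ≤ decayWeight N x * (1 + ‖y‖) ^ N := by
          have h2 := decayWeight_mul_le N (x - y) y x
            (by simpa using norm_add_le (x - y) y)
          rw [decayWeight, decayWeight] at h2 ⊢
          rw [decayWeight, ← div_eq_mul_inv, div_le_iff₀ (by positivity)] at h2
          exact h2
        calc ‖K (x - y) * f y‖ = ‖K (x - y)‖ * ‖f y‖ := norm_mul _ _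
          _ ≤ (C * (decayWeight N x * (1 + ‖y‖) ^ N)) * ‖f y‖ := by
              gcongr
              exact (hK _).trans (by gcongr)
          _ = _ := by ring
    _ = _ := by rw [integral_const_mul]; ring

theorem continuous_convolution_of_integrable {d : ℕ} {K f : Space d → ℂ} {C : ℝ}
    (hKm : Continuous K) (hK : ∀ z, ‖K z‖ ≤ C) (hf : Integrable f volume) :
    Continuous (fun x => ∫ y, K (x - y) * f y) := by
  refine continuous_of_dominated (bound := fun y => C * ‖f y‖) (fun x => ?_) (fun x => ?_)
    (hf.norm.const_mul C) (Eventually.of_forall fun y => by fun_prop)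
  · exact AEStronglyMeasurable.mul (by fun_prop) hf.1
  · refine Eventually.of_forall fun y => ?_
    rw [norm_mul]
    gcongr
    exact hK _

/-- The part of the fundamental solution near the origin. -/
def nearFundSol {d : ℕ} (θ : Space d → ℝ) (y : Space d) : ℂ := ((θ y * fundSol d y : ℝ) : ℂ)

/-- The third derivatives of the regularized fundamental solution. -/
def farKernel {d : ℕ} (θ : Space d → ℝ) (l j k : Fin d) (y : Space d) : ℂ :=
  ((pderivAt l (pderivAt j (pderivAt k (regularFundSol θ))) y : ℝ) : ℂ)

/-- On the support `1 + |y| < 3`: `N` factors of 3 pay for the moment and `d + 3` for inserting the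
weight that makes `E` integrable. -/
theorem norm_nearFundSol_le {d : ℕ} {θ : Space d → ℝ} (hθ : IsCutoff θ) (N : ℕ) (y : Space d) :
    (1 + ‖y‖) ^ N * ‖nearFundSol θ y‖ ≤
      3 ^ (N + (d + 3)) * ‖(decayWeight (d + 3) y : ℂ) * (fundSol d y : ℂ)‖ := by
  rcases le_or_gt 2 ‖y‖ with hy | hy
  · have h0 : θ y = 0 := (hθ.eq_zero hy).eq_of_nhds
    rw [nearFundSol, h0]
    simp only [zero_mul, Complex.ofReal_zero, norm_zero, mul_zero]
    positivity
  · rw [nearFundSol, norm_mul, Complex.norm_real, Complex.norm_real, Complex.norm_real, norm_mul,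
      Real.norm_of_nonneg (decayWeight_nonneg _ _), Real.norm_of_nonneg (hθ.nonneg y), pow_add,
      ← mul_assoc, ← mul_assoc]
    refine mul_le_mul_of_nonneg_right ?_ (norm_nonneg _)
    have h1 : (1 + ‖y‖) ^ N ≤ 3 ^ N := by gcongr; linarith
    have h2 : (1 : ℝ) ≤ 3 ^ (d + 3) * decayWeight (d + 3) y := by
      unfold decayWeight
      rw [← div_eq_mul_inv, one_le_div (by positivity)]
      gcongr; linarith
    calc (1 + ‖y‖) ^ N * θ y ≤ 3 ^ N * 1 := by
          gcongr
          · exact hθ.nonneg y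
          · exact hθ.le_one y
      _ ≤ 3 ^ N * (3 ^ (d + 3) * decayWeight (d + 3) y) := by gcongr
      _ = _ := by ring

theorem measurable_nearFundSol {d : ℕ} {θ : Space d → ℝ} (hθ : IsCutoff θ) :
    Measurable (nearFundSol θ) :=
  Complex.measurable_ofReal.comp (hθ.smooth.continuous.measurable.mul (measurable_fundSol d))

theorem integrable_moment_nearFundSol {d : ℕ} (hd : 2 ≤ d) {θ : Space d → ℝ} (hθ : IsCutoff θ)
    (N : ℕ) : Integrable (fun y => (1 + ‖y‖) ^ N * ‖nearFundSol θ y‖) volume := by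
  refine ((integrable_decayWeight_mul_fundSol hd).norm.const_mul (3 ^ (N + (d + 3)))).mono' ?_
    (Eventually.of_forall fun y => ?_)
  · have := measurable_nearFundSol hθ
    exact Measurable.aestronglyMeasurable (by fun_prop)
  · rw [Real.norm_of_nonneg (by positivity)]
    exact norm_nearFundSol_le hθ N y

theorem integrable_nearFundSol {d : ℕ} (hd : 2 ≤ d) {θ : Space d → ℝ} (hθ : IsCutoff θ) :
    Integrable (nearFundSol θ) volume := by
  have h := integrable_moment_nearFundSol hd hθ 0
  simp only [pow_zero, one_mul] at h
  exact (integrable_norm_iff (measurable_nearFundSol hθ).aestronglyMeasurable).1 h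

theorem continuous_farKernel {d : ℕ} {θ : Space d → ℝ} (hθ : IsCutoff θ) (l j k : Fin d) :
    Continuous (farKernel θ l j k) :=
  Complex.continuous_ofReal.comp (contDiff_pderivAt l (contDiff_pderivAt j (contDiff_pderivAt k
      (contDiff_regularFundSol hθ)))).continuous

theorem exists_decay_farKernel {d : ℕ} {θ : Space d → ℝ} (hθ : IsCutoff θ) (l j k : Fin d) :
    ∃ C : ℝ, 0 ≤ C ∧ ∀ x, ‖farKernel θ l j k x‖ ≤ C * decayWeight (d + 1) x := by
  obtain ⟨C, hC, h⟩ := exists_decay_pderiv_regularFundSol hθ l j k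
  exact ⟨C, hC, fun x => by rw [farKernel, Complex.norm_real]; exact h x⟩

theorem integrable_of_decay {d : ℕ} {f : Space d → ℂ} (hf : Continuous f) {C : ℝ}
    (h : ∀ x, ‖f x‖ ≤ C * decayWeight (d + 1) x) : Integrable f volume :=
  ((integrable_decayWeight (Nat.lt_succ_self d)).const_mul C).mono' hf.aestronglyMeasurable
    (Eventually.of_forall h)

/-- The third derivative of a Schwartz function. -/
def schwartzPderiv₃ {d : ℕ} (l j k : Fin d) (φ : 𝓢(Space d, ℂ)) : 𝓢(Space d, ℂ) :=
  schwartzPderiv l (schwartzPderiv j (schwartzPderiv k φ))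

/-- The kernel of `χ(D)` as a Schwartz function. -/
def cutoffSchwartz {d : ℕ} {χ : Space d → ℝ} (hχ : IsCutoff χ) : 𝓢(Space d, ℂ) :=
  𝓕⁻ (HasCompactSupport.toSchwartzMap (hasTemperateGrowth_cutoffSymbol hχ one_ne_zero).2.1
    (hasTemperateGrowth_cutoffSymbol hχ one_ne_zero).2.2)

theorem fourier_cutoffSchwartz {d : ℕ} {χ : Space d → ℝ} (hχ : IsCutoff χ) (ξ : Space d) :
    (𝓕 (cutoffSchwartz hχ) : 𝓢(Space d, ℂ)) ξ = cutoffSymbol χ 1 ξ := by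
  rw [cutoffSchwartz, FourierTransform.fourier_fourierInv_eq]
  rfl

theorem coe_cutoffSchwartz {d : ℕ} {χ : Space d → ℝ} (hχ : IsCutoff χ) :
    ⇑(cutoffSchwartz hχ) = cutoffKernel χ := by
  rw [cutoffSchwartz, SchwartzMap.fourierInv_coe, cutoffKernel]
  congr 1
  ext ξ
  simp [cutoffSymbol]

theorem coe_schwartzPderiv₃ {d : ℕ} (l j k : Fin d) (φ : 𝓢(Space d, ℂ)) :
    ⇑(schwartzPderiv₃ l j k φ) = pderivAt l (pderivAt j (pderivAt k φ)) := by
  rw [schwartzPderiv₃, coe_schwartzPderiv, coe_schwartzPderiv, coe_schwartzPderiv]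

theorem pressureKernel_eq {d : ℕ} {χ : Space d → ℝ} (hχ : IsCutoff χ) (θ : Space d → ℝ)
    (l j k : Fin d) (x : Space d) :
    pressureKernel χ θ l j k x =
      (∫ y, schwartzPderiv₃ l j k (cutoffSchwartz hχ) (x - y) * nearFundSol θ y) +
        ∫ y, cutoffSchwartz hχ (x - y) * farKernel θ l j k y := by
  rw [coe_schwartzPderiv₃, coe_cutoffSchwartz]
  rfl

theorem continuous_pressureKernel {d : ℕ} (hd : 2 ≤ d) {χ θ : Space d → ℝ} (hχ : IsCutoff χ)
    (hθ : IsCutoff θ) (l j k : Fin d) : Continuous (pressureKernel χ θ l j k) := by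
  obtain ⟨C, -, hC⟩ := exists_decay_farKernel hθ l j k
  rw [funext (pressureKernel_eq hχ θ l j k)]
  refine Continuous.add ?_ ?_
  · exact continuous_convolution_of_integrable (SchwartzMap.continuous _)
      (SchwartzMap.norm_le_seminorm ℂ _) (integrable_nearFundSol hd hθ)
  · exact continuous_convolution_of_integrable (SchwartzMap.continuous _)
      (SchwartzMap.norm_le_seminorm ℂ _)
      (integrable_of_decay (continuous_farKernel hθ l j k) hC)

/-- The kernel `Γ` decays like `|x|^{-d-1}`. -/
theorem exists_decay_pressureKernel {d : ℕ} (hd : 2 ≤ d) {χ θ : Space d → ℝ} (hχ : IsCutoff χ)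
    (hθ : IsCutoff θ) (l j k : Fin d) :
    ∃ C : ℝ, 0 ≤ C ∧ ∀ x, ‖pressureKernel χ θ l j k x‖ ≤ C * decayWeight (d + 1) x := by
  obtain ⟨C, hC, hCb⟩ := exists_decay_farKernel hθ l j k
  set ψ := cutoffSchwartz hχ with hψ
  set ψ₃ := schwartzPderiv₃ l j k ψ with hψ₃
  have hM : 0 ≤ ∫ y, (1 + ‖y‖) ^ (d + 1) * ‖nearFundSol θ y‖ :=
    integral_nonneg fun y => by positivity
  refine ⟨schwartzDecay (d + 1) ψ₃ * (∫ y, (1 + ‖y‖) ^ (d + 1) * ‖nearFundSol θ y‖) +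
    C * schwartzDecay ((d + 1) + (d + 1)) ψ * weightMass d, ?_, fun x => ?_⟩
  · have := schwartzDecay_nonneg (d + 1) ψ₃
    have := schwartzDecay_nonneg ((d + 1) + (d + 1)) ψ
    have := weightMass_nonneg d
    positivity
  · rw [pressureKernel_eq hχ]
    refine (norm_add_le _ _).trans ?_
    rw [add_mul]
    refine add_le_add ?_ ?_
    · exact norm_convolution_le_of_moment (schwartzDecay_nonneg _ _)
        (norm_le_schwartzDecay (d + 1) ψ₃) (integrable_moment_nearFundSol hd hθ (d + 1)) x
    · have h1 : ∫ y, ψ (x - y) * farKernel θ l j k y =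
          ∫ z, (fun w => farKernel θ l j k (-w)) (z - x) * ψ z := by
        rw [← integral_sub_left_eq_self _ volume x]
        congr 1; ext y
        simp [mul_comm]
      rw [h1]
      refine norm_integral_kernel_mul_le (N := d + 1) (K := fun w => farKernel θ l j k (-w)) hC
        (fun z => ?_)
        (norm_le_schwartzDecay ((d + 1) + (d + 1)) ψ) x
      have := hCb (-z)
      rwa [decayWeight, norm_neg] at this

theorem integrable_pressureKernel {d : ℕ} (hd : 2 ≤ d) {χ θ : Space d → ℝ} (hχ : IsCutoff χ)
    (hθ : IsCutoff θ) (l j k : Fin d) : Integrable (pressureKernel χ θ l j k) volume := by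
  obtain ⟨C, -, hC⟩ := exists_decay_pressureKernel hd hχ hθ l j k
  exact integrable_of_decay (continuous_pressureKernel hd hχ hθ l j k) hC

/-! ### The Fourier transform of `Γ`. -/

theorem transMult_symm {d : ℕ} {m : Space d → ℂ} (hm : m.HasTemperateGrowth) (j : Fin d)
    (φ : 𝓢(Space d, ℂ)) :
    schwartzPderiv j (transMult m φ) = -transMult (fun ξ => derivSymbol j ξ * m ξ) φ := by
  rw [transMult_apply, schwartzPderiv_fourier, transMult_apply,
    SchwartzMap.smulLeftCLM_smulLeftCLM_apply (hasTemperateGrowth_derivSymbol j) hm]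
  rfl

theorem schwartzPderiv₃_transMult {d : ℕ} {m : Space d → ℂ} (hm : m.HasTemperateGrowth)
    (l j k : Fin d) (φ : 𝓢(Space d, ℂ)) :
    schwartzPderiv₃ l j k (transMult m φ) =
      -transMult (fun ξ => derivSymbol l ξ * derivSymbol j ξ * derivSymbol k ξ * m ξ) φ := by
  have hk : (fun ξ => derivSymbol k ξ * m ξ).HasTemperateGrowth :=
    (hasTemperateGrowth_derivSymbol k).mul hm
  have hj : (fun ξ => derivSymbol j ξ * (derivSymbol k ξ * m ξ)).HasTemperateGrowth :=
    (hasTemperateGrowth_derivSymbol j).mul hk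
  rw [schwartzPderiv₃, transMult_symm hm, map_neg, transMult_symm hk, map_neg, map_neg,
    transMult_symm hj, neg_neg]
  congr 2
  ext ξ; ring_nf

/-- The symbol `(iη_l)(iη_j)(iη_k)χ(η)` of `∂_l∂_j∂_k χ(D)`. -/
def cutoffDerivSymbol {d : ℕ} (χ : Space d → ℝ) (l j k : Fin d) (ξ : Space d) : ℂ :=
  derivSymbol l ξ * derivSymbol j ξ * derivSymbol k ξ * cutoffSymbol χ 1 ξ

theorem hasTemperateGrowth_cutoffDerivSymbol {d : ℕ} {χ : Space d → ℝ} (hχ : IsCutoff χ)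
    (l j k : Fin d) : (cutoffDerivSymbol χ l j k).HasTemperateGrowth :=
  (((hasTemperateGrowth_derivSymbol l).mul (hasTemperateGrowth_derivSymbol j)).mul
    (hasTemperateGrowth_derivSymbol k)).mul (hasTemperateGrowth_cutoffSymbol hχ one_ne_zero).1

/-- `E` itself is not homogeneous for `d = 2`, but its gradient is. So homogeneity gives the growth
of the derivative, and the crude majorant that of the function. -/
theorem hasTemperateGrowth_regularFundSol {d : ℕ} (hd : 2 ≤ d) {θ : Space d → ℝ}
    (hθ : IsCutoff θ) : (regularFundSol θ).HasTemperateGrowth := by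
  have hs := contDiff_regularFundSol hθ
  obtain ⟨C, hC, hb⟩ := exists_fundSol_bound hd
  have h1 : (fderiv ℝ (regularFundSol θ)).HasTemperateGrowth :=
    (isHomogeneous_fderiv_fundSol d).hasTemperateGrowth_of_eq
      (hs.fderiv_right (m := ∞) (by simp)) two_pos
      fun x hx => (regularFundSol_eventuallyEq hθ hx).fderiv
  refine Function.HasTemperateGrowth.of_fderiv (k := 2) (C := 2 * C) h1
    (hs.differentiable (by simp)) fun x => ?_
  rcases le_or_gt 1 ‖x‖ with hx | hx
  · have hx0 : x ≠ 0 := norm_pos_iff.1 (by linarith)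
    have h2 : ‖regularFundSol θ x‖ ≤ |fundSol d x| := by
      rw [regularFundSol, norm_mul, Real.norm_eq_abs (fundSol d x)]
      refine mul_le_of_le_one_left (abs_nonneg _) ?_
      rw [Real.norm_of_nonneg (by linarith [hθ.le_one x])]
      linarith [hθ.nonneg x]
    refine (h2.trans (hb x hx0)).trans ?_
    have h3 : ‖x‖ ^ (1 - (d : ℝ)) ≤ 1 := by
      refine Real.rpow_le_one_of_one_le_of_nonpos hx ?_
      have : (2 : ℝ) ≤ d := by exact_mod_cast hd
      linarith
    have h4 : fundMajorant d x ≤ 2 * (1 + ‖x‖) ^ 2 := by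
      unfold fundMajorant
      nlinarith
    nlinarith
  · have : regularFundSol θ x = 0 := by rw [regularFundSol, hθ.eq_one x hx.le]; simp
    rw [this, norm_zero]
    positivity

theorem integral_farKernel_mul {d : ℕ} (hd : 2 ≤ d) {θ : Space d → ℝ} (hθ : IsCutoff θ)
    (l j k : Fin d) (h : 𝓢(Space d, ℂ)) :
    ∫ y, farKernel θ l j k y * h y =
      -∫ y, (regularFundSol θ y : ℂ) * schwartzPderiv₃ k j l h y := by
  have t0 := hasTemperateGrowth_regularFundSol hd hθ
  have t1 := hasTemperateGrowth_pderivAt t0 k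
  have t2 := hasTemperateGrowth_pderivAt t1 j
  rw [schwartzPderiv₃, integral_temperate_mul_pderiv t0, integral_temperate_mul_pderiv t1,
    integral_temperate_mul_pderiv t2, neg_neg, neg_neg]
  rfl

theorem nearFundSol_add_regularFundSol {d : ℕ} (θ : Space d → ℝ) (y : Space d) :
    nearFundSol θ y + (regularFundSol θ y : ℂ) = (fundSol d y : ℂ) := by
  simp only [nearFundSol, regularFundSol]
  push_cast; ring

/-- Pairing of `Γ` with a Schwartz function. -/
theorem integral_mul_pressureKernel {d : ℕ} (hd : 2 ≤ d) {χ θ : Space d → ℝ} (hχ : IsCutoff χ)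
    (hθ : IsCutoff θ) (l j k : Fin d) (φ : 𝓢(Space d, ℂ)) :
    ∫ x, φ x * pressureKernel χ θ l j k x =
      ∫ y, (fundSol d y : ℂ) * transMult (cutoffDerivSymbol χ l j k) φ y := by
  obtain ⟨C, hC, hCb⟩ := exists_decay_farKernel hθ l j k
  set ψ := cutoffSchwartz hχ with hψ
  set ψ₃ := schwartzPderiv₃ l j k ψ with hψ₃
  have t0 := (hasTemperateGrowth_cutoffSymbol hχ one_ne_zero).1
  have t3 := hasTemperateGrowth_cutoffDerivSymbol hχ l j k
  have hnear0 : Integrable (fun y => (decayWeight 0 y : ℂ) * nearFundSol θ y) volume := by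
    simpa [decayWeight] using integrable_nearFundSol hd hθ
  have hfar0 : Integrable (fun y => (decayWeight 0 y : ℂ) * farKernel θ l j k y) volume := by
    simpa [decayWeight] using integrable_of_decay (continuous_farKernel hθ l j k) hCb
  have hF3 : 𝓕 (ψ₃ : Space d → ℂ) =ᵐ[volume] cutoffDerivSymbol χ l j k := by
    refine Eventually.of_forall fun ξ => ?_
    rw [← SchwartzMap.fourier_coe, hψ₃, schwartzPderiv₃, fourier_schwartzPderiv,
      fourier_schwartzPderiv, fourier_schwartzPderiv, hψ, fourier_cutoffSchwartz, cutoffDerivSymbol]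
    ring
  have hF0 : 𝓕 (ψ : Space d → ℂ) =ᵐ[volume] cutoffSymbol χ 1 := by
    refine Eventually.of_forall fun ξ => ?_
    rw [← SchwartzMap.fourier_coe, hψ, fourier_cutoffSchwartz]
  have e1 : ∀ x, φ x * pressureKernel χ θ l j k x =
      φ x * (∫ y, ψ₃ (x - y) * nearFundSol θ y) + φ x * ∫ y, ψ (x - y) * farKernel θ l j k y :=
    fun x => by rw [pressureKernel_eq hχ, mul_add]
  simp_rw [e1]
  have c1 := integrable_mul_convolution (schwartzDecay_nonneg 0 ψ₃) ψ₃.continuous φ.continuous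
    (norm_le_schwartzDecay 0 ψ₃) (norm_le_schwartzDecay (0 + (d + 1)) φ) hnear0
  have c2 := integrable_mul_convolution (schwartzDecay_nonneg 0 ψ) ψ.continuous φ.continuous
    (norm_le_schwartzDecay 0 ψ) (norm_le_schwartzDecay (0 + (d + 1)) φ) hfar0
  rw [integral_add c1 c2, integral_mul_convolution (schwartzDecay_nonneg 0 ψ₃) ψ₃.continuous
      φ.continuous (norm_le_schwartzDecay 0 ψ₃) (norm_le_schwartzDecay (0 + (d + 1)) φ) hnear0,
    integral_mul_convolution (schwartzDecay_nonneg 0 ψ) ψ.continuous φ.continuous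
      (norm_le_schwartzDecay 0 ψ) (norm_le_schwartzDecay (0 + (d + 1)) φ) hfar0]
  simp_rw [integral_kernel_mul_eq_symbolFun ψ₃.integrable hF3,
    integral_kernel_mul_eq_symbolFun ψ.integrable hF0, ← coe_transMult t0, ← coe_transMult t3]
  -- The sign from three integrations by parts cancels the sign from differentiating a transposed
  -- multiplier. Both halves of `Γ` are then paired with the same Schwartz function, and `θE +
  -- (1-θ)E = E` eliminates `θ`.
  rw [integral_farKernel_mul hd hθ, schwartzPderiv₃_transMult t0]
  have e2 : (fun ξ => derivSymbol k ξ * derivSymbol j ξ * derivSymbol l ξ * cutoffSymbol χ 1 ξ) =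
      cutoffDerivSymbol χ l j k := by
    ext ξ; rw [cutoffDerivSymbol]; ring
  rw [e2]
  set h := transMult (cutoffDerivSymbol χ l j k) φ
  have i1 : Integrable (fun y => nearFundSol θ y * h y) volume :=
    (integrable_nearFundSol hd hθ).mul_bdd (c := SchwartzMap.seminorm ℂ 0 0 h)
      h.continuous.aestronglyMeasurable
      (Eventually.of_forall fun y => SchwartzMap.norm_le_seminorm ℂ h y)
  have i2 := integrable_temperate_mul (hasTemperateGrowth_regularFundSol hd hθ) h
  simp only [neg_apply, mul_neg]
  rw [integral_neg, neg_neg, ← integral_add i1 i2]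
  congr 1; ext y
  rw [← nearFundSol_add_regularFundSol θ y, add_mul]

theorem sum_derivSymbol_sq {d : ℕ} (ξ : Space d) :
    ∑ j, derivSymbol j ξ * derivSymbol j ξ = -((‖(2 * Real.pi) • ξ‖ ^ 2 : ℝ) : ℂ) := by
  rw [EuclideanSpace.real_norm_sq_eq]
  push_cast
  rw [← Finset.sum_neg_distrib]
  refine Finset.sum_congr rfl fun j _ => ?_
  have : derivSymbol j ξ * derivSymbol j ξ = (Complex.I * Complex.I) *
      ((((2 * Real.pi) • ξ : Space d) j : ℝ) : ℂ) ^ 2 := by rw [derivSymbol]; ring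
  rw [this, Complex.I_mul_I]
  ring

/-- The symbol `|η|²` of `-Δ`. -/
def laplaceSymbol {d : ℕ} (ξ : Space d) : ℂ := ((‖(2 * Real.pi) • ξ‖ ^ 2 : ℝ) : ℂ)

theorem hasTemperateGrowth_laplaceSymbol {d : ℕ} :
    (laplaceSymbol (d := d)).HasTemperateGrowth := by
  have h : laplaceSymbol (d := d) = fun ξ => -∑ j, derivSymbol j ξ * derivSymbol j ξ := by
    ext ξ; rw [sum_derivSymbol_sq, neg_neg]; rfl
  rw [h]
  exact (Function.HasTemperateGrowth.sum fun j _ =>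
    (hasTemperateGrowth_derivSymbol j).mul (hasTemperateGrowth_derivSymbol j)).neg

theorem laplacian_fourier {d : ℕ} (f : 𝓢(Space d, ℂ)) :
    schwartzLaplacian (𝓕 f) = -𝓕 (SchwartzMap.smulLeftCLM ℂ laplaceSymbol f) := by
  have h : ∀ j, schwartzPderiv j (schwartzPderiv j (𝓕 f)) =
      𝓕 (SchwartzMap.smulLeftCLM ℂ (fun ξ => derivSymbol j ξ * derivSymbol j ξ) f) := by
    intro j
    rw [schwartzPderiv_fourier, map_neg, schwartzPderiv_fourier, neg_neg,
      SchwartzMap.smulLeftCLM_smulLeftCLM_apply (hasTemperateGrowth_derivSymbol j)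
        (hasTemperateGrowth_derivSymbol j)]
    rfl
  rw [schwartzLaplacian_apply]
  simp_rw [h]
  rw [← FourierTransform.fourier_neg, ← FourierTransform.fourier_sum]
  congr 1
  ext ξ
  rw [sum_apply, neg_apply, SchwartzMap.smulLeftCLM_apply_apply hasTemperateGrowth_laplaceSymbol,
    smul_eq_mul, laplaceSymbol, ← neg_mul, ← sum_derivSymbol_sq, Finset.sum_mul]
  refine Finset.sum_congr rfl fun j _ => ?_
  have hjj : (fun ξ => derivSymbol j ξ * derivSymbol j ξ).HasTemperateGrowth :=
    (hasTemperateGrowth_derivSymbol j).mul (hasTemperateGrowth_derivSymbol j)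
  rw [SchwartzMap.smulLeftCLM_apply_apply hjj, smul_eq_mul]

/-- The factor `|η|²` makes the function paired with `E` minus a Laplacian, so `-ΔE = δ₀` evaluates
a Fourier transform at the origin, which is the integral on the right. -/
theorem integral_fourier_pressureKernel_mul {d : ℕ} (hd : 2 ≤ d) {χ θ : Space d → ℝ}
    (hχ : IsCutoff χ) (hθ : IsCutoff θ) (l j k : Fin d) (g : 𝓢(Space d, ℂ)) :
    ∫ ξ, 𝓕 (pressureKernel χ θ l j k) ξ * (laplaceSymbol ξ * g ξ) =
      ∫ ξ, cutoffDerivSymbol χ l j k ξ * g ξ := by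
  have t3 := hasTemperateGrowth_cutoffDerivSymbol hχ l j k
  have tL := hasTemperateGrowth_laplaceSymbol (d := d)
  set G := SchwartzMap.smulLeftCLM ℂ laplaceSymbol g with hG
  have hflip := VectorFourier.integral_fourierIntegral_smul_eq_flip
    (μ := (volume : Measure (Space d))) (ν := (volume : Measure (Space d)))
    (e := Real.fourierChar) (L := innerₗ (Space d)) (f := pressureKernel χ θ l j k) (g := G)
    Real.continuous_fourierChar (by exact continuous_inner)
    (integrable_pressureKernel hd hχ hθ l j k) G.integrable
  rw [flip_innerₗ] at hflip
  have e1 : ∫ ξ, 𝓕 (pressureKernel χ θ l j k) ξ * (laplaceSymbol ξ * g ξ) =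
      ∫ x, (𝓕 G : 𝓢(Space d, ℂ)) x * pressureKernel χ θ l j k x := by
    refine Eq.trans ?_ (hflip.trans ?_)
    · congr 1; ext ξ
      rw [hG, SchwartzMap.smulLeftCLM_apply_apply tL]
      rfl
    · congr 1; ext x
      rw [smul_eq_mul, mul_comm]
      rfl
  have e2 : transMult (cutoffDerivSymbol χ l j k) (𝓕 G) =
      -schwartzLaplacian (𝓕 (SchwartzMap.smulLeftCLM ℂ (cutoffDerivSymbol χ l j k) g)) := by
    rw [laplacian_fourier, neg_neg, transMult_apply, FourierTransform.fourierInv_fourier_eq, hG,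
      SchwartzMap.smulLeftCLM_smulLeftCLM_apply t3 tL,
      SchwartzMap.smulLeftCLM_smulLeftCLM_apply tL t3, mul_comm]
  rw [e1, integral_mul_pressureKernel hd hχ hθ, e2]
  simp only [neg_apply, mul_neg]
  rw [integral_neg, integral_fundSol_mul_laplacian hd, neg_neg, SchwartzMap.fourier_coe,
    Real.fourier_eq]
  congr 1; ext ξ
  rw [SchwartzMap.smulLeftCLM_apply_apply t3]
  simp

/-- The Fourier transform of `Γ` is `χ(η)(iη_l)(iη_j)(iη_k)/|η|²`. -/
theorem fourier_pressureKernel {d : ℕ} (hd : 2 ≤ d) {χ θ : Space d → ℝ}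
    (hχ : IsCutoff χ) (hθ : IsCutoff θ) (l j k : Fin d) :
    𝓕 (pressureKernel χ θ l j k) =ᵐ[volume]
      fun ξ => pressureSymbol l j k ξ * cutoffSymbol χ 1 ξ := by
  have t3 := hasTemperateGrowth_cutoffDerivSymbol hχ l j k
  have tL := hasTemperateGrowth_laplaceSymbol (d := d)
  have hc : Continuous (𝓕 (pressureKernel χ θ l j k)) :=
    VectorFourier.fourierIntegral_continuous Real.continuous_fourierChar (by exact continuous_inner)
      (integrable_pressureKernel hd hχ hθ l j k)
  have hcont : Continuous (fun ξ => 𝓕 (pressureKernel χ θ l j k) ξ * laplaceSymbol ξ -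
      cutoffDerivSymbol χ l j k ξ) :=
    (hc.mul tL.1.continuous).sub t3.1.continuous
  -- The identity multiplied by `|η|²` follows by testing; the division below is possible off the
  -- origin, a null set.
  have h0 : ∀ᵐ ξ, 𝓕 (pressureKernel χ θ l j k) ξ * laplaceSymbol ξ -
      cutoffDerivSymbol χ l j k ξ = 0 := by
    refine ae_eq_zero_of_integral_contDiff_smul_eq_zero hcont.locallyIntegrable fun g hg hgc => ?_
    have hgC : HasCompactSupport (fun ξ => (g ξ : ℂ)) := hgc.comp_left Complex.ofReal_zero
    let gS : 𝓢(Space d, ℂ) := hgC.toSchwartzMap (Complex.ofRealCLM.contDiff.comp hg)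
    have h := integral_fourier_pressureKernel_mul hd hχ hθ l j k gS
    have hgS : ∀ ξ, gS ξ = (g ξ : ℂ) := fun ξ => rfl
    simp_rw [hgS] at h
    simp_rw [Complex.real_smul, mul_sub]
    rw [integral_sub, sub_eq_zero]
    · refine Eq.trans ?_ (h.trans ?_)
      · congr 1; ext ξ; ring
      · congr 1; ext ξ; ring
    · refine Continuous.integrable_of_hasCompactSupport (by
        have := hg.continuous; have := tL.1.continuous; fun_prop) ?_
      exact hgC.mul_right
    · refine Continuous.integrable_of_hasCompactSupport (by
        have := hg.continuous; have := t3.1.continuous; fun_prop) ?_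
      exact hgC.mul_right
  filter_upwards [h0, ae_ne_zero hd] with ξ hξ hne
  have hL : laplaceSymbol ξ ≠ 0 := by
    rw [laplaceSymbol, Complex.ofReal_ne_zero]
    have : (2 * Real.pi) • ξ ≠ 0 := smul_ne_zero (by positivity) hne
    have := norm_pos_iff.2 this
    positivity
  rw [sub_eq_zero] at hξ
  rw [pressureSymbol, div_mul_eq_mul_div]
  change _ = _ / laplaceSymbol ξ
  rw [eq_div_iff hL, hξ]
  rfl

/-! ### The operator `∂_l (-Δ)⁻¹ ∂_j ∂_k` on Schwartz functions -/

/-- The function `𝓕 (p_{ljk} · 𝓕⁻ φ)`, the transpose of `∂_l (-Δ)⁻¹ ∂_j ∂_k` applied to `φ`. -/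
def pressureFun {d : ℕ} (l j k : Fin d) (φ : 𝓢(Space d, ℂ)) : Space d → ℂ :=
  symbolFun (pressureSymbol l j k) φ

theorem norm_derivSymbol_le {d : ℕ} (l : Fin d) (ξ : Space d) :
    ‖derivSymbol l ξ‖ ≤ ‖(2 * Real.pi) • ξ‖ := by
  rw [derivSymbol, norm_mul, Complex.norm_I, one_mul, Complex.norm_real]
  exact PiLp.norm_apply_le _ _

theorem norm_pressureSymbol_le {d : ℕ} (l j k : Fin d) (ξ : Space d) :
    ‖pressureSymbol l j k ξ‖ ≤ 2 * Real.pi * ‖ξ‖ := by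
  have h0 : ‖(2 * Real.pi) • ξ‖ = 2 * Real.pi * ‖ξ‖ := by
    rw [norm_smul, Real.norm_of_nonneg (by positivity)]
  rw [← h0, pressureSymbol, norm_div, norm_mul, norm_mul, Complex.norm_real, norm_pow, norm_norm]
  rcases eq_or_ne ‖(2 * Real.pi) • ξ‖ 0 with h | h
  · rw [h]; simp
  · have hp : 0 < ‖(2 * Real.pi) • ξ‖ := lt_of_le_of_ne (norm_nonneg _) (Ne.symm h)
    rw [div_le_iff₀ (by positivity)]
    calc ‖derivSymbol l ξ‖ * ‖derivSymbol j ξ‖ * ‖derivSymbol k ξ‖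
        ≤ ‖(2 * Real.pi) • ξ‖ * ‖(2 * Real.pi) • ξ‖ * ‖(2 * Real.pi) • ξ‖ := by
          gcongr <;> exact norm_derivSymbol_le _ _
      _ = _ := by ring

theorem measurable_pressureSymbol {d : ℕ} (l j k : Fin d) :
    Measurable (pressureSymbol (d := d) l j k) := by
  have := fun l => (hasTemperateGrowth_derivSymbol (d := d) l).1.continuous.measurable
  unfold pressureSymbol
  fun_prop

theorem integrable_pressureSymbol_mul {d : ℕ} (l j k : Fin d) (g : 𝓢(Space d, ℂ)) :
    Integrable (fun ξ => pressureSymbol l j k ξ * g ξ) volume := by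
  have h := (g.integrable_pow_mul (volume : Measure (Space d)) 1).const_mul (2 * Real.pi)
  refine h.mono' ((measurable_pressureSymbol l j k).aestronglyMeasurable.mul
    g.continuous.aestronglyMeasurable) (Eventually.of_forall fun ξ => ?_)
  rw [norm_mul, pow_one, ← mul_assoc]
  gcongr
  exact norm_pressureSymbol_le l j k ξ

theorem continuous_pressureFun {d : ℕ} (l j k : Fin d) (φ : 𝓢(Space d, ℂ)) :
    Continuous (pressureFun l j k φ) :=
  VectorFourier.fourierIntegral_continuous Real.continuous_fourierChar (by exact continuous_inner)
    (integrable_pressureSymbol_mul l j k _)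

theorem fourierInv_transMult {d : ℕ} {m : Space d → ℂ} (hm : m.HasTemperateGrowth)
    (φ : 𝓢(Space d, ℂ)) (ξ : Space d) :
    (𝓕⁻ (transMult m φ) : 𝓢(Space d, ℂ)) ξ = m ξ * (𝓕⁻ φ : 𝓢(Space d, ℂ)) ξ := by
  rw [transMult_apply, FourierTransform.fourierInv_fourier_eq,
    SchwartzMap.smulLeftCLM_apply_apply hm, smul_eq_mul]

/-- The symbols of the two terms add up to `p_{ljk}` almost everywhere. The left side involves no
cut-off, so the pressure operator is independent of them; the right side gives the decay, Schwartz
for the first term and that of `Γ` for the second. -/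
theorem pressureFun_eq_add {d : ℕ} (hd : 2 ≤ d) {χ θ : Space d → ℝ} (hχ : IsCutoff χ)
    (hθ : IsCutoff θ) (l j k : Fin d) (φ : 𝓢(Space d, ℂ)) (y : Space d) :
    pressureFun l j k φ y = transMult (highFreqSymbol χ l j k) φ y +
      ∫ x, pressureKernel χ θ l j k (x - y) * φ x := by
  have th := hasTemperateGrowth_highFreqSymbol hχ l j k
  have tc := (hasTemperateGrowth_cutoffSymbol hχ one_ne_zero).1
  rw [integral_kernel_mul_eq_symbolFun (integrable_pressureKernel hd hχ hθ l j k)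
    (fourier_pressureKernel hd hχ hθ l j k), coe_transMult th, ← symbolFun_add]
  · refine congrFun (symbolFun_congr (Eventually.of_forall fun ξ => ?_) φ) y
    simp only [highFreqSymbol_eq]; ring
  · refine (SchwartzMap.smulLeftCLM ℂ (highFreqSymbol χ l j k)
      (𝓕⁻ φ : 𝓢(Space d, ℂ))).integrable.congr (Eventually.of_forall fun ξ => ?_)
    rw [SchwartzMap.smulLeftCLM_apply_apply th, smul_eq_mul]
  · refine (integrable_pressureSymbol_mul l j k (SchwartzMap.smulLeftCLM ℂ (cutoffSymbol χ 1)
      (𝓕⁻ φ : 𝓢(Space d, ℂ)))).congr (Eventually.of_forall fun ξ => ?_)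
    simp only
    rw [SchwartzMap.smulLeftCLM_apply_apply tc, smul_eq_mul, mul_assoc]

/-- The functions `∂_l (-Δ)⁻¹ ∂_j ∂_k φ` decay like `|x|^{-d-1}`, uniformly for `φ` in bounded
subsets of the Schwartz space. -/
theorem exists_pressureFun_bound {d : ℕ} (hd : 2 ≤ d) {χ θ : Space d → ℝ} (hχ : IsCutoff χ)
    (hθ : IsCutoff θ) : ∃ q : 𝓢(Space d, ℂ) → ℝ, Continuous q ∧ q 0 = 0 ∧
      ∀ l j k φ y, ‖pressureFun l j k φ y‖ ≤ q φ * decayWeight (d + 1) y := by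
  choose C hC hCb using fun l j k => exists_decay_pressureKernel (d := d) hd hχ hθ l j k
  set q := fun (i : Fin d × Fin d × Fin d) (φ : 𝓢(Space d, ℂ)) =>
    schwartzDecay (d + 1) (transMult (highFreqSymbol χ i.1 i.2.1 i.2.2) φ) +
      C i.1 i.2.1 i.2.2 * schwartzDecay ((d + 1) + (d + 1)) φ * weightMass d with hq
  have hq0 : ∀ i φ, 0 ≤ q i φ := fun i φ => by
    have h1 := schwartzDecay_nonneg (d + 1) (transMult (highFreqSymbol χ i.1 i.2.1 i.2.2) φ)
    have h2 := schwartzDecay_nonneg ((d + 1) + (d + 1)) φ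
    have h3 := weightMass_nonneg d
    have h4 := hC i.1 i.2.1 i.2.2
    simp only [hq]
    positivity
  refine ⟨fun φ => ∑ i, q i φ, ?_, ?_, fun l j k φ y => ?_⟩
  · refine continuous_finsetSum _ fun i _ => ?_
    exact ((continuous_schwartzDecay _).comp (transMult _).continuous).add
      ((continuous_const.mul (continuous_schwartzDecay _)).mul continuous_const)
  · refine Finset.sum_eq_zero fun i _ => ?_
    simp only [hq]
    rw [map_zero, schwartzDecay_zero, schwartzDecay_zero]
    simp
  · have h1 : q (l, j, k) φ ≤ ∑ i, q i φ :=
      Finset.single_le_sum (f := fun i => q i φ) (fun i _ => hq0 i φ) (Finset.mem_univ _)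
    refine le_trans ?_ (mul_le_mul_of_nonneg_right h1 (decayWeight_nonneg _ _))
    rw [pressureFun_eq_add hd hχ hθ]
    refine (norm_add_le _ _).trans ?_
    simp only [hq]
    rw [add_mul]
    exact add_le_add (norm_le_schwartzDecay _ _ _) (norm_integral_kernel_mul_le (hC l j k)
      (hCb l j k) (norm_le_schwartzDecay ((d + 1) + (d + 1)) φ) y)

theorem pressureFun_sub {d : ℕ} (l j k : Fin d) (φ ψ : 𝓢(Space d, ℂ)) (y : Space d) :
    pressureFun l j k (φ - ψ) y = pressureFun l j k φ y - pressureFun l j k ψ y := by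
  simp_rw [pressureFun, symbolFun_eq_integral]
  rw [← integral_sub]
  · congr 1; ext ξ
    rw [sub_eq_add_neg, FourierTransform.fourierInv_add, FourierTransform.fourierInv_neg,
      add_apply, neg_apply, ← sub_eq_add_neg, mul_sub, smul_sub]
  · exact (Real.fourierIntegral_convergent_iff y).2 (integrable_pressureSymbol_mul l j k _)
  · exact (Real.fourierIntegral_convergent_iff y).2 (integrable_pressureSymbol_mul l j k _)

/-- The operator annihilates divergence-free fields. -/
theorem sum_pressureFun_of_divFree {d : ℕ} (j k : Fin d) (φ : Fin d → 𝓢(Space d, ℂ))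
    (h : ∑ l, schwartzPderiv l (φ l) = 0) (y : Space d) :
    ∑ l, pressureFun l j k (φ l) y = 0 := by
  simp only [pressureFun]
  rw [symbolFun_sum Finset.univ (fun l => pressureSymbol l j k) φ
    fun l _ => integrable_pressureSymbol_mul l j k _]
  have h1 : (fun ξ => ∑ l, pressureSymbol l j k ξ * (𝓕⁻ (φ l) : 𝓢(Space d, ℂ)) ξ) =
      fun _ => 0 := by
    ext ξ
    -- On the Fourier side the divergence is the sum over `l` of `iη_l` times the components, and
    -- `iη_l` is a factor of the symbol.
    have h2 : ∑ l, derivSymbol l ξ * (𝓕⁻ (φ l) : 𝓢(Space d, ℂ)) ξ = 0 := by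
      have h3 := congrArg (fun f : 𝓢(Space d, ℂ) => (𝓕⁻ f : 𝓢(Space d, ℂ)) ξ) h
      simp only [FourierTransform.fourierInv_sum, sum_apply, fourierInv_schwartzPderiv,
        Finset.sum_neg_distrib, FourierTransform.fourierInv_zero, zero_apply] at h3
      exact neg_eq_zero.1 h3
    calc ∑ l, pressureSymbol l j k ξ * (𝓕⁻ (φ l) : 𝓢(Space d, ℂ)) ξ
        = (derivSymbol j ξ * derivSymbol k ξ / ((‖(2 * Real.pi) • ξ‖ ^ 2 : ℝ) : ℂ)) *
          ∑ l, derivSymbol l ξ * (𝓕⁻ (φ l) : 𝓢(Space d, ℂ)) ξ := by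
          rw [Finset.mul_sum]
          refine Finset.sum_congr rfl fun l _ => ?_
          rw [pressureSymbol]; ring
      _ = 0 := by rw [h2, mul_zero]
  rw [h1, Real.fourier_eq]
  simp

theorem schwartz_eq_fourier {d : ℕ} (φ : 𝓢(Space d, ℂ)) (y : Space d) :
    φ y = 𝓕 (fun ξ => (𝓕⁻ φ : 𝓢(Space d, ℂ)) ξ) y := by
  have h : (𝓕 (𝓕⁻ φ : 𝓢(Space d, ℂ)) : 𝓢(Space d, ℂ)) y = φ y := by
    rw [FourierTransform.fourier_fourierInv_eq]
  rw [← h, SchwartzMap.fourier_coe]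

theorem laplaceSymbol_ne_zero {d : ℕ} {ξ : Space d} (h : ξ ≠ 0) :
    ((‖(2 * Real.pi) • ξ‖ ^ 2 : ℝ) : ℂ) ≠ 0 := by
  rw [Complex.ofReal_ne_zero]
  have := norm_pos_iff.2 (smul_ne_zero (by positivity : (2 * Real.pi) ≠ 0) h)
  positivity

/-- Contracting `l` with a gradient produces `∑ (iη_l)² = -|η|²`, which cancels the denominator. The
pressure therefore balances the stress on gradients. -/
theorem sum_pressureFun_pderiv {d : ℕ} (hd : 2 ≤ d) (j k : Fin d) (q : 𝓢(Space d, ℂ))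
    (y : Space d) :
    ∑ l, pressureFun l j k (schwartzPderiv l q) y = schwartzPderiv j (schwartzPderiv k q) y := by
  simp only [pressureFun]
  rw [symbolFun_sum Finset.univ (fun l => pressureSymbol l j k) (fun l => schwartzPderiv l q)
    fun l _ => integrable_pressureSymbol_mul l j k _, schwartz_eq_fourier]
  refine Real.fourier_congr_ae ?_ y
  filter_upwards [ae_ne_zero hd] with ξ hξ
  simp_rw [fourierInv_schwartzPderiv]
  calc ∑ l, pressureSymbol l j k ξ * -(derivSymbol l ξ * (𝓕⁻ q : 𝓢(Space d, ℂ)) ξ)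
      = -(derivSymbol j ξ * derivSymbol k ξ / ((‖(2 * Real.pi) • ξ‖ ^ 2 : ℝ) : ℂ) *
        (𝓕⁻ q : 𝓢(Space d, ℂ)) ξ) * ∑ l, derivSymbol l ξ * derivSymbol l ξ := by
        rw [Finset.mul_sum]
        refine Finset.sum_congr rfl fun l _ => ?_
        rw [pressureSymbol]; ring
    _ = _ := by
        have h2 := laplaceSymbol_ne_zero hξ
        rw [sum_derivSymbol_sq]
        field_simp

/-- Expresses a plain derivative through pressure functions, so the low-frequency bounds for the
latter also cover `div(u ⊗ u)`. -/
theorem sum_pressureFun_trace {d : ℕ} (hd : 2 ≤ d) (k : Fin d) (φ : 𝓢(Space d, ℂ))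
    (y : Space d) : ∑ m, pressureFun m m k φ y = schwartzPderiv k φ y := by
  simp only [pressureFun]
  rw [symbolFun_sum Finset.univ (fun m => pressureSymbol m m k) (fun _ => φ)
    fun m _ => integrable_pressureSymbol_mul m m k _, schwartz_eq_fourier]
  refine Real.fourier_congr_ae ?_ y
  filter_upwards [ae_ne_zero hd] with ξ hξ
  rw [fourierInv_schwartzPderiv]
  calc ∑ m, pressureSymbol m m k ξ * (𝓕⁻ φ : 𝓢(Space d, ℂ)) ξ
      = (derivSymbol k ξ / ((‖(2 * Real.pi) • ξ‖ ^ 2 : ℝ) : ℂ) *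
        (𝓕⁻ φ : 𝓢(Space d, ℂ)) ξ) * ∑ l, derivSymbol l ξ * derivSymbol l ξ := by
        rw [Finset.mul_sum]
        refine Finset.sum_congr rfl fun l _ => ?_
        rw [pressureSymbol]; ring
    _ = _ := by
        have h2 := laplaceSymbol_ne_zero hξ
        rw [sum_derivSymbol_sq]
        field_simp

/-! #### Low frequencies -/

/-- The kernel `λ^{-d-1} K(x/λ)`. -/
def scaledKernel {d : ℕ} (K : Space d → ℂ) (lam : ℝ) (x : Space d) : ℂ :=
  (((lam ^ (d + 1))⁻¹ : ℝ) : ℂ) * K (lam⁻¹ • x)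

theorem fourier_scaledKernel {d : ℕ} (K : Space d → ℂ) {lam : ℝ} (hl : 0 < lam) (ξ : Space d) :
    𝓕 (scaledKernel K lam) ξ = ((lam⁻¹ : ℝ) : ℂ) * 𝓕 K (lam • ξ) := by
  rw [Real.fourier_eq, Real.fourier_eq]
  have h := Measure.integral_comp_inv_smul_of_nonneg (volume : Measure (Space d))
    (fun x => Real.fourierChar (-inner ℝ x (lam • ξ)) • K x) hl.le
  rw [finrank_euclideanSpace_fin] at h
  have e : ∀ x : Space d, Real.fourierChar (-inner ℝ x ξ) • scaledKernel K lam x =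
      (((lam ^ (d + 1))⁻¹ : ℝ) : ℂ) *
        (Real.fourierChar (-inner ℝ (lam⁻¹ • x) (lam • ξ)) • K (lam⁻¹ • x)) := by
    intro x
    rw [inner_smul_left, inner_smul_right, scaledKernel, Circle.smul_def, Circle.smul_def,
      conj_trivial, inv_mul_cancel_left₀ hl.ne', smul_eq_mul, smul_eq_mul]
    ring
  simp_rw [e]
  rw [integral_const_mul, h, Complex.real_smul, ← mul_assoc]
  congr 1
  rw [← Complex.ofReal_mul]
  congr 1
  field_simp
  ring

theorem pressureSymbol_smul {d : ℕ} (l j k : Fin d) {lam : ℝ} (hl : 0 < lam) (ξ : Space d) :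
    pressureSymbol l j k (lam • ξ) = (lam : ℂ) * pressureSymbol l j k ξ := by
  have h1 : ∀ i, derivSymbol i (lam • ξ) = (lam : ℂ) * derivSymbol i ξ := fun i => by
    simp only [derivSymbol, PiLp.smul_apply, smul_eq_mul]
    push_cast; ring
  have h2 : ‖(2 * Real.pi) • lam • ξ‖ ^ 2 = lam ^ 2 * ‖(2 * Real.pi) • ξ‖ ^ 2 := by
    rw [smul_comm, norm_smul, mul_pow, Real.norm_eq_abs, sq_abs]
  have hl' : (lam : ℂ) ≠ 0 := by exact_mod_cast hl.ne'
  simp only [pressureSymbol, h1, h2]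
  push_cast
  field_simp

/-- Since `p_{ljk}` is homogeneous of degree 1, the dilation reproduces the same symbol with `χ(η)`
replaced by `χ(λη)`; this is why the normalization is `λ^{-d-1}` instead of `λ^{-d}`. -/
theorem fourier_scaled_pressureKernel {d : ℕ} (hd : 2 ≤ d) {χ θ : Space d → ℝ}
    (hχ : IsCutoff χ) (hθ : IsCutoff θ) (l j k : Fin d) {lam : ℝ} (hl : 0 < lam) :
    𝓕 (scaledKernel (pressureKernel χ θ l j k) lam) =ᵐ[volume]
      fun ξ => pressureSymbol l j k ξ * cutoffSymbol χ lam ξ := by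
  have h1 := fourier_pressureKernel hd hχ hθ l j k
  have hq : Measure.QuasiMeasurePreserving (fun ξ : Space d => lam • ξ) volume volume := by
    refine ⟨measurable_const_smul lam, ?_⟩
    rw [Measure.map_addHaar_smul _ hl.ne']
    exact Measure.smul_absolutelyContinuous
  filter_upwards [hq.ae h1] with ξ hξ
  rw [fourier_scaledKernel _ hl, hξ, pressureSymbol_smul l j k hl]
  have hl' : (lam : ℂ) ≠ 0 := by exact_mod_cast hl.ne'
  have : cutoffSymbol χ 1 (lam • ξ) = cutoffSymbol χ lam ξ := by
    rw [cutoffSymbol, cutoffSymbol, smul_smul]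
    congr 3; ring
  rw [this]
  push_cast
  field_simp

/-- For `λ ≥ 1`, `1 + |z| ≤ λ(1 + |z|/λ)` shows that the prefactor `λ^{-d-1}` exactly preserves the
decay. The second bound, where `decayWeight 0` is 1, keeps a gain `1/λ` in place of the decay. -/
theorem norm_scaledKernel_le {d : ℕ} {K : Space d → ℂ} {C : ℝ} (hC : 0 ≤ C)
    (hK : ∀ z, ‖K z‖ ≤ C * decayWeight (d + 1) z) {lam : ℝ} (hl : 1 ≤ lam) (z : Space d) :
    ‖scaledKernel K lam z‖ ≤ C * decayWeight (d + 1) z ∧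
      ‖scaledKernel K lam z‖ ≤ C / lam * decayWeight 0 z := by
  have hl0 : 0 < lam := by linarith
  have h0 : ‖scaledKernel K lam z‖ ≤ (lam ^ (d + 1))⁻¹ * (C * decayWeight (d + 1) (lam⁻¹ • z)) := by
    rw [scaledKernel, norm_mul, Complex.norm_real, Real.norm_of_nonneg (by positivity)]
    gcongr
    exact hK _
  constructor
  · refine h0.trans ?_
    rw [mul_left_comm]
    refine mul_le_mul_of_nonneg_left ?_ hC
    unfold decayWeight
    rw [← mul_inv, ← mul_pow, norm_smul, Real.norm_of_nonneg (by positivity)]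
    gcongr
    rw [mul_add, mul_inv_cancel_left₀ hl0.ne']
    linarith
  · refine h0.trans ?_
    have h1 := decayWeight_le_one (d + 1) (lam⁻¹ • z)
    have h3 := mul_nonneg hC (decayWeight_nonneg (d + 1) (lam⁻¹ • z))
    have h2 : (lam ^ (d + 1))⁻¹ ≤ lam⁻¹ := by
      gcongr
      exact le_self_pow₀ hl (by omega)
    calc (lam ^ (d + 1))⁻¹ * (C * decayWeight (d + 1) (lam⁻¹ • z)) ≤ lam⁻¹ * (C * 1) := by
          gcongr
      _ = _ := by simp [decayWeight]; ring

/-- The transpose of `χ(λD)`. -/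
def lowFreqTest {d : ℕ} (χ : Space d → ℝ) (lam : ℝ) : 𝓢(Space d, ℂ) →L[ℂ] 𝓢(Space d, ℂ) :=
  transMult (cutoffSymbol χ lam)

theorem memSh_iff {d : ℕ} {χ : Space d → ℝ} {f : 𝓢'(Space d, ℂ)} :
    MemSh χ f ↔ ∀ φ, Tendsto (fun lam : ℝ => f (lowFreqTest χ lam φ)) atTop (𝓝 0) := by
  rw [MemSh, PointwiseConvergenceCLM.tendsto_iff_forall_tendsto]
  rfl

/-- The first bound is the majorant and the second the pointwise limit for dominated convergence as
`λ → ∞`. The auxiliary cut-off `θ` is free and is taken equal to `χ`. -/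
theorem exists_pressureFun_lowFreq_bound {d : ℕ} (hd : 2 ≤ d) {χ : Space d → ℝ}
    (hχ : IsCutoff χ) (φ : 𝓢(Space d, ℂ)) : ∃ C : ℝ, 0 ≤ C ∧ ∀ l j k, ∀ lam : ℝ, 1 ≤ lam → ∀ y,
      ‖pressureFun l j k (lowFreqTest χ lam φ) y‖ ≤ C * decayWeight (d + 1) y ∧
      ‖pressureFun l j k (lowFreqTest χ lam φ) y‖ ≤ C / lam := by
  choose C hC hCb using fun l j k => exists_decay_pressureKernel (d := d) hd hχ hχ l j k
  set A := ∑ i : Fin d × Fin d × Fin d, C i.1 i.2.1 i.2.2 with hA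
  have hCA : ∀ l j k, C l j k ≤ A := fun l j k =>
    Finset.single_le_sum (f := fun i : Fin d × Fin d × Fin d => C i.1 i.2.1 i.2.2)
      (fun i _ => hC _ _ _) (Finset.mem_univ (l, j, k))
  have hA0 : 0 ≤ A := Finset.sum_nonneg fun i _ => hC _ _ _
  have hw := weightMass_nonneg d
  have hs1 := schwartzDecay_nonneg ((d + 1) + (d + 1)) φ
  have hs0 := schwartzDecay_nonneg (0 + (d + 1)) φ
  refine ⟨A * (schwartzDecay ((d + 1) + (d + 1)) φ + schwartzDecay (0 + (d + 1)) φ) *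
    weightMass d, by positivity, fun l j k lam hl y => ?_⟩
  have hl0 : 0 < lam := by linarith
  have hK : ∀ z, ‖pressureKernel χ χ l j k z‖ ≤ A * decayWeight (d + 1) z := fun z =>
    (hCb l j k z).trans (mul_le_mul_of_nonneg_right (hCA l j k) (decayWeight_nonneg _ _))
  have hcont : Continuous (scaledKernel (pressureKernel χ χ l j k) lam) := by
    have := continuous_pressureKernel hd hχ hχ l j k
    unfold scaledKernel
    fun_prop
  have hint : Integrable (scaledKernel (pressureKernel χ χ l j k) lam) volume :=
    integrable_of_decay hcont fun x => (norm_scaledKernel_le hA0 hK hl x).1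
  have h1 : pressureFun l j k (lowFreqTest χ lam φ) y =
      ∫ x, scaledKernel (pressureKernel χ χ l j k) lam (x - y) * φ x := by
    rw [integral_kernel_mul_eq_symbolFun hint (fourier_scaled_pressureKernel hd hχ hχ l j k hl0),
      pressureFun, symbolFun, symbolFun]
    refine congrArg (fun f : Space d → ℂ => 𝓕 f y) (funext fun ξ => ?_)
    rw [lowFreqTest, fourierInv_transMult (hasTemperateGrowth_cutoffSymbol hχ hl0.ne').1, mul_assoc]
  rw [h1]
  constructor
  · refine (norm_integral_kernel_mul_le hA0 (fun z => (norm_scaledKernel_le hA0 hK hl z).1)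
      (norm_le_schwartzDecay ((d + 1) + (d + 1)) φ) y).trans ?_
    have := decayWeight_nonneg (d + 1) y
    gcongr
    linarith
  · refine (norm_integral_kernel_mul_le (N := 0) (by positivity)
      (fun z => (norm_scaledKernel_le hA0 hK hl z).2)
      (norm_le_schwartzDecay (0 + (d + 1)) φ) y).trans ?_
    calc A / lam * schwartzDecay (0 + (d + 1)) φ * weightMass d * decayWeight 0 y
        = A * schwartzDecay (0 + (d + 1)) φ * weightMass d / lam := by
          simp [decayWeight]; ring
      _ ≤ _ := by
          gcongr
          linarith

/-- A harmonic tempered distribution that belongs to `S'_h` vanishes. -/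
theorem eq_zero_of_harmonic_of_memSh {d : ℕ} {χ : Space d → ℝ} (hχ : IsCutoff χ)
    {f : 𝓢'(Space d, ℂ)} (h : ∀ φ, f (schwartzLaplacian φ) = 0) (hf : MemSh χ f) : f = 0 := by
  have key : ∀ φ : 𝓢(Space d, ℂ), ∀ lam : ℝ, 0 < lam → f (lowFreqTest χ lam φ) = f φ := by
    intro φ lam hl
    have ti := hasTemperateGrowth_invLaplaceSymbol hχ hl.ne'
    have tL := hasTemperateGrowth_laplaceSymbol (d := d)
    have tc := (hasTemperateGrowth_cutoffSymbol hχ hl.ne').1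
    -- `1 - χ(λη)` vanishes near the origin, so dividing it by `|η|²` gives a smooth symbol: `χ(λD)φ
    -- - φ` is the Laplacian of a Schwartz function and is annihilated by `f`.
    have h1 : lowFreqTest χ lam φ - φ = schwartzLaplacian (transMult (invLaplaceSymbol χ lam) φ) := by
      rw [transMult_apply, laplacian_fourier, SchwartzMap.smulLeftCLM_smulLeftCLM_apply tL ti]
      have h2 : lowFreqTest χ lam φ - φ =
          𝓕 (SchwartzMap.smulLeftCLM ℂ (cutoffSymbol χ lam) (𝓕⁻ φ) - 𝓕⁻ φ) := by
        rw [sub_eq_add_neg, sub_eq_add_neg, FourierTransform.fourier_add,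
          FourierTransform.fourier_neg, FourierTransform.fourier_fourierInv_eq]; rfl
      rw [h2, ← FourierTransform.fourier_neg]
      congr 1; ext ξ
      rw [sub_apply, neg_apply, SchwartzMap.smulLeftCLM_apply_apply tc,
        SchwartzMap.smulLeftCLM_apply_apply (tL.mul ti), smul_eq_mul, smul_eq_mul, Pi.mul_apply]
      by_cases hξ : ξ = 0
      · subst hξ
        have : cutoffSymbol χ lam (0 : Space d) = 1 := by
          rw [cutoffSymbol, smul_zero, hχ.eq_one 0 (by simp)]; simp
        rw [this]
        simp [laplaceSymbol]
      · have h2 := laplaceSymbol_ne_zero hξ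
        rw [laplaceSymbol, invLaplaceSymbol]
        field_simp
        ring
    have h3 := h (transMult (invLaplaceSymbol χ lam) φ)
    rw [← h1, map_sub, sub_eq_zero] at h3
    exact h3
  ext φ
  have h1 := memSh_iff.1 hf φ
  have h2 : Tendsto (fun lam : ℝ => f (lowFreqTest χ lam φ)) atTop (𝓝 (f φ)) :=
    tendsto_const_nhds.congr' (by
      filter_upwards [eventually_gt_atTop 0] with lam hl using (key φ lam hl).symm)
  exact tendsto_nhds_unique h2 h1

/-! ### The weighted `L²` space -/

/-- The finite measure `(1 + |x|)^{-d-1} dx`. -/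
def weightMeasure (d : ℕ) : Measure (Space d) :=
  volume.withDensity fun x => ENNReal.ofReal (decayWeight (d + 1) x)

theorem measurable_ofReal_decayWeight {d : ℕ} (N : ℕ) :
    Measurable fun x : Space d => ENNReal.ofReal (decayWeight N x) :=
  (continuous_decayWeight N).measurable.ennreal_ofReal

instance isFiniteMeasure_weightMeasure (d : ℕ) : IsFiniteMeasure (weightMeasure d) :=
  isFiniteMeasure_withDensity_ofReal (integrable_decayWeight (Nat.lt_succ_self d)).2

theorem weightMeasure_ac (d : ℕ) : weightMeasure d ≪ volume := withDensity_absolutelyContinuous _ _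

theorem ac_weightMeasure (d : ℕ) : (volume : Measure (Space d)) ≪ weightMeasure d :=
  withDensity_absolutelyContinuous' (measurable_ofReal_decayWeight _).aemeasurable
    (Eventually.of_forall fun x => by simpa using decayWeight_pos (d + 1) x)

theorem integrable_weightMeasure_iff {d : ℕ} {f : Space d → ℝ} :
    Integrable f (weightMeasure d) ↔ Integrable (fun x => decayWeight (d + 1) x * f x) volume := by
  rw [weightMeasure, integrable_withDensity_iff_integrable_smul' (measurable_ofReal_decayWeight _)
    (Eventually.of_forall fun x => ENNReal.ofReal_lt_top)]
  simp [ENNReal.toReal_ofReal, decayWeight_nonneg]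

theorem integral_weightMeasure {d : ℕ} (f : Space d → ℝ) :
    ∫ x, f x ∂weightMeasure d = ∫ x, decayWeight (d + 1) x * f x := by
  rw [weightMeasure, integral_withDensity_eq_integral_toReal_smul (measurable_ofReal_decayWeight _)
    (Eventually.of_forall fun x => ENNReal.ofReal_lt_top)]
  simp [ENNReal.toReal_ofReal, decayWeight_nonneg]

/-- The norm of `L²((1 + |x|)^{-d-1} dx)`. -/
def weightNorm {d : ℕ} {F : Type*} [NormedAddCommGroup F] (f : Space d → F) : ℝ :=
  (eLpNorm f 2 (weightMeasure d)).toReal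

theorem weightNorm_nonneg {d : ℕ} {F : Type*} [NormedAddCommGroup F] (f : Space d → F) :
    0 ≤ weightNorm f := ENNReal.toReal_nonneg

/-- The integral of `f g a`. -/
def pairing {d : ℕ} (f g : Space d → ℝ) (a : Space d → ℂ) : ℂ :=
  ∫ y, ((f y * g y : ℝ) : ℂ) * a y

theorem integrable_weight_mul {d : ℕ} {f g : Space d → ℝ} (hf : MemLp f 2 (weightMeasure d))
    (hg : MemLp g 2 (weightMeasure d)) :
    Integrable (fun y => decayWeight (d + 1) y * (f y * g y)) volume :=
  integrable_weightMeasure_iff.1 (hf.integrable_mul hg)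

/-- The Cauchy–Schwarz inequality for the weighted measure. -/
theorem integral_weight_norm_mul_le {d : ℕ} {f g : Space d → ℝ}
    (hf : MemLp f 2 (weightMeasure d)) (hg : MemLp g 2 (weightMeasure d)) :
    ∫ y, decayWeight (d + 1) y * ‖f y * g y‖ ≤ weightNorm f * weightNorm g := by
  rw [← integral_weightMeasure, integral_norm_eq_lintegral_enorm
    (f := fun y => f y * g y) (hf.1.mul hg.1), ← eLpNorm_one_eq_lintegral_enorm, weightNorm, weightNorm,
    ← ENNReal.toReal_mul]
  refine ENNReal.toReal_mono (ENNReal.mul_ne_top hf.2.ne hg.2.ne) ?_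
  exact eLpNorm_smul_le_mul_eLpNorm (p := 2) (q := 2) (r := 1) (φ := f) (f := g) hg.1 hf.1

theorem norm_pairing_integrand_le {d : ℕ} {f g : Space d → ℝ} {a : Space d → ℂ} {q : ℝ}
    (ha : ∀ y, ‖a y‖ ≤ q * decayWeight (d + 1) y) (y : Space d) :
    ‖((f y * g y : ℝ) : ℂ) * a y‖ ≤ q * (decayWeight (d + 1) y * ‖f y * g y‖) := by
  rw [norm_mul, Complex.norm_real]
  calc ‖f y * g y‖ * ‖a y‖ ≤ ‖f y * g y‖ * (q * decayWeight (d + 1) y) := by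
        gcongr
        exact ha y
    _ = _ := by ring

theorem integrable_pairing {d : ℕ} {f g : Space d → ℝ} {a : Space d → ℂ} {q : ℝ}
    (hf : MemLp f 2 (weightMeasure d)) (hg : MemLp g 2 (weightMeasure d)) (hac : Continuous a)
    (ha : ∀ y, ‖a y‖ ≤ q * decayWeight (d + 1) y) :
    Integrable (fun y => ((f y * g y : ℝ) : ℂ) * a y) volume := by
  refine Integrable.mono' ((integrable_weight_mul hf hg).norm.const_mul q) ?_
    (Eventually.of_forall fun y => ?_)
  · exact (Complex.continuous_ofReal.comp_aestronglyMeasurable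
      ((hf.1.mul hg.1).mono_ac (ac_weightMeasure d))).mul hac.aestronglyMeasurable
  · rw [norm_mul (decayWeight _ _), Real.norm_of_nonneg (decayWeight_nonneg _ _)]
    exact norm_pairing_integrand_le ha y

theorem norm_pairing_le {d : ℕ} {f g : Space d → ℝ} {a : Space d → ℂ} {q : ℝ}
    (hf : MemLp f 2 (weightMeasure d)) (hg : MemLp g 2 (weightMeasure d))
    (ha : ∀ y, ‖a y‖ ≤ q * decayWeight (d + 1) y) :
    ‖pairing f g a‖ ≤ q * (weightNorm f * weightNorm g) := by
  have hq : 0 ≤ q := nonneg_of_mul_nonneg_left ((norm_nonneg _).trans (ha 0)) (decayWeight_pos _ _)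
  calc ‖pairing f g a‖ ≤ ∫ y, q * (decayWeight (d + 1) y * ‖f y * g y‖) := by
        refine norm_integral_le_of_norm_le ?_
          (Eventually.of_forall fun y => norm_pairing_integrand_le ha y)
        refine Integrable.const_mul ?_ q
        refine (integrable_weight_mul hf hg).norm.congr (Eventually.of_forall fun y => ?_)
        simp only
        rw [norm_mul (decayWeight _ _), Real.norm_of_nonneg (decayWeight_nonneg _ _)]
    _ ≤ _ := by
        rw [integral_const_mul]
        exact mul_le_mul_of_nonneg_left (integral_weight_norm_mul_le hf hg) hq

theorem pairing_sub_left {d : ℕ} {f f' g : Space d → ℝ} {a : Space d → ℂ} {q : ℝ}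
    (hf : MemLp f 2 (weightMeasure d)) (hf' : MemLp f' 2 (weightMeasure d))
    (hg : MemLp g 2 (weightMeasure d)) (hac : Continuous a)
    (ha : ∀ y, ‖a y‖ ≤ q * decayWeight (d + 1) y) :
    pairing (f - f') g a = pairing f g a - pairing f' g a := by
  rw [pairing, pairing, pairing, ← integral_sub (integrable_pairing hf hg hac ha)
    (integrable_pairing hf' hg hac ha)]
  refine integral_congr_ae (Eventually.of_forall fun y => ?_)
  simp only [Pi.sub_apply]
  push_cast; ring

theorem pairing_comm {d : ℕ} (f g : Space d → ℝ) (a : Space d → ℂ) :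
    pairing f g a = pairing g f a := by
  simp only [pairing, mul_comm]

theorem pairing_sub_right {d : ℕ} {f g : Space d → ℝ} {a b : Space d → ℂ} {q r : ℝ}
    (hf : MemLp f 2 (weightMeasure d)) (hg : MemLp g 2 (weightMeasure d)) (hac : Continuous a)
    (hbc : Continuous b) (ha : ∀ y, ‖a y‖ ≤ q * decayWeight (d + 1) y)
    (hb : ∀ y, ‖b y‖ ≤ r * decayWeight (d + 1) y) :
    pairing f g (a - b) = pairing f g a - pairing f g b := by
  rw [pairing, pairing, pairing, ← integral_sub (integrable_pairing hf hg hac ha)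
    (integrable_pairing hf hg hbc hb)]
  refine integral_congr_ae (Eventually.of_forall fun y => ?_)
  simp only [Pi.sub_apply]
  ring

theorem pairing_sum {d : ℕ} {ι : Type*} {f g : Space d → ℝ} (s : Finset ι) {a : ι → Space d → ℂ}
    {q : ι → ℝ}
    (hf : MemLp f 2 (weightMeasure d)) (hg : MemLp g 2 (weightMeasure d))
    (hac : ∀ i, Continuous (a i)) (ha : ∀ i y, ‖a i y‖ ≤ q i * decayWeight (d + 1) y) :
    pairing f g (fun y => ∑ i ∈ s, a i y) = ∑ i ∈ s, pairing f g (a i) := by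
  simp only [pairing]
  rw [← integral_finsetSum _ fun i _ => integrable_pairing hf hg (hac i) (ha i)]
  simp only [Finset.mul_sum]

theorem weightNorm_sub_comm {d : ℕ} {F : Type*} [NormedAddCommGroup F] (f g : Space d → F) :
    weightNorm (f - g) = weightNorm (g - f) := by
  rw [weightNorm, weightNorm, eLpNorm_sub_comm]

theorem weightNorm_le_add {d : ℕ} {F : Type*} [NormedAddCommGroup F] {f g : Space d → F}
    (hf : MemLp f 2 (weightMeasure d)) (hg : MemLp g 2 (weightMeasure d)) :
    weightNorm f ≤ weightNorm g + weightNorm (f - g) := by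
  rw [weightNorm, weightNorm, weightNorm, ← ENNReal.toReal_add hg.2.ne (hf.sub hg).2.ne]
  refine ENNReal.toReal_mono (ENNReal.add_ne_top.2 ⟨hg.2.ne, (hf.sub hg).2.ne⟩) ?_
  have := eLpNorm_add_le hg.1 (hf.sub hg).1 (p := 2) (by norm_num)
  rwa [add_sub_cancel] at this

/-- Joint continuity of the pairing. -/
theorem tendsto_pairing {d : ℕ} {ι : Type*} {l : Filter ι} {f g : ι → Space d → ℝ}
    {f₀ g₀ : Space d → ℝ} {a : ι → Space d → ℂ} {a₀ : Space d → ℂ} {q : ι → ℝ} {q₀ : ℝ}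
    (hf : ∀ᶠ i in l, MemLp (f i) 2 (weightMeasure d))
    (hg : ∀ᶠ i in l, MemLp (g i) 2 (weightMeasure d))
    (hf₀ : MemLp f₀ 2 (weightMeasure d)) (hg₀ : MemLp g₀ 2 (weightMeasure d))
    (hft : Tendsto (fun i => weightNorm (f i - f₀)) l (𝓝 0))
    (hgt : Tendsto (fun i => weightNorm (g i - g₀)) l (𝓝 0))
    (hac : ∀ i, Continuous (a i)) (hac₀ : Continuous a₀)
    (ha₀ : ∀ y, ‖a₀ y‖ ≤ q₀ * decayWeight (d + 1) y)
    (ha : ∀ᶠ i in l, ∀ y, ‖a i y - a₀ y‖ ≤ q i * decayWeight (d + 1) y) (hq : Tendsto q l (𝓝 0)) :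
    Tendsto (fun i => pairing (f i) (g i) (a i)) l (𝓝 (pairing f₀ g₀ a₀)) := by
  rw [tendsto_iff_norm_sub_tendsto_zero]
  have hlim : Tendsto (fun i => (q i + q₀) * (weightNorm (f i - f₀) *
      (weightNorm g₀ + weightNorm (g i - g₀))) + (q i + q₀) * (weightNorm f₀ *
      weightNorm (g i - g₀)) + q i * (weightNorm f₀ * weightNorm g₀)) l (𝓝 0) := by
    have h1 : Tendsto (fun i => q i + q₀) l (𝓝 (0 + q₀)) := hq.add_const _
    have := ((h1.mul (hft.mul (hgt.const_add (weightNorm g₀)))).add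
      (h1.mul (hgt.const_mul (weightNorm f₀)))).add (hq.mul_const (weightNorm f₀ * weightNorm g₀))
    simpa using this
  refine squeeze_zero' (Eventually.of_forall fun i => norm_nonneg _) ?_ hlim
  filter_upwards [hf, hg, ha] with i hfi hgi ha
  have hai : ∀ y, ‖a i y‖ ≤ (q i + q₀) * decayWeight (d + 1) y := fun y => by
    calc ‖a i y‖ = ‖(a i y - a₀ y) + a₀ y‖ := by rw [sub_add_cancel]
      _ ≤ _ := (norm_add_le _ _).trans (by rw [add_mul]; exact add_le_add (ha y) (ha₀ y))
  -- One factor is changed at a time. In the middle term the arguments are exchanged so that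
  -- additivity in the first argument suffices.
  have e : pairing (f i) (g i) (a i) - pairing f₀ g₀ a₀ =
      pairing (f i - f₀) (g i) (a i) + pairing (g i - g₀) f₀ (a i) +
        pairing f₀ g₀ (a i - a₀) := by
    rw [pairing_sub_left hfi hf₀ hgi (hac i) hai, pairing_sub_left hgi hg₀ hf₀ (hac i) hai,
      pairing_sub_right hf₀ hg₀ (hac i) hac₀ hai ha₀, pairing_comm f₀ (g i),
      pairing_comm g₀ f₀]
    ring
  rw [e]
  have h0 : 0 ≤ q i + q₀ :=
    nonneg_of_mul_nonneg_left ((norm_nonneg _).trans (hai 0)) (decayWeight_pos _ _)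
  refine (norm_add_le _ _).trans (add_le_add ((norm_add_le _ _).trans (add_le_add ?_ ?_)) ?_)
  · refine (norm_pairing_le (hfi.sub hf₀) hgi hai).trans ?_
    have := weightNorm_le_add hgi hg₀
    have := weightNorm_nonneg (f i - f₀)
    gcongr
  · refine (norm_pairing_le (hgi.sub hg₀) hf₀ hai).trans ?_
    rw [mul_comm (weightNorm f₀)]
  · exact norm_pairing_le hf₀ hg₀ ha

/-! ### The pressure operator as a pairing -/

/-- Both terms of the operator are transposed, the convolution with `Γ` by Fubini's theorem, and
`pressureFun_eq_add` reassembles them. The integrability shown on the way guarantees that `ofFun` is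
not its default value 0. -/
theorem pressureOp_apply {d : ℕ} (hd : 2 ≤ d) {χ θ : Space d → ℝ} (hχ : IsCutoff χ)
    (hθ : IsCutoff θ) {u v : Space d → Space d}
    (hu : ∀ j, MemLp (fun x => u x j) 2 (weightMeasure d))
    (hv : ∀ j, MemLp (fun x => v x j) 2 (weightMeasure d)) (l : Fin d) (φ : 𝓢(Space d, ℂ)) :
    pressureOp χ θ u v l φ =
      ∑ j, ∑ k, pairing (fun x => u x j) (fun x => v x k) (pressureFun l j k φ) := by
  obtain ⟨q, -, -, hq⟩ := exists_pressureFun_bound hd hχ hθ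
  have key : ∀ j k, (TemperedDistribution.fourierMultiplierCLM ℂ (highFreqSymbol χ l j k)
        (ofFun fun x => ((u x j * v x k : ℝ) : ℂ)) +
      ofFun fun x => ∫ y, pressureKernel χ θ l j k (x - y) * ((u y j * v y k : ℝ) : ℂ) : 𝓢'(Space d, ℂ)) φ =
      pairing (fun x => u x j) (fun x => v x k) (pressureFun l j k φ) := by
    intro j k
    have hf : Integrable (fun y => (decayWeight (d + 1) y : ℂ) * ((u y j * v y k : ℝ) : ℂ))
        volume := by
      refine (integrable_weight_mul (hu j) (hv k)).ofReal.congr (Eventually.of_forall fun y => ?_)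
      simp
    obtain ⟨C, hC, hCb⟩ := exists_decay_pressureKernel (d := d) hd hχ hθ l j k
    have hcont := continuous_pressureKernel hd hχ hθ l j k
    have hp2 : HasPolyIntegrability
        fun x => ∫ y, pressureKernel χ θ l j k (x - y) * ((u y j * v y k : ℝ) : ℂ) := by
      -- The weight itself plays the role of the rapidly decreasing test function, with constant `D
      -- = 1`.
      refine hasPolyIntegrability_of_weight (N := (d + 1) + (d + 1)) ?_
      refine integrable_mul_convolution (N := d + 1) (D := 1) hC hcont
        (Complex.continuous_ofReal.comp (continuous_decayWeight _)) hCb (fun x => ?_) hf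
      rw [Complex.norm_real, Real.norm_of_nonneg (decayWeight_nonneg _ _), one_mul]
    rw [add_apply, fourierMultiplier_apply_eq_transMult,
      ofFun_apply (hasPolyIntegrability_of_weight hf), ofFun_apply hp2,
      integral_mul_convolution hC hcont φ.continuous hCb
        (norm_le_schwartzDecay ((d + 1) + (d + 1)) φ) hf, pairing]
    set g := transMult (highFreqSymbol χ l j k) φ with hg
    have hg1 := integrable_pairing (hu j) (hv k) g.continuous (norm_le_schwartzDecay (d + 1) g)
    have hg2 := integrable_pairing (hu j) (hv k) (continuous_pressureFun l j k φ) (hq l j k φ)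
    have e : ∀ y, ((u y j * v y k : ℝ) : ℂ) * ∫ x, pressureKernel χ θ l j k (x - y) * φ x =
        ((u y j * v y k : ℝ) : ℂ) * pressureFun l j k φ y - ((u y j * v y k : ℝ) : ℂ) * g y := by
      intro y
      rw [pressureFun_eq_add hd hχ hθ, hg]; ring
    simp_rw [e]
    rw [integral_sub hg2 hg1]
    simp_rw [mul_comm (g _)]
    ring
  rw [pressureOp]
  simp_rw [sum_apply, key]

/-! ### Morrey spaces and the weighted `L²` space -/

/-- Only the term with the least `k` such that `|x| < 2^k` is kept; for `k ≥ 1` minimality gives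
`|x| ≥ 2^{k-1}`, whence the factor `2^N`. -/
theorem ofReal_decayWeight_le_tsum {d : ℕ} (N : ℕ) (x : Space d) :
    ENNReal.ofReal (decayWeight N x) ≤ ∑' k : ℕ, ENNReal.ofReal (2 ^ N * ((2 ^ k) ^ N)⁻¹) *
      (Metric.ball (0 : Space d) (2 ^ k)).indicator 1 x := by
  classical
  have hex : ∃ k : ℕ, ‖x‖ < 2 ^ k := pow_unbounded_of_one_lt ‖x‖ one_lt_two
  obtain ⟨k, hk, hmin⟩ : ∃ k : ℕ, ‖x‖ < 2 ^ k ∧ ∀ m < k, ¬ ‖x‖ < 2 ^ m :=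
    ⟨Nat.find hex, Nat.find_spec hex, fun m hm => Nat.find_min hex hm⟩
  refine le_trans ?_ (ENNReal.le_tsum k)
  rw [indicator_of_mem (by simpa using hk), Pi.one_apply, mul_one]
  refine ENNReal.ofReal_le_ofReal ?_
  rcases k with _ | k
  · simpa using (decayWeight_le_one N x).trans (one_le_pow₀ one_le_two)
  · have h1 : (2 : ℝ) ^ k ≤ ‖x‖ := not_lt.1 (hmin k (Nat.lt_succ_self k))
    have h2 : (2 : ℝ) ^ N * ((2 ^ (k + 1)) ^ N)⁻¹ = ((2 ^ k) ^ N)⁻¹ := by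
      rw [pow_succ, mul_pow]
      field_simp
    rw [h2, decayWeight]
    gcongr
    linarith

theorem lintegral_weightMeasure_le {d : ℕ} {g : Space d → ENNReal} (hg : AEMeasurable g volume) :
    ∫⁻ x, g x ∂weightMeasure d ≤ ∑' k : ℕ, ENNReal.ofReal (2 ^ (d + 1) * ((2 ^ k) ^ (d + 1))⁻¹) *
      ∫⁻ x in Metric.ball 0 (2 ^ k), g x := by
  rw [weightMeasure, lintegral_withDensity_eq_lintegral_mul₀
    (measurable_ofReal_decayWeight _).aemeasurable hg]
  calc ∫⁻ x, ((fun x => ENNReal.ofReal (decayWeight (d + 1) x)) * g : Space d → ENNReal) x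
      ≤ ∫⁻ x : Space d, ∑' k : ℕ, ENNReal.ofReal (2 ^ (d + 1) * ((2 ^ k) ^ (d + 1))⁻¹) *
        (Metric.ball (0 : Space d) (2 ^ k)).indicator g x := by
        refine lintegral_mono fun x => ?_
        simp only [Pi.mul_apply]
        refine (mul_le_mul_left (ofReal_decayWeight_le_tsum (d + 1) x) (g x)).trans ?_
        rw [← ENNReal.tsum_mul_right]
        refine ENNReal.tsum_le_tsum fun k => ?_
        rw [mul_assoc]
        gcongr
        by_cases h : x ∈ Metric.ball (0 : Space d) (2 ^ k)
        · rw [indicator_of_mem h, indicator_of_mem h, Pi.one_apply, one_mul]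
        · rw [indicator_of_notMem h, zero_mul]; exact zero_le
    _ = _ := by
        rw [lintegral_tsum fun k => (hg.indicator measurableSet_ball).const_mul _]
        refine tsum_congr fun k => ?_
        rw [lintegral_const_mul'' _ (hg.indicator measurableSet_ball),
          lintegral_indicator measurableSet_ball]

theorem eLpNorm_two_sq {X F : Type*} [MeasurableSpace X] {μ : Measure X} [NormedAddCommGroup F]
    (f : X → F) : eLpNorm f 2 μ ^ 2 = ∫⁻ x, ‖f x‖ₑ ^ 2 ∂μ := by
  have := eLpNorm_nnreal_pow_eq_lintegral (f := f) (μ := μ) (p := 2) (by norm_num)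
  simpa using this

theorem eLpNorm_ball_le {d : ℕ} {α : ℝ} {f : Space d → Space d} {r : ℝ} (hr : 1 ≤ r) :
    eLpNorm f 2 (volume.restrict (Metric.ball 0 r)) ≤
      morreyENorm α f * ENNReal.ofReal (r ^ (α + (d : ℝ) / 2)) := by
  have hp : 0 < r ^ (α + (d : ℝ) / 2) := Real.rpow_pos_of_pos (by linarith) _
  rw [← ENNReal.div_le_iff (by simpa using hp) ENNReal.ofReal_ne_top]
  exact le_iSup₂ (f := fun (r : ℝ) (_ : 1 ≤ r) => eLpNorm f 2 (volume.restrict (Metric.ball 0 r)) /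
    ENNReal.ofReal (r ^ (α + (d : ℝ) / 2))) r hr

/-- The ball of radius `2^k` contributes `2^{-k(d+1)} · 2^{k(2α+d)} = 2^{k(2α-1)}` to the squared
norm, a geometric series that converges because `α < 1/2`. -/
theorem exists_eLpNorm_weightMeasure_le {d : ℕ} {α : ℝ} (hα : α < 1 / 2) :
    ∃ C : ENNReal, C ≠ ⊤ ∧ ∀ f : Space d → Space d, AEStronglyMeasurable f volume →
      eLpNorm f 2 (weightMeasure d) ≤ C * morreyENorm α f := by
  set ρ : ℝ := 2 ^ (2 * α - 1) with hρ
  have hρ0 : 0 < ρ := Real.rpow_pos_of_pos two_pos _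
  have hρ1 : ρ < 1 := Real.rpow_lt_one_of_one_lt_of_neg one_lt_two (by linarith)
  have hs : Summable fun k : ℕ => (2 : ℝ) ^ (d + 1) * ρ ^ k :=
    (summable_geometric_of_lt_one hρ0.le hρ1).mul_left _
  set A := ∑' k : ℕ, ENNReal.ofReal (2 ^ (d + 1) * ρ ^ k) with hA
  have hAt : A ≠ ⊤ := hs.tsum_ofReal_ne_top
  refine ⟨A ^ (1 / 2 : ℝ), ENNReal.rpow_ne_top_of_nonneg (by norm_num) hAt, fun f hf => ?_⟩
  have hsq : eLpNorm f 2 (weightMeasure d) ^ 2 ≤ A * morreyENorm α f ^ 2 := by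
    rw [eLpNorm_two_sq]
    refine (lintegral_weightMeasure_le (hf.enorm.pow_const 2)).trans ?_
    rw [hA, ← ENNReal.tsum_mul_right]
    refine ENNReal.tsum_le_tsum fun k => ?_
    rw [← eLpNorm_two_sq]
    have h1 : (1 : ℝ) ≤ 2 ^ k := one_le_pow₀ one_le_two
    calc ENNReal.ofReal (2 ^ (d + 1) * ((2 ^ k) ^ (d + 1))⁻¹) *
          eLpNorm f 2 (volume.restrict (Metric.ball 0 (2 ^ k))) ^ 2
        ≤ ENNReal.ofReal (2 ^ (d + 1) * ((2 ^ k) ^ (d + 1))⁻¹) *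
          (morreyENorm α f * ENNReal.ofReal (((2 : ℝ) ^ k) ^ (α + (d : ℝ) / 2))) ^ 2 := by
          gcongr
          exact eLpNorm_ball_le h1
      _ = ENNReal.ofReal (2 ^ (d + 1) * ((2 ^ k) ^ (d + 1))⁻¹) *
          ENNReal.ofReal ((((2 : ℝ) ^ k) ^ (α + (d : ℝ) / 2)) ^ 2) * morreyENorm α f ^ 2 := by
          rw [mul_pow, ← ENNReal.ofReal_pow (by positivity)]
          ring
      _ = _ := by
          rw [← ENNReal.ofReal_mul (by positivity)]
          congr 2
          rw [mul_assoc]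
          congr 1
          rw [hρ, ← Real.rpow_natCast (((2 : ℝ) ^ k) ^ (α + (d : ℝ) / 2)) 2,
            ← Real.rpow_natCast ((2 : ℝ) ^ k) (d + 1), ← Real.rpow_natCast 2 k,
            ← Real.rpow_natCast ((2 : ℝ) ^ (2 * α - 1)) k, ← Real.rpow_mul two_pos.le,
            ← Real.rpow_mul two_pos.le, ← Real.rpow_mul two_pos.le, ← Real.rpow_mul two_pos.le,
            ← Real.rpow_neg two_pos.le, ← Real.rpow_add two_pos]
          congr 1
          push_cast; ring
  have h2 := ENNReal.rpow_le_rpow hsq (z := 1 / 2) (by norm_num)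
  rw [ENNReal.mul_rpow_of_nonneg _ _ (by norm_num), ← ENNReal.rpow_natCast,
    ← ENNReal.rpow_natCast, ← ENNReal.rpow_mul, ← ENNReal.rpow_mul] at h2
  simpa using h2

/-- Continuity on `[0,T)` with values in the weighted `L²` space. -/
def ContinuousInWeight {d : ℕ} {F : Type*} [NormedAddCommGroup F] (T : ℝ)
    (f : ℝ → Space d → F) : Prop :=
  (∀ t ∈ Ico 0 T, MemLp (f t) 2 (weightMeasure d)) ∧
    ∀ t ∈ Ico 0 T, Tendsto (fun s => weightNorm (f s - f t)) (𝓝[Ico 0 T] t) (𝓝 0)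

theorem MemMorrey.memLp {d : ℕ} {α : ℝ} (hα : α < 1 / 2) {f : Space d → Space d}
    (hf : MemMorrey α f) : MemLp f 2 (weightMeasure d) := by
  obtain ⟨C, hC, h⟩ := exists_eLpNorm_weightMeasure_le (d := d) hα
  exact ⟨hf.1.mono_ac (weightMeasure_ac d),
    (h f hf.1).trans_lt (ENNReal.mul_lt_top hC.lt_top hf.2)⟩

theorem ContinuousInMorrey.continuousInWeight {d : ℕ} {T α : ℝ} (hα : α < 1 / 2)
    {u : ℝ → Space d → Space d} (hu : ContinuousInMorrey T α u) : ContinuousInWeight T u := by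
  obtain ⟨C, hC, h⟩ := exists_eLpNorm_weightMeasure_le (d := d) hα
  refine ⟨fun t ht => (hu.1 t ht).memLp hα, fun t ht => ?_⟩
  have h1 := ENNReal.Tendsto.const_mul (hu.2 t ht) (Or.inr hC)
  rw [mul_zero] at h1
  have h2 : Tendsto (fun s => eLpNorm (u s - u t) 2 (weightMeasure d)) (𝓝[Ico 0 T] t) (𝓝 0) := by
    refine tendsto_of_tendsto_of_tendsto_of_le_of_le' tendsto_const_nhds h1
      (Eventually.of_forall fun s => zero_le) ?_
    filter_upwards [self_mem_nhdsWithin] with s hs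
    exact h _ ((hu.1 s hs).1.sub (hu.1 t ht).1)
  have h3 := (ENNReal.tendsto_toReal ENNReal.zero_ne_top).comp h2
  exact h3

theorem memLp_component {d : ℕ} {f : Space d → Space d} (hf : MemLp f 2 (weightMeasure d))
    (j : Fin d) : MemLp (fun x => f x j) 2 (weightMeasure d) :=
  hf.of_le ((EuclideanSpace.proj (𝕜 := ℝ) j).continuous.comp_aestronglyMeasurable hf.1)
    (Eventually.of_forall fun x => PiLp.norm_apply_le (f x) j)

theorem weightNorm_component_le {d : ℕ} {f : Space d → Space d}
    (hf : MemLp f 2 (weightMeasure d)) (j : Fin d) :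
    weightNorm (fun x => f x j) ≤ weightNorm f :=
  ENNReal.toReal_mono hf.2.ne
    (eLpNorm_mono_ae (Eventually.of_forall fun x => PiLp.norm_apply_le (f x) j))

theorem ContinuousInWeight.component {d : ℕ} {T : ℝ} {u : ℝ → Space d → Space d}
    (hu : ContinuousInWeight T u) (j : Fin d) : ContinuousInWeight T fun t x => u t x j := by
  refine ⟨fun t ht => memLp_component (hu.1 t ht) j, fun t ht => ?_⟩
  refine squeeze_zero' (Eventually.of_forall fun s => weightNorm_nonneg _) ?_ (hu.2 t ht)
  filter_upwards [self_mem_nhdsWithin] with s hs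
  exact weightNorm_component_le ((hu.1 s hs).sub (hu.1 t ht)) j

theorem continuousInWeight_const {d : ℕ} {T : ℝ} {f : Space d → ℝ}
    (hf : MemLp f 2 (weightMeasure d)) : ContinuousInWeight T fun _ => f :=
  ⟨fun _ _ => hf, fun _ _ => by simpa [weightNorm] using tendsto_const_nhds⟩

/-- The weighted measure is finite. Linear functionals of `u` are thus pairings with second factor 1
and need no separate estimates. -/
theorem memLp_one {d : ℕ} : MemLp (fun _ : Space d => (1 : ℝ)) 2 (weightMeasure d) := memLp_const 1

theorem ContinuousInWeight.continuousOn_weightNorm {d : ℕ} {T : ℝ} {f : ℝ → Space d → ℝ}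
    (hf : ContinuousInWeight T f) : ContinuousOn (fun t => weightNorm (f t)) (Ico 0 T) := by
  intro t ht
  rw [ContinuousWithinAt, tendsto_iff_norm_sub_tendsto_zero]
  refine squeeze_zero' (Eventually.of_forall fun s => norm_nonneg _) ?_ (hf.2 t ht)
  filter_upwards [self_mem_nhdsWithin] with s hs
  have h1 := weightNorm_le_add (hf.1 s hs) (hf.1 t ht)
  have h2 := weightNorm_le_add (hf.1 t ht) (hf.1 s hs)
  rw [weightNorm_sub_comm] at h2
  rw [Real.norm_eq_abs, abs_le]
  constructor <;> linarith

theorem ContinuousInWeight.exists_bound {d : ℕ} {T : ℝ} {f : ℝ → Space d → ℝ}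
    (hf : ContinuousInWeight T f) {t : ℝ} (ht : t < T) :
    ∃ B, 0 ≤ B ∧ ∀ s ∈ Icc 0 t, weightNorm (f s) ≤ B := by
  obtain ⟨B, hB⟩ := isCompact_Icc.exists_bound_of_continuousOn
    (hf.continuousOn_weightNorm.mono fun s (hs : s ∈ Icc 0 t) => ⟨hs.1, hs.2.trans_lt ht⟩)
  refine ⟨max B 0, le_max_right _ _, fun s hs => le_max_of_le_left ((le_abs_self _).trans ?_)⟩
  exact hB s hs

/-! ### Linear maps from Schwartz functions to functions with decay `|x|^{-d-1}` -/

/-- The linear map `L` takes Schwartz functions to continuous functions of size `|x|^{-d-1}`,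
continuously. -/
structure IsWeightBounded {d : ℕ} (L : 𝓢(Space d, ℂ) →ₗ[ℂ] (Space d → ℂ)) : Prop where
  continuous : ∀ φ, Continuous (L φ)
  bound : ∃ q : 𝓢(Space d, ℂ) → ℝ, Continuous q ∧ q 0 = 0 ∧
    ∀ φ y, ‖L φ y‖ ≤ q φ * decayWeight (d + 1) y

theorem IsWeightBounded.sub {d : ℕ} {L M : 𝓢(Space d, ℂ) →ₗ[ℂ] (Space d → ℂ)}
    (hL : IsWeightBounded L) (hM : IsWeightBounded M) : IsWeightBounded (L - M) := by
  obtain ⟨q, hq, hq0, hqb⟩ := hL.bound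
  obtain ⟨r, hr, hr0, hrb⟩ := hM.bound
  refine ⟨fun φ => (hL.continuous φ).sub (hM.continuous φ), fun φ => q φ + r φ, hq.add hr,
    by simp only [hq0, hr0, add_zero], fun φ y => ?_⟩
  rw [add_mul]
  exact (norm_sub_le _ _).trans (add_le_add (hqb φ y) (hrb φ y))

theorem IsWeightBounded.zero {d : ℕ} :
    IsWeightBounded (0 : 𝓢(Space d, ℂ) →ₗ[ℂ] (Space d → ℂ)) :=
  ⟨fun _ => continuous_const, fun _ => 0, continuous_const, rfl, fun φ y => by simp⟩

/-- Evaluation of a continuous linear map on Schwartz functions. -/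
def coeMap {d : ℕ} (A : 𝓢(Space d, ℂ) →L[ℂ] 𝓢(Space d, ℂ)) :
    𝓢(Space d, ℂ) →ₗ[ℂ] (Space d → ℂ) where
  toFun φ := ⇑(A φ)
  map_add' φ ψ := by rw [map_add]; rfl
  map_smul' c φ := by rw [map_smul]; rfl

theorem isWeightBounded_coeMap {d : ℕ} (A : 𝓢(Space d, ℂ) →L[ℂ] 𝓢(Space d, ℂ)) :
    IsWeightBounded (coeMap A) :=
  ⟨fun φ => (A φ).continuous, fun φ => schwartzDecay (d + 1) (A φ),
    (continuous_schwartzDecay _).comp A.continuous, by simp only [map_zero, schwartzDecay_zero],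
    fun φ => norm_le_schwartzDecay _ _⟩

/-- The linear map `pressureFun l j k`. -/
def pressureMap {d : ℕ} (l j k : Fin d) : 𝓢(Space d, ℂ) →ₗ[ℂ] (Space d → ℂ) where
  toFun := pressureFun l j k
  map_add' φ ψ := by
    have h := fun y => pressureFun_sub l j k (φ + ψ) ψ y
    simp only [add_sub_cancel_right] at h
    ext y
    rw [Pi.add_apply, h y, sub_add_cancel]
  map_smul' c φ := by
    ext y
    rw [RingHom.id_apply, Pi.smul_apply, pressureFun, pressureFun, symbolFun_eq_integral,
      symbolFun_eq_integral, ← integral_smul]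
    congr 1; ext ξ
    rw [FourierTransform.fourierInv_smul, smul_apply, smul_comm c, smul_eq_mul, smul_eq_mul,
      mul_left_comm]

theorem isWeightBounded_pressureMap {d : ℕ} (hd : 2 ≤ d) {χ : Space d → ℝ} (hχ : IsCutoff χ)
    (l j k : Fin d) : IsWeightBounded (pressureMap (d := d) l j k) := by
  obtain ⟨q, hq, hq0, hqb⟩ := exists_pressureFun_bound hd hχ hχ
  exact ⟨continuous_pressureFun l j k, q, hq, hq0, hqb l j k⟩

theorem pairing_map_add {d : ℕ} {L : 𝓢(Space d, ℂ) →ₗ[ℂ] (Space d → ℂ)} (hL : IsWeightBounded L)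
    {f g : Space d → ℝ} (hf : MemLp f 2 (weightMeasure d)) (hg : MemLp g 2 (weightMeasure d))
    (φ ψ : 𝓢(Space d, ℂ)) :
    pairing f g (L (φ + ψ)) = pairing f g (L φ) + pairing f g (L ψ) := by
  obtain ⟨q, -, -, hq⟩ := hL.bound
  rw [pairing, pairing, pairing, ← integral_add
    (integrable_pairing hf hg (hL.continuous φ) (hq φ))
    (integrable_pairing hf hg (hL.continuous ψ) (hq ψ)), map_add]
  simp only [Pi.add_apply, mul_add]

theorem pairing_map_smul {d : ℕ} (L : 𝓢(Space d, ℂ) →ₗ[ℂ] (Space d → ℂ))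
    (f g : Space d → ℝ) (c : ℂ) (φ : 𝓢(Space d, ℂ)) :
    pairing f g (L (c • φ)) = c * pairing f g (L φ) := by
  rw [pairing, pairing, ← integral_const_mul, map_smul]
  simp only [Pi.smul_apply, smul_eq_mul, mul_left_comm]

theorem pairing_map_sum {d : ℕ} {ι : Type*} {L : ι → 𝓢(Space d, ℂ) →ₗ[ℂ] (Space d → ℂ)}
    (hL : ∀ i, IsWeightBounded (L i))
    {f g : Space d → ℝ} (hf : MemLp f 2 (weightMeasure d)) (hg : MemLp g 2 (weightMeasure d))
    (s : Finset ι) (φ : ι → 𝓢(Space d, ℂ)) :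
    ∑ i ∈ s, pairing f g (L i (φ i)) = pairing f g fun y => ∑ i ∈ s, L i (φ i) y := by
  choose q _ _ hq using fun i => (hL i).bound
  exact (pairing_sum s hf hg (fun i => (hL i).continuous _) fun i => hq i (φ i)).symm

theorem ContinuousInWeight.continuousOn_pairing {d : ℕ} {T : ℝ}
    {L : 𝓢(Space d, ℂ) →ₗ[ℂ] (Space d → ℂ)} (hL : IsWeightBounded L) {f g : ℝ → Space d → ℝ}
    (hf : ContinuousInWeight T f) (hg : ContinuousInWeight T g) {φ : ℝ → 𝓢(Space d, ℂ)}
    (hφ : ContinuousOn φ (Ico 0 T)) :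
    ContinuousOn (fun t => pairing (f t) (g t) (L (φ t))) (Ico 0 T) := by
  obtain ⟨q, hq, hq0, hqb⟩ := hL.bound
  intro t ht
  refine tendsto_pairing (q := fun s => q (φ s - φ t)) (q₀ := q (φ t))
    (eventually_mem_nhdsWithin.mono hf.1) (eventually_mem_nhdsWithin.mono hg.1) (hf.1 t ht)
    (hg.1 t ht) (hf.2 t ht) (hg.2 t ht) (fun s => hL.continuous _) (hL.continuous _) (hqb _)
    (Eventually.of_forall fun s y => ?_) ?_
  · have := hqb (φ s - φ t) y
    rwa [map_sub, Pi.sub_apply] at this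
  · have h1 : Tendsto (fun s => φ s - φ t) (𝓝[Ico 0 T] t) (𝓝 (φ t - φ t)) :=
      (hφ t ht).sub tendsto_const_nhds
    rw [sub_self] at h1
    have h2 := (hq.tendsto 0).comp h1
    rwa [hq0] at h2

/-! ### Density of the test functions in the Schwartz space -/

/-- A real test function as a Schwartz function. -/
def schwartzOfTest {d : ℕ} {Ω : TopologicalSpace.Opens (Space d)} (b : 𝓓(Ω, ℝ)) : 𝓢(Space d, ℂ) :=
  HasCompactSupport.toSchwartzMap (f := fun x => ((b x : ℝ) : ℂ))
    (b.hasCompactSupport.comp_left (g := Complex.ofReal) Complex.ofReal_zero)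
    (Complex.ofRealCLM.contDiff.comp b.contDiff)

@[simp]
theorem schwartzOfTest_apply {d : ℕ} {Ω : TopologicalSpace.Opens (Space d)} (b : 𝓓(Ω, ℝ))
    (x : Space d) : schwartzOfTest b x = ((b x : ℝ) : ℂ) := rfl

/-- The cut-off function `χ(c x)` as a complex function. -/
def dilatedCutoff {d : ℕ} (χ : Space d → ℝ) (c : ℝ) (x : Space d) : ℂ := ((χ (c • x) : ℝ) : ℂ)

theorem contDiff_dilatedCutoff {d : ℕ} {χ : Space d → ℝ} (hχ : IsCutoff χ) (c : ℝ) :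
    ContDiff ℝ ∞ (dilatedCutoff χ c) :=
  Complex.ofRealCLM.contDiff.comp (hχ.smooth.comp (contDiff_const_smul _))

theorem hasCompactSupport_dilatedCutoff {d : ℕ} {χ : Space d → ℝ} (hχ : IsCutoff χ) {c : ℝ}
    (hc : c ≠ 0) : HasCompactSupport (dilatedCutoff χ c) :=
  (hχ.hasCompactSupport.comp_smul hc).comp_left (g := Complex.ofReal) Complex.ofReal_zero

theorem hasTemperateGrowth_dilatedCutoff {d : ℕ} {χ : Space d → ℝ} (hχ : IsCutoff χ) {c : ℝ}
    (hc : c ≠ 0) : (dilatedCutoff χ c).HasTemperateGrowth :=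
  (hasCompactSupport_dilatedCutoff hχ hc).hasTemperateGrowth (contDiff_dilatedCutoff hχ c)

/-- The dilation contributes a factor `c^i ≤ 1`, so the bounds are uniform in `c`. -/
theorem exists_bound_iteratedFDeriv_dilatedCutoff {d : ℕ} {χ : Space d → ℝ} (hχ : IsCutoff χ) :
    ∃ M : ℕ → ℝ, ∀ i c x, 0 ≤ c → c ≤ 1 →
      ‖iteratedFDeriv ℝ i (dilatedCutoff χ c) x‖ ≤ M i := by
  have h : ∀ i : ℕ, ∃ C, ∀ x, ‖iteratedFDeriv ℝ i (dilatedCutoff χ 1) x‖ ≤ C := fun i =>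
    ((hasCompactSupport_dilatedCutoff hχ one_ne_zero).iteratedFDeriv i).exists_bound_of_continuous
      ((contDiff_dilatedCutoff hχ 1).continuous_iteratedFDeriv (by exact_mod_cast le_top))
  choose M hM using h
  refine ⟨M, fun i c x hc0 hc1 => ?_⟩
  have e : dilatedCutoff χ c = fun x => dilatedCutoff χ 1 (c • x) := by
    ext x; simp [dilatedCutoff]
  rw [e, iteratedFDeriv_comp_const_smul c ((contDiff_dilatedCutoff hχ 1).of_le
    (by exact_mod_cast le_top)), norm_smul, norm_pow, Real.norm_of_nonneg hc0]
  calc c ^ i * ‖iteratedFDeriv ℝ i (dilatedCutoff χ 1) (c • x)‖ ≤ 1 * M i := by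
        gcongr
        · exact pow_le_one₀ hc0 hc1
        · exact hM i _
    _ = M i := one_mul _

/-- The truncation error vanishes where `c|x| < 1`. Elsewhere a factor `c|x| ≥ 1` can be inserted,
so each seminorm is at most `c` times seminorms of `φ` with one more power of `|x|`. -/
theorem tendsto_dilatedCutoff_smul {d : ℕ} {χ : Space d → ℝ} (hχ : IsCutoff χ)
    (φ : 𝓢(Space d, ℂ)) : Tendsto (fun n : ℕ =>
      SchwartzMap.smulLeftCLM ℂ (dilatedCutoff χ ((n : ℝ) + 1)⁻¹) φ) atTop (𝓝 φ) := by
  obtain ⟨M, hM⟩ := exists_bound_iteratedFDeriv_dilatedCutoff hχ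
  have hM0 : ∀ i, 0 ≤ M i := fun i => (norm_nonneg _).trans (hM i 0 0 le_rfl zero_le_one)
  rw [(schwartz_withSeminorms ℂ (Space d) ℂ).tendsto_nhds]
  rintro ⟨k, n⟩ ε hε
  set B := ∑ i ∈ Finset.range (n + 1), (n.choose i : ℝ) * M i *
    SchwartzMap.seminorm ℂ (k + 1) (n - i) φ + SchwartzMap.seminorm ℂ (k + 1) n φ with hB
  have hB0 : 0 ≤ B := by
    have : ∀ i, 0 ≤ M i := hM0
    refine add_nonneg (Finset.sum_nonneg fun i _ => ?_) (apply_nonneg _ _)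
    exact mul_nonneg (mul_nonneg (Nat.cast_nonneg _) (this i)) (apply_nonneg _ _)
  have key : ∀ N : ℕ, SchwartzMap.seminorm ℂ k n
      (SchwartzMap.smulLeftCLM ℂ (dilatedCutoff χ ((N : ℝ) + 1)⁻¹) φ - φ) ≤ B * ((N : ℝ) + 1)⁻¹ := by
    intro N
    have hN : (0 : ℝ) < (N : ℝ) + 1 := by positivity
    set c := ((N : ℝ) + 1)⁻¹ with hc
    have hc0 : 0 < c := inv_pos.2 hN
    have hc1 : c ≤ 1 := inv_le_one_of_one_le₀ (by linarith [(Nat.cast_nonneg N : (0 : ℝ) ≤ N)])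
    set g := SchwartzMap.smulLeftCLM ℂ (dilatedCutoff χ c) φ with hg
    have hgx : ⇑g = fun y => dilatedCutoff χ c y * φ y := by
      ext y
      rw [hg, SchwartzMap.smulLeftCLM_apply_apply (hasTemperateGrowth_dilatedCutoff hχ hc0.ne'),
        smul_eq_mul]
    refine SchwartzMap.seminorm_le_bound ℂ k n _ (by positivity) fun x => ?_
    by_cases hx : ‖c • x‖ < 1
    · have h0 : ⇑(g - φ) =ᶠ[𝓝 x] 0 := by
        have hcont : Continuous fun y : Space d => c • y := by fun_prop
        filter_upwards [hcont.continuousAt.eventually (hχ.eventually_eq_one hx)] with y hy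
        rw [sub_apply, hgx]
        simp [dilatedCutoff, hy]
      have h1 : x ∉ tsupport ⇑(g - φ) := notMem_tsupport_iff_eventuallyEq.2 h0
      rw [image_eq_zero_of_notMem_tsupport fun h => h1 (tsupport_iteratedFDeriv_subset n h),
        norm_zero, mul_zero]
      positivity
    · have hx1 : 1 ≤ c * ‖x‖ := by
        rwa [not_lt, norm_smul, Real.norm_of_nonneg hc0.le] at hx
      have e : iteratedFDeriv ℝ n ⇑(g - φ) x = iteratedFDeriv ℝ n g x - iteratedFDeriv ℝ n φ x :=
        iteratedFDeriv_sub_apply ((g.smooth n).contDiffAt) ((φ.smooth n).contDiffAt)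
      have h1 : ‖x‖ ^ (k + 1) * ‖iteratedFDeriv ℝ n ⇑(g - φ) x‖ ≤ B := by
        rw [e, hB]
        refine (mul_le_mul_of_nonneg_left (norm_sub_le _ _) (by positivity)).trans ?_
        rw [mul_add]
        refine add_le_add ?_ (SchwartzMap.le_seminorm ℂ (k + 1) n φ x)
        have h2 := norm_iteratedFDeriv_mul_le (contDiff_dilatedCutoff hχ c) (φ.smooth ⊤) x
          (n := n) (by exact_mod_cast le_top)
        rw [hgx]
        refine (mul_le_mul_of_nonneg_left h2 (by positivity)).trans ?_
        rw [Finset.mul_sum]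
        refine Finset.sum_le_sum fun i _ => ?_
        have h3 := SchwartzMap.le_seminorm ℂ (k + 1) (n - i) φ x
        have h4 := hM i c x hc0.le hc1
        calc ‖x‖ ^ (k + 1) * ((n.choose i : ℝ) * ‖iteratedFDeriv ℝ i (dilatedCutoff χ c) x‖ *
              ‖iteratedFDeriv ℝ (n - i) φ x‖)
            = (n.choose i : ℝ) * ‖iteratedFDeriv ℝ i (dilatedCutoff χ c) x‖ *
              (‖x‖ ^ (k + 1) * ‖iteratedFDeriv ℝ (n - i) φ x‖) := by ring
          _ ≤ _ := by
            have := hM0 i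
            gcongr
      calc ‖x‖ ^ k * ‖iteratedFDeriv ℝ n ⇑(g - φ) x‖
          ≤ (c * ‖x‖) * (‖x‖ ^ k * ‖iteratedFDeriv ℝ n ⇑(g - φ) x‖) :=
            le_mul_of_one_le_left (by positivity) hx1
        _ = (‖x‖ ^ (k + 1) * ‖iteratedFDeriv ℝ n ⇑(g - φ) x‖) * c := by ring
        _ ≤ B * c := by gcongr
  have hlim : Tendsto (fun N : ℕ => B * ((N : ℝ) + 1)⁻¹) atTop (𝓝 0) := by
    have h := tendsto_one_div_add_atTop_nhds_zero_nat (𝕜 := ℝ)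
    simp only [one_div] at h
    simpa using h.const_mul B
  filter_upwards [hlim.eventually (gt_mem_nhds hε)] with N hN
  exact (key N).trans_lt hN

/-- The real test function obtained from a real part map and truncation. -/
def truncatedTest {d : ℕ} {χ : Space d → ℝ} (hχ : IsCutoff χ) {c : ℝ} (hc : c ≠ 0)
    (φ : 𝓢(Space d, ℂ)) (R : ℂ →L[ℝ] ℝ) : 𝓓((⊤ : TopologicalSpace.Opens (Space d)), ℝ) where
  toFun x := χ (c • x) * R (φ x)
  contDiff' := (hχ.smooth.comp (contDiff_const_smul _)).mul (R.contDiff.comp (φ.smooth ⊤))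
  hasCompactSupport' := (hχ.hasCompactSupport.comp_smul hc).mul_right
  tsupport_subset' := by simp

/-- A tempered distribution that vanishes on the test functions is zero. -/
theorem map_eq_zero_of_test {d : ℕ} {χ : Space d → ℝ} (hχ : IsCutoff χ)
    {f : 𝓢(Space d, ℂ) →ₗ[ℂ] ℂ} (hf : Continuous f)
    (h : ∀ b : 𝓓((⊤ : TopologicalSpace.Opens (Space d)), ℝ), f (schwartzOfTest b) = 0)
    (φ : 𝓢(Space d, ℂ)) : f φ = 0 := by
  have h1 := (hf.tendsto φ).comp (tendsto_dilatedCutoff_smul hχ φ)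
  refine tendsto_nhds_unique (h1.congr fun n => ?_) tendsto_const_nhds
  have hc : ((n : ℝ) + 1)⁻¹ ≠ 0 := by positivity
  -- The test functions are real-valued, so the truncated function is split into real and imaginary
  -- parts.
  have e : SchwartzMap.smulLeftCLM ℂ (dilatedCutoff χ ((n : ℝ) + 1)⁻¹) φ =
      schwartzOfTest (truncatedTest hχ hc φ Complex.reCLM) +
        Complex.I • schwartzOfTest (truncatedTest hχ hc φ Complex.imCLM) := by
    ext x
    rw [SchwartzMap.smulLeftCLM_apply_apply (hasTemperateGrowth_dilatedCutoff hχ hc), add_apply,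
      smul_apply, schwartzOfTest_apply, schwartzOfTest_apply, smul_eq_mul, smul_eq_mul]
    have h1 : truncatedTest hχ hc φ Complex.reCLM x = χ (((n : ℝ) + 1)⁻¹ • x) * (φ x).re := rfl
    have h2 : truncatedTest hχ hc φ Complex.imCLM x = χ (((n : ℝ) + 1)⁻¹ • x) * (φ x).im := rfl
    rw [h1, h2, dilatedCutoff]
    conv_lhs => rw [← Complex.re_add_im (φ x)]
    push_cast; ring
  rw [Function.comp_apply, e, map_add, map_smul, h, h]
  simp

/-! ### Time slices of test fields -/

theorem testSlice_apply {d : ℕ} {T : ℝ} (φ : 𝓓(beforeTime d T, Space d)) (t : ℝ) (l : Fin d)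
    (x : Space d) : testSlice φ t l x = ((φ (t, x) l : ℝ) : ℂ) := rfl

/-- A component of a test field as a function of space and time. -/
def testComponent {d : ℕ} {T : ℝ} (φ : 𝓓(beforeTime d T, Space d)) (l : Fin d) :
    ℝ × Space d → ℂ := fun p => ((φ p l : ℝ) : ℂ)

theorem contDiff_testComponent {d : ℕ} {T : ℝ} (φ : 𝓓(beforeTime d T, Space d)) (l : Fin d) :
    ContDiff ℝ ∞ (testComponent φ l) :=
  Complex.ofRealCLM.contDiff.comp ((EuclideanSpace.proj (𝕜 := ℝ) l).contDiff.comp φ.contDiff)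

theorem hasCompactSupport_testComponent {d : ℕ} {T : ℝ} (φ : 𝓓(beforeTime d T, Space d))
    (l : Fin d) : HasCompactSupport (testComponent φ l) :=
  φ.hasCompactSupport.comp_left (g := fun v : Space d => ((v l : ℝ) : ℂ)) (by simp)

theorem iteratedFDeriv_testSlice {d : ℕ} {T : ℝ} (φ : 𝓓(beforeTime d T, Space d)) (l : Fin d)
    (t : ℝ) (n : ℕ) (x : Space d) : iteratedFDeriv ℝ n (testSlice φ t l) x =
      (iteratedFDeriv ℝ n (testComponent φ l) (t, x)).compContinuousLinearMap
        fun _ => ContinuousLinearMap.inr ℝ ℝ (Space d) := by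
  have e : ⇑(testSlice φ t l) = (fun p => testComponent φ l (p + (t, 0))) ∘
      ContinuousLinearMap.inr ℝ ℝ (Space d) := by
    ext y; simp [testSlice_apply, testComponent]
  have hs : ContDiff ℝ ∞ fun p => testComponent φ l (p + (t, 0)) :=
    (contDiff_testComponent φ l).comp (contDiff_id.add contDiff_const)
  rw [e, ContinuousLinearMap.iteratedFDeriv_comp_right _ hs x (by exact_mod_cast le_top),
    iteratedFDeriv_comp_add_right]
  simp

/-- `|x|^k` times the `n`-th space-time derivative is continuous with compact support, hence
uniformly continuous; uniformity in `x` is what a Schwartz seminorm requires. -/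
theorem exists_seminorm_testSlice_sub_le {d : ℕ} {T : ℝ} (φ : 𝓓(beforeTime d T, Space d))
    (l : Fin d) (t : ℝ) (k n : ℕ) {ε : ℝ} (hε : 0 < ε) : ∃ δ > 0, ∀ s, dist s t < δ →
      SchwartzMap.seminorm ℂ k n (testSlice φ s l - testSlice φ t l) ≤ ε := by
  have hψs := contDiff_testComponent φ l
  have hsl := iteratedFDeriv_testSlice φ l
  have hgc : Continuous fun p : ℝ × Space d =>
      ‖p.2‖ ^ k • iteratedFDeriv ℝ n (testComponent φ l) p := by
    have := hψs.continuous_iteratedFDeriv (m := n) (by exact_mod_cast le_top)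
    fun_prop
  have hgs : HasCompactSupport fun p : ℝ × Space d =>
      ‖p.2‖ ^ k • iteratedFDeriv ℝ n (testComponent φ l) p := by
    refine ((hasCompactSupport_testComponent φ l).iteratedFDeriv (𝕜 := ℝ) n).mono
      fun p hp h => hp ?_
    simp only
    rw [h, smul_zero]
  obtain ⟨δ, hδ, hδg⟩ := Metric.uniformContinuous_iff.1
    (hgs.uniformContinuous_of_continuous hgc) ε hε
  refine ⟨δ, hδ, fun s hs => SchwartzMap.seminorm_le_bound ℂ k n _ hε.le fun x => ?_⟩
  have e : iteratedFDeriv ℝ n ⇑(testSlice φ s l - testSlice φ t l) x =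
      iteratedFDeriv ℝ n (testSlice φ s l) x - iteratedFDeriv ℝ n (testSlice φ t l) x :=
    iteratedFDeriv_sub_apply (((testSlice φ s l).smooth n).contDiffAt)
      (((testSlice φ t l).smooth n).contDiffAt)
  have h1 := hδg (a := (s, x)) (b := (t, x)) (by
    rw [Prod.dist_eq, dist_self]
    exact max_lt hs hδ)
  rw [dist_eq_norm, ← smul_sub, norm_smul, norm_pow, norm_norm] at h1
  have h3 : iteratedFDeriv ℝ n (testSlice φ s l) x - iteratedFDeriv ℝ n (testSlice φ t l) x =
      (iteratedFDeriv ℝ n (testComponent φ l) (s, x) -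
        iteratedFDeriv ℝ n (testComponent φ l) (t, x)).compContinuousLinearMap
        fun _ => ContinuousLinearMap.inr ℝ ℝ (Space d) := by
    rw [hsl, hsl]; rfl
  rw [e, h3]
  refine le_trans (mul_le_mul_of_nonneg_left
    (ContinuousMultilinearMap.norm_compContinuousLinearMap_le _ _) (by positivity)) (le_trans ?_ h1.le)
  gcongr
  exact mul_le_of_le_one_right (norm_nonneg _) (Finset.prod_le_one (fun _ _ => norm_nonneg _)
    fun _ _ => ContinuousLinearMap.norm_inr_le_one _ _ _)

/-- The slices of a test field depend continuously on time. -/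
theorem continuous_testSlice {d : ℕ} {T : ℝ} (φ : 𝓓(beforeTime d T, Space d)) (l : Fin d) :
    Continuous fun t => testSlice φ t l := by
  rw [continuous_iff_continuousAt]
  intro t
  rw [ContinuousAt, (schwartz_withSeminorms ℂ (Space d) ℂ).tendsto_nhds]
  rintro ⟨k, n⟩ ε hε
  obtain ⟨δ, hδ, h⟩ := exists_seminorm_testSlice_sub_le φ l t k n (half_pos hε)
  filter_upwards [Metric.ball_mem_nhds t hδ] with s hs
  exact (h s hs).trans_lt (half_lt_self hε)

/-- The time derivative of a test field. -/
def timeDeriv {d : ℕ} {T : ℝ} (φ : 𝓓(beforeTime d T, Space d)) : 𝓓(beforeTime d T, Space d) where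
  toFun p := fderiv ℝ φ p (1, 0)
  contDiff' := (φ.contDiff.fderiv_right (m := ∞) (by simp)).clm_apply contDiff_const
  hasCompactSupport' := (φ.hasCompactSupport.fderiv ℝ).comp_left
    (g := fun A : ℝ × Space d →L[ℝ] Space d => A (1, 0)) rfl
  tsupport_subset' := (tsupport_comp_subset
    (g := fun A : ℝ × Space d →L[ℝ] Space d => A (1, 0)) rfl _).trans
      ((tsupport_fderiv_subset ℝ).trans φ.tsupport_subset)

theorem hasDerivAt_time {d : ℕ} {T : ℝ} (φ : 𝓓(beforeTime d T, Space d)) (t : ℝ) (x : Space d) :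
    HasDerivAt (fun s => φ (s, x)) (timeDeriv φ (t, x)) t := by
  have h1 : HasFDerivAt φ (fderiv ℝ φ (t, x)) (t, x) :=
    (φ.contDiff.differentiable (by simp)).differentiableAt.hasFDerivAt
  have h2 : HasDerivAt (fun s : ℝ => (s, x)) (1, 0) t :=
    (hasDerivAt_id t).prodMk (hasDerivAt_const t x)
  exact h1.comp_hasDerivAt t h2

/-- The product `a(t) b(x)` as a test field. -/
def productTest {d : ℕ} {T : ℝ} (a : ℝ → ℝ) (ha : ContDiff ℝ ∞ a) (hac : HasCompactSupport a)
    (haT : tsupport a ⊆ Iio T) (b : Space d → Space d) (hb : ContDiff ℝ ∞ b)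
    (hbc : HasCompactSupport b) : 𝓓(beforeTime d T, Space d) where
  toFun p := a p.1 • b p.2
  contDiff' := (ha.comp contDiff_fst).smul (hb.comp contDiff_snd)
  hasCompactSupport' := by
    refine HasCompactSupport.intro' (hac.isCompact.prod hbc.isCompact)
      ((isClosed_tsupport a).prod (isClosed_tsupport b)) fun p hp => ?_
    rw [mem_prod, not_and_or] at hp
    rcases hp with hp | hp
    · rw [image_eq_zero_of_notMem_tsupport hp, zero_smul]
    · rw [image_eq_zero_of_notMem_tsupport hp, smul_zero]
  tsupport_subset' := by
    have h1 : tsupport (fun p : ℝ × Space d => a p.1 • b p.2) ⊆ Prod.fst ⁻¹' tsupport a := by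
      refine closure_minimal (fun p hp => ?_) ((isClosed_tsupport a).preimage continuous_fst)
      exact subset_tsupport _ fun h => hp (by simp [h])
    exact fun p hp => haT (h1 hp)

/-! ### Scalar functions of time -/

theorem exists_lt_of_isCompact_subset_Iio {K : Set ℝ} (hK : IsCompact K) {T : ℝ}
    (h : K ⊆ Iio T) : ∃ S < T, K ⊆ Iic S := by
  rcases K.eq_empty_or_nonempty with rfl | hne
  · exact ⟨T - 1, by linarith, empty_subset _⟩
  · obtain ⟨x, hx, hmax⟩ := hK.exists_isGreatest hne
    exact ⟨x, h hx, fun y hy => hmax hy⟩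

theorem setIntegral_Ico_eq_intervalIntegral {f : ℝ → ℂ} {S T : ℝ} (hS : 0 ≤ S) (hST : S < T)
    (h0 : ∀ t, S < t → t < T → f t = 0) : ∫ t in Ico 0 T, f t = ∫ t in 0..S, f t := by
  rw [intervalIntegral.integral_of_le hS, ← integral_Icc_eq_integral_Ioc]
  refine setIntegral_eq_of_subset_of_forall_sdiff_eq_zero measurableSet_Ico
    (fun t ht => ⟨ht.1, ht.2.trans_lt hST⟩) fun t ht => ?_
  refine h0 t ?_ ht.1.2
  by_contra hc
  exact ht.2 ⟨ht.1.1, not_lt.1 hc⟩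

theorem integrableOn_Ico_of_eq_zero {f : ℝ → ℂ} {S T : ℝ} (hST : S < T)
    (hf : ContinuousOn f (Ico 0 T)) (h0 : ∀ t, S < t → t < T → f t = 0) :
    IntegrableOn f (Ico 0 T) := by
  have h1 : IntegrableOn f (Icc 0 S) :=
    (hf.mono fun t ht => ⟨ht.1, ht.2.trans_lt hST⟩).integrableOn_compact isCompact_Icc
  refine h1.of_forall_sdiff_eq_zero measurableSet_Ico fun t ht => ?_
  refine h0 t ?_ ht.1.2
  by_contra hc
  exact ht.2 ⟨ht.1.1, not_lt.1 hc⟩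

/-- The fundamental theorem of calculus on `[0,T)` for functions that vanish near `T`. -/
theorem setIntegral_Ico_deriv {F F' : ℝ → ℂ} {S T : ℝ} (hT : 0 < T) (hST : S < T)
    (hF : ContinuousOn F (Ico 0 T)) (hF' : ContinuousOn F' (Ico 0 T))
    (hd : ∀ t ∈ Ioo 0 T, HasDerivAt F (F' t) t) (h0 : ∀ t, S < t → t < T → F t = 0)
    (h0' : ∀ t, S < t → t < T → F' t = 0) : ∫ t in Ico 0 T, F' t = -F 0 := by
  obtain ⟨R, hR1, hR2⟩ := exists_between (max_lt hST hT)
  have hR : 0 ≤ R := (le_max_right _ _).trans hR1.le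
  have hSR : S < R := (le_max_left _ _).trans_lt hR1
  have hsub : Icc 0 R ⊆ Ico 0 T := fun t ht => ⟨ht.1, ht.2.trans_lt hR2⟩
  rw [setIntegral_Ico_eq_intervalIntegral hR hR2 fun t h1 h2 => h0' t (hSR.trans h1) h2,
    intervalIntegral.integral_eq_sub_of_hasDerivAt_of_le hR (hF.mono hsub)
      (fun t ht => hd t ⟨ht.1, ht.2.trans hR2⟩)
      ((hF'.mono (by rwa [uIcc_of_le hR])).intervalIntegrable), h0 R hSR hR2, zero_sub]

/-- Testing gives zero almost everywhere in the open interval; continuity upgrades this to every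
point and extends it to `t = 0`. -/
theorem eq_zero_of_setIntegral_test {h : ℝ → ℂ} {T : ℝ} (hT : 0 < T)
    (hc : ContinuousOn h (Ico 0 T))
    (H : ∀ a : ℝ → ℝ, ContDiff ℝ ∞ a → HasCompactSupport a → tsupport a ⊆ Ioo 0 T →
      ∫ t in Ico 0 T, (a t : ℂ) * h t = 0) : ∀ t ∈ Ico 0 T, h t = 0 := by
  have hc' : ContinuousOn h (Ioo 0 T) := hc.mono Ioo_subset_Ico_self
  have h1 := isOpen_Ioo.ae_eq_zero_of_integral_contDiff_smul_eq_zero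
    (hc'.locallyIntegrableOn (μ := volume) measurableSet_Ioo) fun a ha hac haT => by
      rw [← H a ha hac haT]
      rw [setIntegral_eq_integral_of_forall_compl_eq_zero]
      · simp
      · intro t ht
        rw [image_eq_zero_of_notMem_tsupport fun hm => ht (Ioo_subset_Ico_self (haT hm))]
        simp
  have h2 : EqOn h (fun _ => 0) (Ioo 0 T) := by
    refine Measure.eqOn_open_of_ae_eq (μ := volume) ?_ isOpen_Ioo hc' continuousOn_const
    rw [Filter.EventuallyEq, ae_restrict_iff' measurableSet_Ioo]
    exact h1
  exact h2.of_subset_closure hc continuousOn_const Ioo_subset_Ico_self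
    (by rw [closure_Ioo hT.ne]; exact Ico_subset_Icc_self)

/-- The primitive based at `S`, beyond the support, vanishes for `t ≥ S`. It may be a nonzero
constant for negative times, where a smooth transition between `-2` and `-1` cuts it off without
touching `t ≥ 0`. -/
theorem exists_test_deriv_eq {T : ℝ} {c : ℝ → ℝ} (hc : ContDiff ℝ ∞ c)
    (hcc : HasCompactSupport c) (hcT : tsupport c ⊆ Ioo 0 T) :
    ∃ a : ℝ → ℝ, ContDiff ℝ ∞ a ∧ HasCompactSupport a ∧ tsupport a ⊆ Iio T ∧
      ∀ t, 0 ≤ t → deriv a t = c t := by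
  obtain ⟨S, hS, hcS⟩ := exists_lt_of_isCompact_subset_Iio hcc.isCompact
    (hcT.trans fun t ht => ht.2)
  set C : ℝ → ℝ := fun t => ∫ s in S..t, c s with hC
  have hd : ∀ t, HasDerivAt C (c t) t := fun t =>
    intervalIntegral.integral_hasDerivAt_right (hc.continuous.intervalIntegrable _ _)
      (hc.continuous.stronglyMeasurableAtFilter _ _) hc.continuous.continuousAt
  have hCs : ContDiff ℝ ∞ C := by
    rw [contDiff_infty_iff_deriv]
    exact ⟨fun t => (hd t).differentiableAt, by rwa [deriv_eq hd]⟩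
  have hC0 : ∀ t, S ≤ t → C t = 0 := fun t ht => by
    rw [hC]
    simp only
    rw [intervalIntegral.integral_of_le ht]
    refine setIntegral_eq_zero_of_forall_eq_zero fun s hs => ?_
    exact image_eq_zero_of_notMem_tsupport fun h => absurd (hcS h) (not_le.2 hs.1)
  refine ⟨fun t => Real.smoothTransition (t + 2) * C t, ?_, ?_, ?_, fun t ht => ?_⟩
  · exact (Real.smoothTransition.contDiff.comp (contDiff_id.add contDiff_const)).mul hCs
  · refine HasCompactSupport.intro (isCompact_Icc (a := -2) (b := S)) fun t ht => ?_
    rw [mem_Icc, not_and_or, not_le, not_le] at ht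
    rcases ht with ht | ht
    · rw [Real.smoothTransition.zero_of_nonpos (by linarith), zero_mul]
    · rw [hC0 t ht.le, mul_zero]
  · refine (closure_minimal (fun t ht => ?_) isClosed_Iic).trans (fun t ht => lt_of_le_of_lt ht hS)
    by_contra h
    exact ht (by simp only; rw [hC0 t (not_le.1 h).le, mul_zero])
  · have : (fun t => Real.smoothTransition (t + 2) * C t) =ᶠ[𝓝 t] C := by
      filter_upwards [lt_mem_nhds (show -1 < t by linarith)] with s hs
      rw [Real.smoothTransition.one_of_one_le (by linarith), one_mul]
    rw [this.deriv_eq, (hd t).deriv]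

theorem intervalIntegrable_of_continuousOn_Ico {m : ℝ → ℂ} {T : ℝ} (hm : ContinuousOn m (Ico 0 T))
    {t : ℝ} (ht : t ∈ Ico 0 T) : IntervalIntegrable m volume 0 t :=
  (hm.mono (by rw [uIcc_of_le ht.1]; exact fun s hs => ⟨hs.1, hs.2.trans_lt ht.2⟩)).intervalIntegrable

theorem hasDerivAt_primitive_Ico {m : ℝ → ℂ} {T : ℝ} (hm : ContinuousOn m (Ico 0 T)) {t : ℝ}
    (ht : t ∈ Ioo 0 T) : HasDerivAt (fun t => ∫ s in 0..t, m s) (m t) t := by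
  have hm' : ContinuousOn m (Ioo 0 T) := hm.mono Ioo_subset_Ico_self
  exact intervalIntegral.integral_hasDerivAt_right
    (intervalIntegrable_of_continuousOn_Ico hm ⟨ht.1.le, ht.2⟩)
    (hm'.stronglyMeasurableAtFilter isOpen_Ioo t ht) (hm'.continuousAt (Ioo_mem_nhds ht.1 ht.2))

theorem continuousOn_primitive_Ico {m : ℝ → ℂ} {T : ℝ} (hm : ContinuousOn m (Ico 0 T)) :
    ContinuousOn (fun t => ∫ s in 0..t, m s) (Ico 0 T) := by
  intro t ht
  obtain ⟨R, hR1, hR2⟩ := exists_between ht.2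
  have hR : 0 ≤ R := ht.1.trans hR1.le
  have h1 : ContinuousOn (fun t => ∫ s in 0..t, m s) (uIcc 0 R) :=
    intervalIntegral.continuousOn_primitive_interval
      ((intervalIntegrable_iff' (by simp)).1 (intervalIntegrable_of_continuousOn_Ico hm ⟨hR, hR2⟩))
  rw [uIcc_of_le hR] at h1
  refine (h1 t ⟨ht.1, hR1.le⟩).mono_of_mem_nhdsWithin ?_
  filter_upwards [self_mem_nhdsWithin, mem_nhdsWithin_of_mem_nhds (Iic_mem_nhds hR1)] with s hs hs'
  exact ⟨hs.1, hs'⟩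

/-- A weak form of the equation `g' = m`, `g(0) = A`. -/
theorem eq_add_primitive_of_test {g m : ℝ → ℂ} {A : ℂ} {T : ℝ} (hT : 0 < T)
    (hg : ContinuousOn g (Ico 0 T)) (hm : ContinuousOn m (Ico 0 T))
    (H : ∀ a : ℝ → ℝ, ContDiff ℝ ∞ a → HasCompactSupport a → tsupport a ⊆ Iio T →
      (a 0 : ℂ) * A + ∫ t in Ico 0 T, (((deriv a t : ℝ) : ℂ) * g t + (a t : ℂ) * m t) = 0) :
    ∀ t ∈ Ico 0 T, g t = A + ∫ s in 0..t, m s := by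
  set M : ℝ → ℂ := fun t => A + ∫ s in 0..t, m s with hM
  have hMc : ContinuousOn M (Ico 0 T) := continuousOn_const.add (continuousOn_primitive_Ico hm)
  suffices h : ∀ t ∈ Ico 0 T, (g - M) t = 0 from fun t ht => sub_eq_zero.1 (h t ht)
  refine eq_zero_of_setIntegral_test hT (hg.sub hMc) fun c hc hcc hcT => ?_
  -- With `a' = c` on `t ≥ 0`, the hypothesis for `g` and the fundamental theorem of calculus for `a
  -- M` have the same terms `a(0) A` and `a m`; their difference is the integral of `c (g - M)`.
  obtain ⟨a, ha, hac, haT, had⟩ := exists_test_deriv_eq hc hcc hcT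
  obtain ⟨S, hS, haS⟩ := exists_lt_of_isCompact_subset_Iio hac.isCompact haT
  have z1 : ∀ t, S < t → a t = 0 := fun t ht =>
    image_eq_zero_of_notMem_tsupport fun h => absurd (haS h) (not_le.2 ht)
  have z2 : ∀ t, S < t → deriv a t = 0 := fun t ht =>
    image_eq_zero_of_notMem_tsupport fun h =>
      absurd (haS (tsupport_deriv_subset h)) (not_le.2 ht)
  have ca : Continuous fun t => (a t : ℂ) := Complex.continuous_ofReal.comp ha.continuous
  have cd : Continuous fun t => ((deriv a t : ℝ) : ℂ) :=
    Complex.continuous_ofReal.comp (ha.continuous_deriv (by simp))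
  have h1 : ∫ t in Ico 0 T, (((deriv a t : ℝ) : ℂ) * M t + (a t : ℂ) * m t) = -(a 0 * M 0) := by
    refine setIntegral_Ico_deriv (F := fun t => (a t : ℂ) * M t) hT hS
      (ca.continuousOn.mul hMc) ((cd.continuousOn.mul hMc).add (ca.continuousOn.mul hm))
      (fun t ht => ?_) (fun t ht _ => ?_) fun t ht _ => ?_
    · have hda : HasDerivAt (fun t => (a t : ℂ)) ((deriv a t : ℝ) : ℂ) t :=
        ((ha.differentiable (by simp)).differentiableAt.hasDerivAt).ofReal_comp
      exact hda.mul ((hasDerivAt_primitive_Ico hm ht).const_add A)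
    · rw [z1 t ht]; simp
    · rw [z1 t ht, z2 t ht]; simp
  have hM0 : M 0 = A := by simp [hM]
  rw [hM0] at h1
  have h2 := H a ha hac haT
  have i1 : IntegrableOn (fun t => ((deriv a t : ℝ) : ℂ) * M t + (a t : ℂ) * m t) (Ico 0 T) :=
    integrableOn_Ico_of_eq_zero hS ((cd.continuousOn.mul hMc).add (ca.continuousOn.mul hm))
      fun t ht _ => by rw [z1 t ht, z2 t ht]; simp
  have i2 : IntegrableOn (fun t => ((deriv a t : ℝ) : ℂ) * g t + (a t : ℂ) * m t) (Ico 0 T) :=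
    integrableOn_Ico_of_eq_zero hS ((cd.continuousOn.mul hg).add (ca.continuousOn.mul hm))
      fun t ht _ => by rw [z1 t ht, z2 t ht]; simp
  have h3 : ∫ t in Ico 0 T, (c t : ℂ) * (g - M) t =
      (∫ t in Ico 0 T, (((deriv a t : ℝ) : ℂ) * g t + (a t : ℂ) * m t)) -
        ∫ t in Ico 0 T, (((deriv a t : ℝ) : ℂ) * M t + (a t : ℂ) * m t) := by
    rw [← integral_sub i2 i1]
    refine setIntegral_congr_fun measurableSet_Ico fun t ht => ?_
    simp only [Pi.sub_apply, had t ht.1]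
    ring
  rw [h3, h1]
  linear_combination h2

/-! ### Velocity, stress and pressure pairings -/

/-- `∫ f · φ`. -/
def velocityPair {d : ℕ} (f : Space d → Space d) (φ : Fin d → 𝓢(Space d, ℂ)) : ℂ :=
  ∑ l, pairing (fun x => f x l) (fun _ => 1) (φ l)

/-- `∫ f ⊗ f : ∇φ`. -/
def stressPair {d : ℕ} (f : Space d → Space d) (φ : Fin d → 𝓢(Space d, ℂ)) : ℂ :=
  ∑ l, ∑ j, pairing (fun x => f x j) (fun x => f x l) (schwartzPderiv j (φ l))

/-- The pressure force of `f` tested against `φ`. -/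
def pressurePair {d : ℕ} (f : Space d → Space d) (φ : Fin d → 𝓢(Space d, ℂ)) : ℂ :=
  ∑ l, ∑ j, ∑ k, pairing (fun x => f x j) (fun x => f x k) (pressureFun l j k (φ l))

theorem velocityPair_congr_ae {d : ℕ} {f g : Space d → Space d} (h : f =ᵐ[volume] g)
    (φ : Fin d → 𝓢(Space d, ℂ)) : velocityPair f φ = velocityPair g φ := by
  refine Finset.sum_congr rfl fun l _ => integral_congr_ae ?_
  filter_upwards [h] with x hx
  rw [hx]

theorem velocityPair_smul {d : ℕ} (f : Space d → Space d) (φ : Fin d → 𝓢(Space d, ℂ)) (c : ℂ) :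
    velocityPair f (c • φ) = c * velocityPair f φ := by
  rw [velocityPair, velocityPair, Finset.mul_sum]
  exact Finset.sum_congr rfl fun l _ =>
    pairing_map_smul (coeMap (ContinuousLinearMap.id ℂ _)) _ _ c (φ l)

theorem stressPair_smul {d : ℕ} (f : Space d → Space d) (φ : Fin d → 𝓢(Space d, ℂ)) (c : ℂ) :
    stressPair f (c • φ) = c * stressPair f φ := by
  simp only [stressPair, Finset.mul_sum]
  exact Finset.sum_congr rfl fun l _ => Finset.sum_congr rfl fun j _ =>
    pairing_map_smul (coeMap (schwartzPderiv j)) _ _ c (φ l)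

theorem integrable_velocity {d : ℕ} {f : Space d → Space d} (hf : MemLp f 2 (weightMeasure d))
    (φ : 𝓢(Space d, ℂ)) (l : Fin d) :
    Integrable (fun x => ((f x l * 1 : ℝ) : ℂ) * φ x) volume :=
  integrable_pairing (memLp_component hf l) memLp_one φ.continuous
    (norm_le_schwartzDecay (d + 1) φ)

theorem integrable_stress {d : ℕ} {f : Space d → Space d} (hf : MemLp f 2 (weightMeasure d))
    (φ : 𝓢(Space d, ℂ)) (j l : Fin d) :
    Integrable (fun x => ((f x j * f x l : ℝ) : ℂ) * φ x) volume :=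
  integrable_pairing (memLp_component hf j) (memLp_component hf l) φ.continuous
    (norm_le_schwartzDecay (d + 1) φ)

theorem velocityPair_eq_integral {d : ℕ} {f : Space d → Space d}
    (hf : MemLp f 2 (weightMeasure d)) (φ : Fin d → 𝓢(Space d, ℂ)) :
    velocityPair f φ = ∫ x, ∑ l, ((f x l * 1 : ℝ) : ℂ) * φ l x := by
  rw [integral_finsetSum _ fun l _ => integrable_velocity hf (φ l) l]
  rfl

theorem stressPair_eq_integral {d : ℕ} {f : Space d → Space d}
    (hf : MemLp f 2 (weightMeasure d)) (φ : Fin d → 𝓢(Space d, ℂ)) :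
    stressPair f φ =
      ∫ x, ∑ l, ∑ j, ((f x j * f x l : ℝ) : ℂ) * schwartzPderiv j (φ l) x := by
  rw [integral_finsetSum _ fun l _ => integrable_finsetSum _ fun j _ =>
    integrable_stress hf (schwartzPderiv j (φ l)) j l]
  refine Finset.sum_congr rfl fun l _ => ?_
  rw [integral_finsetSum _ fun j _ => integrable_stress hf (schwartzPderiv j (φ l)) j l]
  rfl

theorem integral_inner_eq_velocityPair {d : ℕ} {f v : Space d → Space d}
    (hf : MemLp f 2 (weightMeasure d)) {φ : Fin d → 𝓢(Space d, ℂ)}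
    (h : ∀ l x, φ l x = ((v x l : ℝ) : ℂ)) :
    ((∫ x, inner ℝ (f x) (v x) : ℝ) : ℂ) = velocityPair f φ := by
  rw [velocityPair_eq_integral hf, ← integral_complex_ofReal]
  refine integral_congr_ae (Eventually.of_forall fun x => ?_)
  simp only [PiLp.inner_apply, h]
  push_cast
  exact Finset.sum_congr rfl fun l _ => by simp [mul_comm]

theorem fderiv_apply_eq_sum {d : ℕ} {F : Type*} [NormedAddCommGroup F] [NormedSpace ℝ F]
    (A : Space d →L[ℝ] F) (w : Space d) :
    A w = ∑ j, w j • A (EuclideanSpace.single j 1) := by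
  conv_lhs => rw [← (EuclideanSpace.basisFun (Fin d) ℝ).sum_repr w]
  simp [map_sum]

theorem schwartzPderiv_component {d : ℕ} {v : Space d → Space d} (hv : Differentiable ℝ v)
    {φ : 𝓢(Space d, ℂ)} {l : Fin d} (h : ∀ x, φ x = ((v x l : ℝ) : ℂ)) (j : Fin d)
    (x : Space d) :
    schwartzPderiv j φ x = (((fderiv ℝ v x (EuclideanSpace.single j 1)) l : ℝ) : ℂ) := by
  have e : ⇑φ = fun x => Complex.ofRealCLM (EuclideanSpace.proj (𝕜 := ℝ) l (v x)) := by
    ext x; rw [h]; rfl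
  rw [coe_schwartzPderiv, pderivAt, e]
  have h1 : HasFDerivAt (fun x => Complex.ofRealCLM (EuclideanSpace.proj (𝕜 := ℝ) l (v x)))
      (Complex.ofRealCLM.comp ((EuclideanSpace.proj (𝕜 := ℝ) l).comp (fderiv ℝ v x))) x :=
    Complex.ofRealCLM.hasFDerivAt.comp x
      ((EuclideanSpace.proj (𝕜 := ℝ) l).hasFDerivAt.comp x (hv x).hasFDerivAt)
  rw [h1.fderiv]
  rfl

theorem inner_add_inner_eq_sum {d : ℕ} {f v w : Space d → Space d} (hv : Differentiable ℝ v)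
    {φ ψ : Fin d → 𝓢(Space d, ℂ)} (h : ∀ l x, φ l x = ((v x l : ℝ) : ℂ))
    (h' : ∀ l x, ψ l x = ((w x l : ℝ) : ℂ)) (x : Space d) :
    ((inner ℝ (f x) (w x) + inner ℝ (f x) (fderiv ℝ v x (f x)) : ℝ) : ℂ) =
      (∑ l, ((f x l * 1 : ℝ) : ℂ) * ψ l x) +
        ∑ l, ∑ j, ((f x j * f x l : ℝ) : ℂ) * schwartzPderiv j (φ l) x := by
  simp_rw [fun l j => schwartzPderiv_component hv (h l) j x, h']
  rw [fderiv_apply_eq_sum (fderiv ℝ v x) (f x)]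
  simp only [PiLp.inner_apply]
  push_cast
  congr 1
  · exact Finset.sum_congr rfl fun l _ => by simp [mul_comm]
  · refine Finset.sum_congr rfl fun l _ => ?_
    simp only [WithLp.ofLp_sum, Finset.sum_apply, PiLp.smul_apply, smul_eq_mul,
      RCLike.inner_apply, conj_trivial]
    push_cast
    rw [Finset.sum_mul]
    exact Finset.sum_congr rfl fun j _ => by ring

theorem integral_inner_add_inner {d : ℕ} {f v w : Space d → Space d}
    (hf : MemLp f 2 (weightMeasure d)) (hv : Differentiable ℝ v)
    {φ ψ : Fin d → 𝓢(Space d, ℂ)} (h : ∀ l x, φ l x = ((v x l : ℝ) : ℂ))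
    (h' : ∀ l x, ψ l x = ((w x l : ℝ) : ℂ)) :
    ((∫ x, (inner ℝ (f x) (w x) + inner ℝ (f x) (fderiv ℝ v x (f x))) : ℝ) : ℂ) =
      velocityPair f ψ + stressPair f φ := by
  rw [velocityPair_eq_integral hf, stressPair_eq_integral hf, ← integral_complex_ofReal,
    ← integral_add (integrable_finsetSum _ fun l _ => integrable_velocity hf (ψ l) l)
      (integrable_finsetSum _ fun l _ => integrable_finsetSum _ fun j _ =>
        integrable_stress hf (schwartzPderiv j (φ l)) j l)]
  exact integral_congr_ae (Eventually.of_forall fun x => inner_add_inner_eq_sum hv h h' x)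

theorem pressureForce_eq {d : ℕ} {T : ℝ} {u : ℝ → Space d → Space d} {u₀ : Space d → Space d}
    (hu : ∀ t ∈ Ico 0 T, MemLp (u t) 2 (weightMeasure d)) (hu₀ : MemLp u₀ 2 (weightMeasure d))
    (φ : 𝓓(beforeTime d T, Space d)) :
    ((pressureForce T u u₀ φ : ℝ) : ℂ) = velocityPair u₀ (testSlice φ 0) +
      ∫ t in Ico 0 T, (velocityPair (u t) (testSlice (timeDeriv φ) t) +
        stressPair (u t) (testSlice φ t)) := by
  rw [pressureForce, Complex.ofReal_add, integral_inner_eq_velocityPair hu₀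
    (φ := testSlice φ 0) fun l x => rfl, ← integral_complex_ofReal]
  congr 1
  refine setIntegral_congr_fun measurableSet_Ico fun t ht => ?_
  have hv : Differentiable ℝ fun y => φ (t, y) :=
    (φ.contDiff.comp (contDiff_const.prodMk contDiff_id)).differentiable (by simp)
  simp only [(hasDerivAt_time φ t _).deriv]
  exact integral_inner_add_inner (hu t ht) hv (fun l x => rfl) fun l x => rfl

/-! ### Separated test fields -/

/-- The vector field with the given components. -/
def vectorField {d : ℕ} (b : Fin d → 𝓓((⊤ : TopologicalSpace.Opens (Space d)), ℝ))
    (x : Space d) : Space d := WithLp.toLp 2 fun l => b l x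

theorem contDiff_vectorField {d : ℕ} (b : Fin d → 𝓓((⊤ : TopologicalSpace.Opens (Space d)), ℝ)) :
    ContDiff ℝ ∞ (vectorField b) :=
  contDiff_euclidean.2 fun l => (b l).contDiff

theorem hasCompactSupport_vectorField {d : ℕ}
    (b : Fin d → 𝓓((⊤ : TopologicalSpace.Opens (Space d)), ℝ)) :
    HasCompactSupport (vectorField b) := by
  refine HasCompactSupport.intro' (K := ⋃ l, tsupport (b l))
    (isCompact_iUnion fun l => (b l).hasCompactSupport.isCompact)
    (isClosed_iUnion_of_finite fun l => isClosed_tsupport _) fun x hx => ?_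
  ext l
  exact image_eq_zero_of_notMem_tsupport (f := b l) fun h => hx (mem_iUnion.2 ⟨l, h⟩)

/-- The Schwartz functions given by the components of a test field. -/
def schwartzField {d : ℕ} (b : Fin d → 𝓓((⊤ : TopologicalSpace.Opens (Space d)), ℝ)) :
    Fin d → 𝓢(Space d, ℂ) := fun l => schwartzOfTest (b l)

/-- The test field `a(t) b(x)`. -/
def separatedTest {d : ℕ} {T : ℝ} {a : ℝ → ℝ} (ha : ContDiff ℝ ∞ a) (hac : HasCompactSupport a)
    (haT : tsupport a ⊆ Iio T) (b : Fin d → 𝓓((⊤ : TopologicalSpace.Opens (Space d)), ℝ)) :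
    𝓓(beforeTime d T, Space d) :=
  productTest a ha hac haT (vectorField b) (contDiff_vectorField b)
    (hasCompactSupport_vectorField b)

theorem separatedTest_apply {d : ℕ} {T : ℝ} {a : ℝ → ℝ} (ha : ContDiff ℝ ∞ a)
    (hac : HasCompactSupport a) (haT : tsupport a ⊆ Iio T)
    (b : Fin d → 𝓓((⊤ : TopologicalSpace.Opens (Space d)), ℝ)) (t : ℝ) (x : Space d) :
    separatedTest ha hac haT b (t, x) = a t • vectorField b x := rfl

theorem testSlice_separatedTest {d : ℕ} {T : ℝ} {a : ℝ → ℝ} (ha : ContDiff ℝ ∞ a)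
    (hac : HasCompactSupport a) (haT : tsupport a ⊆ Iio T)
    (b : Fin d → 𝓓((⊤ : TopologicalSpace.Opens (Space d)), ℝ)) (t : ℝ) :
    testSlice (separatedTest ha hac haT b) t = (a t : ℂ) • schwartzField b := by
  funext l; ext x
  rw [testSlice_apply, separatedTest_apply]
  simp [schwartzField, vectorField]

theorem testSlice_timeDeriv_separatedTest {d : ℕ} {T : ℝ} {a : ℝ → ℝ} (ha : ContDiff ℝ ∞ a)
    (hac : HasCompactSupport a) (haT : tsupport a ⊆ Iio T)
    (b : Fin d → 𝓓((⊤ : TopologicalSpace.Opens (Space d)), ℝ)) (t : ℝ) :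
    testSlice (timeDeriv (separatedTest ha hac haT b)) t =
      ((deriv a t : ℝ) : ℂ) • schwartzField b := by
  funext l; ext x
  rw [testSlice_apply, ← (hasDerivAt_time (separatedTest ha hac haT b) t x).deriv]
  have h : HasDerivAt (fun s => separatedTest ha hac haT b (s, x)) (deriv a t • vectorField b x) t := by
    simp_rw [separatedTest_apply]
    exact ((ha.differentiable (by simp)).differentiableAt (x := t)).hasDerivAt.smul_const _
  rw [h.deriv]
  simp [schwartzField, vectorField]

/-- For separated fields the weak formulation becomes the scalar problem of
`eq_add_primitive_of_test`. -/
theorem pressureForce_separatedTest {d : ℕ} {T : ℝ} {u : ℝ → Space d → Space d}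
    {u₀ : Space d → Space d} (hu : ∀ t ∈ Ico 0 T, MemLp (u t) 2 (weightMeasure d))
    (hu₀ : MemLp u₀ 2 (weightMeasure d)) {a : ℝ → ℝ} (ha : ContDiff ℝ ∞ a)
    (hac : HasCompactSupport a) (haT : tsupport a ⊆ Iio T)
    (b : Fin d → 𝓓((⊤ : TopologicalSpace.Opens (Space d)), ℝ)) :
    ((pressureForce T u u₀ (separatedTest ha hac haT b) : ℝ) : ℂ) =
      a 0 * velocityPair u₀ (schwartzField b) +
      ∫ t in Ico 0 T, (((deriv a t : ℝ) : ℂ) * velocityPair (u t) (schwartzField b) +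
        a t * stressPair (u t) (schwartzField b)) := by
  rw [pressureForce_eq hu hu₀]
  simp only [testSlice_separatedTest, testSlice_timeDeriv_separatedTest, velocityPair_smul,
    stressPair_smul]

/-! ### Continuity in time -/

theorem ContinuousInWeight.continuousOn_velocityPair {d : ℕ} {T : ℝ}
    {u : ℝ → Space d → Space d} (hu : ContinuousInWeight T u)
    {φ : ℝ → Fin d → 𝓢(Space d, ℂ)} (hφ : ∀ l, Continuous fun t => φ t l) :
    ContinuousOn (fun t => velocityPair (u t) (φ t)) (Ico 0 T) :=
  continuousOn_finsetSum _ fun l _ => (hu.component l).continuousOn_pairing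
    (isWeightBounded_coeMap (ContinuousLinearMap.id ℂ _)) (continuousInWeight_const memLp_one)
    (hφ l).continuousOn

theorem ContinuousInWeight.continuousOn_stressPair {d : ℕ} {T : ℝ}
    {u : ℝ → Space d → Space d} (hu : ContinuousInWeight T u)
    {φ : ℝ → Fin d → 𝓢(Space d, ℂ)} (hφ : ∀ l, Continuous fun t => φ t l) :
    ContinuousOn (fun t => stressPair (u t) (φ t)) (Ico 0 T) :=
  continuousOn_finsetSum _ fun l _ => continuousOn_finsetSum _ fun j _ =>
    (hu.component j).continuousOn_pairing (isWeightBounded_coeMap (schwartzPderiv j))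
      (hu.component l) (hφ l).continuousOn

theorem ContinuousInWeight.continuousOn_pressurePair {d : ℕ} (hd : 2 ≤ d) {χ : Space d → ℝ}
    (hχ : IsCutoff χ) {T : ℝ} {u : ℝ → Space d → Space d} (hu : ContinuousInWeight T u)
    {φ : ℝ → Fin d → 𝓢(Space d, ℂ)} (hφ : ∀ l, Continuous fun t => φ t l) :
    ContinuousOn (fun t => pressurePair (u t) (φ t)) (Ico 0 T) :=
  continuousOn_finsetSum _ fun l _ => continuousOn_finsetSum _ fun j _ =>
    continuousOn_finsetSum _ fun k _ => (hu.component j).continuousOn_pairing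
      (isWeightBounded_pressureMap hd hχ l j k) (hu.component k) (hφ l).continuousOn

/-! ### Gradients and divergence-free fields as test fields -/

/-- The partial derivative of a test function. -/
def testPderiv {d : ℕ} (j : Fin d) (q : 𝓓((⊤ : TopologicalSpace.Opens (Space d)), ℝ)) :
    𝓓((⊤ : TopologicalSpace.Opens (Space d)), ℝ) where
  toFun x := fderiv ℝ q x (EuclideanSpace.single j 1)
  contDiff' := (q.contDiff.fderiv_right (m := ∞) (by simp)).clm_apply contDiff_const
  hasCompactSupport' := (q.hasCompactSupport.fderiv ℝ).comp_left
    (g := fun A : Space d →L[ℝ] ℝ => A (EuclideanSpace.single j 1)) rfl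
  tsupport_subset' := by simp

theorem schwartzPderiv_schwartzOfTest_apply {d : ℕ} (j : Fin d)
    (q : 𝓓((⊤ : TopologicalSpace.Opens (Space d)), ℝ)) (x : Space d) :
    schwartzPderiv j (schwartzOfTest q) x =
      ((fderiv ℝ q x (EuclideanSpace.single j 1) : ℝ) : ℂ) := by
  rw [coe_schwartzPderiv, pderivAt]
  have h : HasFDerivAt (fun x => Complex.ofRealCLM (q x)) (Complex.ofRealCLM.comp (fderiv ℝ q x)) x :=
    Complex.ofRealCLM.hasFDerivAt.comp x
      ((q.contDiff.differentiable (by simp)) x).hasFDerivAt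
  have e : ⇑(schwartzOfTest q) = fun x => Complex.ofRealCLM (q x) := rfl
  rw [e, h.fderiv]
  rfl

theorem schwartzOfTest_testPderiv {d : ℕ} (j : Fin d)
    (q : 𝓓((⊤ : TopologicalSpace.Opens (Space d)), ℝ)) :
    schwartzOfTest (testPderiv j q) = schwartzPderiv j (schwartzOfTest q) := by
  ext x
  rw [schwartzPderiv_schwartzOfTest_apply]
  rfl

theorem schwartzPderiv_comm {d : ℕ} (j k : Fin d) (φ : 𝓢(Space d, ℂ)) :
    schwartzPderiv j (schwartzPderiv k φ) = schwartzPderiv k (schwartzPderiv j φ) := by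
  have h : (𝓕⁻ (schwartzPderiv j (schwartzPderiv k φ)) : 𝓢(Space d, ℂ)) =
      𝓕⁻ (schwartzPderiv k (schwartzPderiv j φ)) := by
    ext ξ
    simp only [fourierInv_schwartzPderiv]
    ring
  ext y
  rw [schwartz_eq_fourier, h, ← schwartz_eq_fourier]

/-- The gradient of a test function. -/
def gradField {d : ℕ} (q : 𝓓((⊤ : TopologicalSpace.Opens (Space d)), ℝ)) :
    Fin d → 𝓓((⊤ : TopologicalSpace.Opens (Space d)), ℝ) := fun l => testPderiv l q

theorem schwartzField_gradField {d : ℕ} (q : 𝓓((⊤ : TopologicalSpace.Opens (Space d)), ℝ)) :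
    schwartzField (gradField q) = fun l => schwartzPderiv l (schwartzOfTest q) :=
  funext fun l => schwartzOfTest_testPderiv l q

theorem velocityPair_gradField {d : ℕ} {f : Space d → Space d}
    (hf : MemLp f 2 (weightMeasure d)) (q : 𝓓((⊤ : TopologicalSpace.Opens (Space d)), ℝ)) :
    velocityPair f (schwartzField (gradField q)) = ((∫ x, fderiv ℝ q x (f x) : ℝ) : ℂ) := by
  rw [velocityPair_eq_integral hf, ← integral_complex_ofReal]
  refine integral_congr_ae (Eventually.of_forall fun x => ?_)
  simp only
  rw [fderiv_apply_eq_sum (fderiv ℝ q x) (f x), Complex.ofReal_sum]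
  refine Finset.sum_congr rfl fun l _ => ?_
  rw [schwartzField_gradField, schwartzPderiv_schwartzOfTest_apply, smul_eq_mul]
  push_cast; ring

/-- The function `a(t) q(x)` as a test function on the slab. -/
def slabTest {d : ℕ} {T : ℝ} {a : ℝ → ℝ} (ha : ContDiff ℝ ∞ a) (hac : HasCompactSupport a)
    (haT : tsupport a ⊆ Ioo 0 T) (q : 𝓓((⊤ : TopologicalSpace.Opens (Space d)), ℝ)) :
    𝓓(openSlab d T, ℝ) where
  toFun p := a p.1 * q p.2
  contDiff' := (ha.comp contDiff_fst).mul (q.contDiff.comp contDiff_snd)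
  hasCompactSupport' := by
    refine HasCompactSupport.intro' (hac.isCompact.prod q.hasCompactSupport.isCompact)
      ((isClosed_tsupport a).prod (isClosed_tsupport q)) fun p hp => ?_
    rw [mem_prod, not_and_or] at hp
    rcases hp with hp | hp
    · rw [image_eq_zero_of_notMem_tsupport hp, zero_mul]
    · rw [image_eq_zero_of_notMem_tsupport hp, mul_zero]
  tsupport_subset' := by
    have h1 : tsupport (fun p : ℝ × Space d => a p.1 * q p.2) ⊆ Prod.fst ⁻¹' tsupport a := by
      refine closure_minimal (fun p hp => ?_) ((isClosed_tsupport a).preimage continuous_fst)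
      exact subset_tsupport _ fun h => hp (by simp [h])
    exact fun p hp => haT (h1 hp)

/-- Continuity in time turns the space-time constraint into one at each single time, including `t =
0`, which test functions on the open slab do not see. -/
theorem WeaklyDivFreeInTime.velocityPair_eq_zero {d : ℕ} {T : ℝ} (hT : 0 < T)
    {u : ℝ → Space d → Space d} (hu : ContinuousInWeight T u) (h : WeaklyDivFreeInTime T u)
    (q : 𝓓((⊤ : TopologicalSpace.Opens (Space d)), ℝ)) :
    ∀ t ∈ Ico 0 T, velocityPair (u t) (schwartzField (gradField q)) = 0 := by
  refine eq_zero_of_setIntegral_test hT (hu.continuousOn_velocityPair fun l => continuous_const)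
    fun a ha hac haT => ?_
  have h1 := h (slabTest ha hac haT q)
  have h2 : ∀ t x, fderiv ℝ (fun y => slabTest ha hac haT q (t, y)) x (u t x) =
      a t * fderiv ℝ q x (u t x) := by
    intro t x
    have e : (fun y => slabTest ha hac haT q (t, y)) = fun y => a t * q y := rfl
    rw [e, fderiv_const_mul ((q.contDiff.differentiable (by simp)) x)]
    rfl
  simp_rw [h2, integral_const_mul] at h1
  have h3 := congrArg Complex.ofReal h1
  rw [← integral_complex_ofReal, Complex.ofReal_zero] at h3
  rw [← h3]
  refine setIntegral_congr_fun measurableSet_Ico fun t ht => ?_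
  rw [velocityPair_gradField (hu.1 t ht), Complex.ofReal_mul]

theorem WeaklyDivFree.velocityPair_eq_zero {d : ℕ} {f : Space d → Space d}
    (hf : MemLp f 2 (weightMeasure d)) (h : WeaklyDivFree f)
    (q : 𝓓((⊤ : TopologicalSpace.Opens (Space d)), ℝ)) :
    velocityPair f (schwartzField (gradField q)) = 0 := by
  rw [velocityPair_gradField hf, h q, Complex.ofReal_zero]

/-- The momentum equation against a divergence-free field, integrated in time. -/
theorem IsWeakEulerSolution.velocityPair_eq {d : ℕ} {T : ℝ} (hT : 0 < T)
    {u : ℝ → Space d → Space d} {u₀ : Space d → Space d} (hsol : IsWeakEulerSolution T u u₀)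
    (hu : ContinuousInWeight T u) (hu₀ : MemLp u₀ 2 (weightMeasure d))
    {b : Fin d → 𝓓((⊤ : TopologicalSpace.Opens (Space d)), ℝ)}
    (hb : ∑ l, schwartzPderiv l (schwartzField b l) = 0) :
    ∀ t ∈ Ico 0 T, velocityPair (u t) (schwartzField b) = velocityPair u₀ (schwartzField b) +
      ∫ s in 0..t, stressPair (u s) (schwartzField b) := by
  refine eq_add_primitive_of_test hT (hu.continuousOn_velocityPair fun l => continuous_const)
    (hu.continuousOn_stressPair fun l => continuous_const) fun a ha hac haT => ?_
  rw [← pressureForce_separatedTest hu.1 hu₀ ha hac haT b, hsol.momentum _ fun t _ x => ?_,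
    Complex.ofReal_zero]
  have h1 : ∀ j, pderivAt j (fun y => separatedTest ha hac haT b (t, y) j) x =
      a t * fderiv ℝ (b j) x (EuclideanSpace.single j 1) := by
    intro j
    have e : (fun y => separatedTest ha hac haT b (t, y) j) = fun y => a t * b j y := rfl
    rw [pderivAt, e, fderiv_const_mul (((b j).contDiff.differentiable (by simp)) x)]
    rfl
  simp_rw [h1]
  rw [← Finset.mul_sum]
  have h2 := congrArg (fun f : 𝓢(Space d, ℂ) => f x) hb
  simp only [sum_apply, schwartzField, schwartzPderiv_schwartzOfTest_apply, zero_apply] at h2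
  have h3 : ∑ j, fderiv ℝ (b j) x (EuclideanSpace.single j 1) = 0 := by exact_mod_cast h2
  rw [h3, mul_zero]

/-- The equation with pressure force `F`, integrated in time. -/
theorem PressureForceEq.velocityPair_eq {d : ℕ} {T : ℝ} (hT : 0 < T)
    {u : ℝ → Space d → Space d} {u₀ : Space d → Space d} (hu : ContinuousInWeight T u)
    (hu₀ : MemLp u₀ 2 (weightMeasure d)) {F : ℝ → Fin d → 𝓢'(Space d, ℂ)}
    (hF : PressureForceEq T u u₀ F) (b : Fin d → 𝓓((⊤ : TopologicalSpace.Opens (Space d)), ℝ))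
    (hFc : ContinuousOn (fun s => ∑ l, F s l (schwartzField b l)) (Ico 0 T)) :
    ∀ t ∈ Ico 0 T, velocityPair (u t) (schwartzField b) = velocityPair u₀ (schwartzField b) +
      ∫ s in 0..t, (stressPair (u s) (schwartzField b) - ∑ l, F s l (schwartzField b l)) := by
  have hV := hu.continuousOn_velocityPair (φ := fun _ => schwartzField b) fun l => continuous_const
  have hS := hu.continuousOn_stressPair (φ := fun _ => schwartzField b) fun l => continuous_const
  refine eq_add_primitive_of_test hT hV (hS.sub hFc) fun a ha hac haT => ?_
  have h1 := hF (separatedTest ha hac haT b)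
  rw [pressureForce_separatedTest hu.1 hu₀ ha hac haT b] at h1
  obtain ⟨S, hS', haS⟩ := exists_lt_of_isCompact_subset_Iio hac.isCompact haT
  have z1 : ∀ t, S < t → a t = 0 := fun t ht =>
    image_eq_zero_of_notMem_tsupport fun h => absurd (haS h) (not_le.2 ht)
  have z2 : ∀ t, S < t → deriv a t = 0 := fun t ht =>
    image_eq_zero_of_notMem_tsupport fun h =>
      absurd (haS (tsupport_deriv_subset h)) (not_le.2 ht)
  have ca : Continuous fun t => (a t : ℂ) := Complex.continuous_ofReal.comp ha.continuous
  have cd : Continuous fun t => ((deriv a t : ℝ) : ℂ) :=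
    Complex.continuous_ofReal.comp (ha.continuous_deriv (by simp))
  have i1 : IntegrableOn (fun t => ((deriv a t : ℝ) : ℂ) * velocityPair (u t) (schwartzField b) +
      (a t : ℂ) * stressPair (u t) (schwartzField b)) (Ico 0 T) :=
    integrableOn_Ico_of_eq_zero hS' ((cd.continuousOn.mul hV).add (ca.continuousOn.mul hS))
      fun t ht _ => by rw [z1 t ht, z2 t ht]; simp
  have i2 : IntegrableOn (fun t => (a t : ℂ) * ∑ l, F t l (schwartzField b l)) (Ico 0 T) :=
    integrableOn_Ico_of_eq_zero hS' (ca.continuousOn.mul hFc)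
      fun t ht _ => by rw [z1 t ht]; simp
  have h2 : ∫ t in Ico 0 T, ∑ l, F t l (testSlice (separatedTest ha hac haT b) t l) =
      ∫ t in Ico 0 T, (a t : ℂ) * ∑ l, F t l (schwartzField b l) := by
    refine integral_congr_ae (Eventually.of_forall fun t => ?_)
    simp only [testSlice_separatedTest, Pi.smul_apply, map_smul, smul_eq_mul, Finset.mul_sum]
  rw [h2] at h1
  have h3 := integral_sub i1 i2
  rw [← sub_eq_zero, add_sub_assoc, ← h3] at h1
  rw [← h1]
  congr 2
  ext t
  ring

theorem eq_zero_of_primitive_eq_zero {m : ℝ → ℂ} {T : ℝ} (hT : 0 < T)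
    (hm : ContinuousOn m (Ico 0 T)) (h : ∀ t ∈ Ico 0 T, ∫ s in 0..t, m s = 0) :
    ∀ t ∈ Ico 0 T, m t = 0 := by
  have h2 : EqOn m (fun _ => 0) (Ioo 0 T) := fun t ht => by
    refine (hasDerivAt_primitive_Ico hm ht).unique ((hasDerivAt_const t (0 : ℂ)).congr_of_eventuallyEq ?_)
    filter_upwards [Ioo_mem_nhds ht.1 ht.2] with s hs using h s ⟨hs.1.le, hs.2⟩
  exact h2.of_subset_closure hm continuousOn_const Ioo_subset_Ico_self
    (by rw [closure_Ioo hT.ne]; exact Ico_subset_Icc_self)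

/-- The divergence-free field `Δq e_m - ∇∂_m q`. -/
def solenoidalField {d : ℕ} (m : Fin d) (q : 𝓓((⊤ : TopologicalSpace.Opens (Space d)), ℝ)) :
    Fin d → 𝓓((⊤ : TopologicalSpace.Opens (Space d)), ℝ) := fun l =>
  (if l = m then ∑ j, testPderiv j (testPderiv j q) else 0) - testPderiv l (testPderiv m q)

theorem schwartzOfTest_sub {d : ℕ} (p q : 𝓓((⊤ : TopologicalSpace.Opens (Space d)), ℝ)) :
    schwartzOfTest (p - q) = schwartzOfTest p - schwartzOfTest q := by
  ext x; simp

theorem schwartzField_solenoidalField {d : ℕ} (m l : Fin d)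
    (q : 𝓓((⊤ : TopologicalSpace.Opens (Space d)), ℝ)) :
    schwartzField (solenoidalField m q) l =
      (if l = m then schwartzLaplacian (schwartzOfTest q) else 0) -
        schwartzPderiv l (schwartzPderiv m (schwartzOfTest q)) := by
  rw [schwartzField, solenoidalField, schwartzOfTest_sub, schwartzOfTest_testPderiv,
    schwartzOfTest_testPderiv, schwartzLaplacian_apply]
  congr 1
  split_ifs with h
  · ext x
    rw [schwartzOfTest_apply, sum_apply, sum_apply, Complex.ofReal_sum]
    refine Finset.sum_congr rfl fun j _ => ?_
    rw [← schwartzOfTest_testPderiv, ← schwartzOfTest_testPderiv, schwartzOfTest_apply]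
  · ext x; simp

theorem sum_schwartzPderiv_solenoidalField {d : ℕ} (m : Fin d)
    (q : 𝓓((⊤ : TopologicalSpace.Opens (Space d)), ℝ)) :
    ∑ l, schwartzPderiv l (schwartzField (solenoidalField m q) l) = 0 := by
  have h1 : ∀ l, schwartzPderiv l (schwartzField (solenoidalField m q) l) =
      (if l = m then schwartzPderiv m (schwartzLaplacian (schwartzOfTest q)) else 0) -
        schwartzPderiv m (schwartzPderiv l (schwartzPderiv l (schwartzOfTest q))) := by
    intro l
    rw [schwartzField_solenoidalField, map_sub, schwartzPderiv_comm l m (schwartzOfTest q),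
      schwartzPderiv_comm l m]
    split_ifs with h
    · rw [h]
    · rw [map_zero]
  simp_rw [h1]
  rw [Finset.sum_sub_distrib, Finset.sum_ite_eq' Finset.univ m, if_pos (Finset.mem_univ m),
    schwartzLaplacian_apply, map_sum, sub_self]

/-- A field in `S'_h` that annihilates divergence-free fields and gradients is zero. -/
theorem eq_zero_of_annihilates {d : ℕ} {χ : Space d → ℝ} (hχ : IsCutoff χ)
    {H : Fin d → 𝓢'(Space d, ℂ)}
    (hdiv : ∀ b, ∑ l, schwartzPderiv l (schwartzField b l) = 0 → ∑ l, H l (schwartzField b l) = 0)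
    (hgrad : ∀ q, ∑ l, H l (schwartzField (gradField q) l) = 0) (hH : ∀ l, MemSh χ (H l))
    (m : Fin d) : H m = 0 := by
  refine eq_zero_of_harmonic_of_memSh hχ (fun φ => ?_) (hH m)
  have hcont : Continuous (H m) := ContinuousLinearMap.continuous (H m)
  refine map_eq_zero_of_test hχ
    (f := (H m : 𝓢(Space d, ℂ) →ₗ[ℂ] ℂ) ∘ₗ (schwartzLaplacian : 𝓢(Space d, ℂ) →L[ℂ] _).toLinearMap)
    (hcont.comp schwartzLaplacian.continuous) (fun q => ?_) φ
  -- The field `Δq e_m - ∇∂_m q` and the gradient of `∂_m q` are both annihilated, so `H m`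
  -- annihilates `Δq`.
  have h1 := hdiv _ (sum_schwartzPderiv_solenoidalField m q)
  have h2 := hgrad (testPderiv m q)
  simp only [schwartzField_gradField, schwartzOfTest_testPderiv] at h2
  have h3 : ∀ l, H l (schwartzField (solenoidalField m q) l) =
      (if l = m then H m (schwartzLaplacian (schwartzOfTest q)) else 0) -
        H l (schwartzPderiv l (schwartzPderiv m (schwartzOfTest q))) := by
    intro l
    rw [schwartzField_solenoidalField, map_sub]
    split_ifs with h
    · rw [h]
    · rw [map_zero]
  simp_rw [h3] at h1
  rw [Finset.sum_sub_distrib, h2, sub_zero, Finset.sum_ite_eq' Finset.univ m,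
    if_pos (Finset.mem_univ m)] at h1
  exact h1

/-! ### Identities for the pressure pairing -/

theorem pressurePair_eq_sum {d : ℕ} (hd : 2 ≤ d) {χ : Space d → ℝ} (hχ : IsCutoff χ)
    {f : Space d → Space d} (hf : MemLp f 2 (weightMeasure d)) (φ : Fin d → 𝓢(Space d, ℂ)) :
    pressurePair f φ = ∑ j, ∑ k, pairing (fun x => f x j) (fun x => f x k)
      fun y => ∑ l, pressureFun l j k (φ l) y := by
  rw [pressurePair, Finset.sum_comm]
  refine Finset.sum_congr rfl fun j _ => ?_
  rw [Finset.sum_comm]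
  refine Finset.sum_congr rfl fun k _ => ?_
  exact pairing_map_sum (L := fun l => pressureMap l j k)
    (fun l => isWeightBounded_pressureMap hd hχ l j k) (memLp_component hf j)
    (memLp_component hf k) Finset.univ φ

theorem pressurePair_of_divFree {d : ℕ} (hd : 2 ≤ d) {χ : Space d → ℝ} (hχ : IsCutoff χ)
    {f : Space d → Space d} (hf : MemLp f 2 (weightMeasure d)) {φ : Fin d → 𝓢(Space d, ℂ)}
    (h : ∑ l, schwartzPderiv l (φ l) = 0) : pressurePair f φ = 0 := by
  rw [pressurePair_eq_sum hd hχ hf]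
  simp [sum_pressureFun_of_divFree _ _ φ h, pairing]

theorem pressurePair_gradient {d : ℕ} (hd : 2 ≤ d) {χ : Space d → ℝ} (hχ : IsCutoff χ)
    {f : Space d → Space d} (hf : MemLp f 2 (weightMeasure d)) (q : 𝓢(Space d, ℂ)) :
    pressurePair f (fun l => schwartzPderiv l q) = stressPair f fun l => schwartzPderiv l q := by
  rw [pressurePair_eq_sum hd hχ hf, stressPair, Finset.sum_comm]
  simp only [sum_pressureFun_pderiv hd]

theorem sum_pressureOp {d : ℕ} (hd : 2 ≤ d) {χ θ : Space d → ℝ} (hχ : IsCutoff χ)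
    (hθ : IsCutoff θ) {f : Space d → Space d} (hf : MemLp f 2 (weightMeasure d))
    (φ : Fin d → 𝓢(Space d, ℂ)) : ∑ l, pressureOp χ θ f f l (φ l) = pressurePair f φ :=
  Finset.sum_congr rfl fun l _ =>
    pressureOp_apply hd hχ hθ (memLp_component hf) (memLp_component hf) l (φ l)

/-! ### The right-hand side of the Euler equations as a functional -/

/-- The transpose of `∇(-Δ)⁻¹∇² : - div`, so that pairing with `u ⊗ u` gives `-∂ₜ u`. -/
def eulerMap {d : ℕ} (l j k : Fin d) : 𝓢(Space d, ℂ) →ₗ[ℂ] (Space d → ℂ) :=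
  pressureMap l j k - if k = l then coeMap (schwartzPderiv j) else 0

theorem isWeightBounded_ite {d : ℕ} (p : Prop) [Decidable p] (j : Fin d) :
    IsWeightBounded (if p then coeMap (schwartzPderiv j) else 0) := by
  split_ifs
  · exact isWeightBounded_coeMap _
  · exact IsWeightBounded.zero

theorem isWeightBounded_eulerMap {d : ℕ} (hd : 2 ≤ d) {χ : Space d → ℝ} (hχ : IsCutoff χ)
    (l j k : Fin d) : IsWeightBounded (eulerMap l j k) :=
  (isWeightBounded_pressureMap hd hχ l j k).sub (isWeightBounded_ite _ j)

/-- The `l`-th component of the weak form of `-∂ₜ u`. -/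
def eulerPair {d : ℕ} (f : Space d → Space d) (l : Fin d) (φ : 𝓢(Space d, ℂ)) : ℂ :=
  ∑ j, ∑ k, pairing (fun x => f x j) (fun x => f x k) (eulerMap l j k φ)

theorem eulerPair_zero {d : ℕ} (f : Space d → Space d) (l : Fin d) :
    eulerPair f l 0 = 0 := by
  simp [eulerPair, pairing]

theorem eulerPair_eq {d : ℕ} (hd : 2 ≤ d) {χ : Space d → ℝ} (hχ : IsCutoff χ)
    {f : Space d → Space d} (hf : MemLp f 2 (weightMeasure d)) (l : Fin d) (φ : 𝓢(Space d, ℂ)) :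
    eulerPair f l φ =
      (∑ j, ∑ k, pairing (fun x => f x j) (fun x => f x k) (pressureFun l j k φ)) -
        ∑ j, pairing (fun x => f x j) (fun x => f x l) (schwartzPderiv j φ) := by
  rw [eulerPair, ← Finset.sum_sub_distrib]
  refine Finset.sum_congr rfl fun j _ => ?_
  have h1 : ∀ k, pairing (fun x => f x j) (fun x => f x k) (eulerMap l j k φ) =
      pairing (fun x => f x j) (fun x => f x k) (pressureFun l j k φ) -
        if k = l then pairing (fun x => f x j) (fun x => f x l) (schwartzPderiv j φ) else 0 := by
    intro k
    have hp := isWeightBounded_pressureMap hd hχ l j k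
    have hi := isWeightBounded_ite (k = l) j
    obtain ⟨q, -, -, hq⟩ := hp.bound
    obtain ⟨r, -, -, hr⟩ := hi.bound
    rw [eulerMap, LinearMap.sub_apply, pairing_sub_right (memLp_component hf j)
      (memLp_component hf k) (hp.continuous φ) (hi.continuous φ) (hq φ) (hr φ)]
    congr 1
    split_ifs with h
    · rw [h]; rfl
    · simp [pairing]
  simp_rw [h1]
  rw [Finset.sum_sub_distrib, Finset.sum_ite_eq' Finset.univ l, if_pos (Finset.mem_univ l)]

theorem sum_eulerPair {d : ℕ} (hd : 2 ≤ d) {χ : Space d → ℝ} (hχ : IsCutoff χ)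
    {f : Space d → Space d} (hf : MemLp f 2 (weightMeasure d)) (φ : Fin d → 𝓢(Space d, ℂ)) :
    ∑ l, eulerPair f l (φ l) = pressurePair f φ - stressPair f φ := by
  simp_rw [eulerPair_eq hd hχ hf, Finset.sum_sub_distrib]
  rfl

/-! ### Low frequencies of the right-hand side -/

/-- The derivative in `eulerMap` is a sum of `d` pressure functions by `sum_pressureFun_trace`; this
accounts for the constant `1 + d`. -/
theorem exists_eulerMap_lowFreq_bound {d : ℕ} (hd : 2 ≤ d) {χ : Space d → ℝ}
    (hχ : IsCutoff χ) (φ : 𝓢(Space d, ℂ)) : ∃ C : ℝ, 0 ≤ C ∧ ∀ l j k, ∀ lam : ℝ, 1 ≤ lam → ∀ y,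
      ‖eulerMap l j k (lowFreqTest χ lam φ) y‖ ≤ C * decayWeight (d + 1) y ∧
      ‖eulerMap l j k (lowFreqTest χ lam φ) y‖ ≤ C / lam := by
  obtain ⟨C, hC, h⟩ := exists_pressureFun_lowFreq_bound hd hχ φ
  have key : ∀ l j k lam y (B : ℝ), 0 ≤ B →
      (∀ l j k, ‖pressureFun l j k (lowFreqTest χ lam φ) y‖ ≤ B) →
      ‖eulerMap l j k (lowFreqTest χ lam φ) y‖ ≤ (1 + d) * B := by
    intro l j k lam y B hB hb
    have h1 : ‖(if k = l then coeMap (schwartzPderiv j) else 0 :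
        𝓢(Space d, ℂ) →ₗ[ℂ] (Space d → ℂ)) (lowFreqTest χ lam φ) y‖ ≤ d * B := by
      split_ifs
      · have e : coeMap (schwartzPderiv j) (lowFreqTest χ lam φ) y =
            ∑ m, pressureFun m m j (lowFreqTest χ lam φ) y :=
          (sum_pressureFun_trace hd j _ y).symm
        rw [e]
        refine (norm_sum_le_of_le _ fun m _ => hb m m j).trans ?_
        simp
      · simp only [LinearMap.zero_apply, Pi.zero_apply, norm_zero]
        positivity
    rw [eulerMap, LinearMap.sub_apply, Pi.sub_apply, add_mul, one_mul]
    exact (norm_sub_le _ _).trans (add_le_add (hb l j k) h1)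
  refine ⟨(1 + d) * C, by positivity, fun l j k lam hl y => ⟨?_, ?_⟩⟩
  · rw [mul_assoc]
    exact key l j k lam y _ (mul_nonneg hC (decayWeight_nonneg _ _)) fun l j k => (h l j k lam hl y).1
  · rw [mul_div_assoc]
    exact key l j k lam y _ (by positivity) fun l j k => (h l j k lam hl y).2

theorem tendsto_pairing_zero {d : ℕ} {f g : Space d → ℝ} (hf : MemLp f 2 (weightMeasure d))
    (hg : MemLp g 2 (weightMeasure d)) {a : ℝ → Space d → ℂ} {C : ℝ}
    (hac : ∀ lam, Continuous (a lam))
    (ha : ∀ lam, 1 ≤ lam → ∀ y, ‖a lam y‖ ≤ C * decayWeight (d + 1) y)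
    (ha' : ∀ lam, 1 ≤ lam → ∀ y, ‖a lam y‖ ≤ C / lam) :
    Tendsto (fun lam => pairing f g (a lam)) atTop (𝓝 0) := by
  have h0 : (0 : ℂ) = ∫ _ : Space d, (0 : ℂ) := by simp
  rw [h0]
  refine tendsto_integral_filter_of_dominated_convergence
    (fun y => C * (decayWeight (d + 1) y * ‖f y * g y‖)) ?_ ?_ ?_ ?_
  · filter_upwards [eventually_ge_atTop 1] with lam hl
    exact (integrable_pairing hf hg (hac lam) (ha lam hl)).1
  · filter_upwards [eventually_ge_atTop 1] with lam hl
    exact Eventually.of_forall fun y => norm_pairing_integrand_le (ha lam hl) y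
  · refine ((integrable_weight_mul hf hg).norm.const_mul C).congr (Eventually.of_forall fun y => ?_)
    simp only
    rw [norm_mul (decayWeight _ _), Real.norm_of_nonneg (decayWeight_nonneg _ _)]
  · refine Eventually.of_forall fun y => ?_
    have h1 : Tendsto (fun lam => a lam y) atTop (𝓝 0) := by
      refine squeeze_zero_norm' ?_ (tendsto_const_nhds.div_atTop tendsto_id : Tendsto
        (fun lam : ℝ => C / lam) atTop (𝓝 0))
      filter_upwards [eventually_ge_atTop 1] with lam hl using ha' lam hl y
    simpa using h1.const_mul (((f y * g y : ℝ) : ℂ))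

/-- After `pressureOp_apply` the cut-offs `χ'` and `θ` are gone, so only the cut-off `χ` that
defines `S'_h` matters. -/
theorem memSh_pressureOp {d : ℕ} (hd : 2 ≤ d) {χ χ' θ : Space d → ℝ} (hχ : IsCutoff χ)
    (hχ' : IsCutoff χ') (hθ : IsCutoff θ) {f : Space d → Space d}
    (hf : MemLp f 2 (weightMeasure d)) (l : Fin d) : MemSh χ (pressureOp χ' θ f f l) := by
  refine memSh_iff.2 fun φ => ?_
  obtain ⟨C, -, h⟩ := exists_pressureFun_lowFreq_bound hd hχ φ
  simp_rw [pressureOp_apply hd hχ' hθ (memLp_component hf) (memLp_component hf)]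
  rw [show (0 : ℂ) = ∑ _j : Fin d, ∑ _k : Fin d, (0 : ℂ) by simp]
  exact tendsto_finsetSum _ fun j _ => tendsto_finsetSum _ fun k _ =>
    tendsto_pairing_zero (memLp_component hf j) (memLp_component hf k)
      (fun lam => continuous_pressureFun l j k _) (fun lam hl y => (h l j k lam hl y).1)
      fun lam hl y => (h l j k lam hl y).2

theorem continuousOn_pressureOp {d : ℕ} (hd : 2 ≤ d) {χ θ : Space d → ℝ} (hχ : IsCutoff χ)
    (hθ : IsCutoff θ) {T : ℝ} {u : ℝ → Space d → Space d} (hu : ContinuousInWeight T u) :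
    ContinuousOn (fun t => pressureOp χ θ (u t) (u t)) (Ico 0 T) := by
  refine continuousOn_pi.2 fun l t ht => ?_
  rw [ContinuousWithinAt, PointwiseConvergenceCLM.tendsto_iff_forall_tendsto]
  intro φ
  have h : ContinuousOn (fun t => ∑ j, ∑ k, pairing (fun x => u t x j) (fun x => u t x k)
      (pressureMap l j k φ)) (Ico 0 T) :=
    continuousOn_finsetSum _ fun j _ => continuousOn_finsetSum _ fun k _ =>
      (hu.component j).continuousOn_pairing (isWeightBounded_pressureMap hd hχ l j k)
        (hu.component k) continuousOn_const
  have h1 := h.congr fun s hs => pressureOp_apply hd hχ hθ (memLp_component (hu.1 s hs))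
    (memLp_component (hu.1 s hs)) l φ
  exact h1 t ht

/-! ### Time integrals of the right-hand side -/

theorem ContinuousInWeight.continuousOn_map {d : ℕ} {T : ℝ}
    {L : 𝓢(Space d, ℂ) →ₗ[ℂ] (Space d → ℂ)} (hL : IsWeightBounded L) {f g : ℝ → Space d → ℝ}
    (hf : ContinuousInWeight T f) (hg : ContinuousInWeight T g) (φ : 𝓢(Space d, ℂ)) :
    ContinuousOn (fun t => pairing (f t) (g t) (L φ)) (Ico 0 T) :=
  hf.continuousOn_pairing hL hg (φ := fun _ => φ) continuousOn_const

/-- The residual of the integrated equation has to be a tempered distribution for the uniqueness and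
density arguments. By linearity continuity at 0 is enough, and there the bound `q φ` tends to `q 0 =
0`. -/
theorem exists_integral_pairing_clm {d : ℕ} {T : ℝ} {L : 𝓢(Space d, ℂ) →ₗ[ℂ] (Space d → ℂ)}
    (hL : IsWeightBounded L) {f g : ℝ → Space d → ℝ} (hf : ContinuousInWeight T f)
    (hg : ContinuousInWeight T g) {t : ℝ} (ht : t ∈ Ico 0 T) :
    ∃ A : 𝓢(Space d, ℂ) →L[ℂ] ℂ, ∀ φ, A φ = ∫ s in 0..t, pairing (f s) (g s) (L φ) := by
  have hi : ∀ φ, IntervalIntegrable (fun s => pairing (f s) (g s) (L φ)) volume 0 t := fun φ =>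
    intervalIntegrable_of_continuousOn_Ico (hf.continuousOn_map hL hg φ) ht
  have hsub : ∀ s ∈ Icc 0 t, s ∈ Ico 0 T := fun s hs => ⟨hs.1, hs.2.trans_lt ht.2⟩
  obtain ⟨q, hq, hq0, hqb⟩ := hL.bound
  obtain ⟨B, hB, hfB⟩ := hf.exists_bound ht.2
  obtain ⟨B', hB', hgB⟩ := hg.exists_bound ht.2
  let A : 𝓢(Space d, ℂ) →ₗ[ℂ] ℂ :=
    { toFun := fun φ => ∫ s in 0..t, pairing (f s) (g s) (L φ)
      map_add' := fun φ ψ => by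
        rw [← intervalIntegral.integral_add (hi φ) (hi ψ)]
        refine intervalIntegral.integral_congr fun s hs => ?_
        rw [uIcc_of_le ht.1] at hs
        exact pairing_map_add hL (hf.1 s (hsub s hs)) (hg.1 s (hsub s hs)) φ ψ
      map_smul' := fun c φ => by
        simp only [pairing_map_smul, RingHom.id_apply, smul_eq_mul]
        exact intervalIntegral.integral_const_mul _ _ }
  have hA : ∀ φ, ‖A φ‖ ≤ q φ * (B * B') * |t - 0| := fun φ => by
    refine intervalIntegral.norm_integral_le_of_norm_le_const fun s hs => ?_
    rw [uIoc_of_le ht.1] at hs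
    have hs' : s ∈ Icc 0 t := ⟨hs.1.le, hs.2⟩
    have hqφ : 0 ≤ q φ :=
      nonneg_of_mul_nonneg_left ((norm_nonneg _).trans (hqb φ 0)) (decayWeight_pos _ _)
    refine (norm_pairing_le (hf.1 s (hsub s hs')) (hg.1 s (hsub s hs')) (hqb φ)).trans ?_
    have h1 := hfB s hs'
    have h2 := hgB s hs'
    have h3 := weightNorm_nonneg (g s)
    gcongr
  have hc : Continuous A := by
    refine continuous_of_continuousAt_zero A.toAddMonoidHom ?_
    have h0 : A.toAddMonoidHom 0 = 0 := map_zero _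
    rw [ContinuousAt, h0]
    refine squeeze_zero_norm hA ?_
    have h1 : Continuous fun φ => q φ * (B * B') * |t - 0| :=
      (hq.mul continuous_const).mul continuous_const
    have h2 := h1.tendsto 0
    simpa [hq0] using h2
  exact ⟨⟨A, hc⟩, fun φ => rfl⟩

/-- A second dominated convergence, in time; the weighted norms are bounded on the compact interval
`[0,t]`. -/
theorem tendsto_integral_pairing_zero {d : ℕ} {T : ℝ} {f g : ℝ → Space d → ℝ}
    (hf : ContinuousInWeight T f)
    (hg : ContinuousInWeight T g) {t : ℝ} (ht : t ∈ Ico 0 T) {a : ℝ → Space d → ℂ} {C : ℝ}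
    (hm : ∀ lam, ContinuousOn (fun s => pairing (f s) (g s) (a lam)) (Ico 0 T))
    (hac : ∀ lam, Continuous (a lam))
    (ha : ∀ lam, 1 ≤ lam → ∀ y, ‖a lam y‖ ≤ C * decayWeight (d + 1) y)
    (ha' : ∀ lam, 1 ≤ lam → ∀ y, ‖a lam y‖ ≤ C / lam) :
    Tendsto (fun lam => ∫ s in 0..t, pairing (f s) (g s) (a lam)) atTop (𝓝 0) := by
  have hsub : ∀ s ∈ Ioc 0 t, s ∈ Ico 0 T := fun s hs => ⟨hs.1.le, hs.2.trans_lt ht.2⟩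
  obtain ⟨B, hB, hfB⟩ := hf.exists_bound ht.2
  obtain ⟨B', hB', hgB⟩ := hg.exists_bound ht.2
  have hC : 0 ≤ C :=
    nonneg_of_mul_nonneg_left ((norm_nonneg _).trans (ha 1 le_rfl 0)) (decayWeight_pos _ _)
  have h0 : (0 : ℂ) = ∫ _ in (0 : ℝ)..t, (0 : ℂ) := by simp
  rw [h0]
  refine intervalIntegral.tendsto_integral_filter_of_dominated_convergence
    (fun _ => C * (B * B')) ?_ ?_ ?_ ?_
  · refine Eventually.of_forall fun lam => ?_
    rw [uIoc_of_le ht.1]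
    exact (intervalIntegrable_of_continuousOn_Ico (hm lam) ht).1.1
  · filter_upwards [eventually_ge_atTop 1] with lam hl
    refine Eventually.of_forall fun s hs => ?_
    rw [uIoc_of_le ht.1] at hs
    refine (norm_pairing_le (hf.1 s (hsub s hs)) (hg.1 s (hsub s hs)) (ha lam hl)).trans ?_
    have h1 := hfB s ⟨hs.1.le, hs.2⟩
    have h2 := hgB s ⟨hs.1.le, hs.2⟩
    have h3 := weightNorm_nonneg (g s)
    gcongr
  · exact intervalIntegrable_const
  · refine Eventually.of_forall fun s hs => ?_
    rw [uIoc_of_le ht.1] at hs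
    exact tendsto_pairing_zero (hf.1 s (hsub s hs)) (hg.1 s (hsub s hs)) hac ha ha'

theorem ContinuousInWeight.continuousOn_eulerPair {d : ℕ} (hd : 2 ≤ d) {χ : Space d → ℝ}
    (hχ : IsCutoff χ) {T : ℝ} {u : ℝ → Space d → Space d} (hu : ContinuousInWeight T u)
    (l : Fin d) (φ : 𝓢(Space d, ℂ)) : ContinuousOn (fun t => eulerPair (u t) l φ) (Ico 0 T) :=
  continuousOn_finsetSum _ fun j _ => continuousOn_finsetSum _ fun k _ =>
    (hu.component j).continuousOn_map (isWeightBounded_eulerMap hd hχ l j k) (hu.component k) φ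

/-- The time integral of the right-hand side is a tempered distribution in `S'_h`. -/
theorem exists_integral_eulerPair_clm {d : ℕ} (hd : 2 ≤ d) {χ : Space d → ℝ} (hχ : IsCutoff χ)
    {T : ℝ} {u : ℝ → Space d → Space d} (hu : ContinuousInWeight T u) {t : ℝ} (ht : t ∈ Ico 0 T)
    (l : Fin d) : ∃ A : 𝓢(Space d, ℂ) →L[ℂ] ℂ, (∀ φ, A φ = ∫ s in 0..t, eulerPair (u s) l φ) ∧
      ∀ φ, Tendsto (fun lam : ℝ => A (lowFreqTest χ lam φ)) atTop (𝓝 0) := by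
  choose A hA using fun j k => exists_integral_pairing_clm
    (isWeightBounded_eulerMap hd hχ l j k) (hu.component j) (hu.component k) ht
  have hsum : ∀ φ, (∑ j, ∑ k, A j k) φ = ∑ j, ∑ k, A j k φ := fun φ => by
    simp only [sum_apply]
  refine ⟨∑ j, ∑ k, A j k, fun φ => ?_, fun φ => ?_⟩
  · have hi : ∀ j k, IntervalIntegrable (fun s => pairing (fun x => u s x j) (fun x => u s x k)
        (eulerMap l j k φ)) volume 0 t := fun j k => intervalIntegrable_of_continuousOn_Ico
      ((hu.component j).continuousOn_map (isWeightBounded_eulerMap hd hχ l j k)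
        (hu.component k) φ) ht
    have hi' : ∀ j, IntervalIntegrable (fun s => ∑ k, pairing (fun x => u s x j) (fun x => u s x k)
        (eulerMap l j k φ)) volume 0 t := fun j => intervalIntegrable_of_continuousOn_Ico
      (continuousOn_finsetSum _ fun k _ => (hu.component j).continuousOn_map
        (isWeightBounded_eulerMap hd hχ l j k) (hu.component k) φ) ht
    simp only [eulerPair]
    rw [hsum, intervalIntegral.integral_finsetSum fun j _ => hi' j]
    refine Finset.sum_congr rfl fun j _ => ?_
    rw [intervalIntegral.integral_finsetSum fun k _ => hi j k]
    exact Finset.sum_congr rfl fun k _ => hA j k φ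
  · obtain ⟨C, -, h⟩ := exists_eulerMap_lowFreq_bound hd hχ φ
    simp_rw [hsum, hA]
    rw [show (0 : ℂ) = ∑ _j : Fin d, ∑ _k : Fin d, (0 : ℂ) by simp]
    exact tendsto_finsetSum _ fun j _ => tendsto_finsetSum _ fun k _ =>
      tendsto_integral_pairing_zero (hu.component j) (hu.component k) ht
        (fun lam => (hu.component j).continuousOn_map (isWeightBounded_eulerMap hd hχ l j k)
          (hu.component k) _)
        (fun lam => (isWeightBounded_eulerMap hd hχ l j k).continuous _)
        (fun lam hl y => (h l j k lam hl y).1) fun lam hl y => (h l j k lam hl y).2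

/-! ### The integrated Euler equations -/

/-- The Euler equations integrated in time, with the pressure given by the pressure operator. -/
def SolvesIntegrated {d : ℕ} (T : ℝ) (u : ℝ → Space d → Space d) : Prop :=
  ∀ t ∈ Ico 0 T, ∀ l, ∀ φ : 𝓢(Space d, ℂ),
    pairing (fun x => u t x l) (fun _ => 1) φ =
      pairing (fun x => u 0 x l) (fun _ => 1) φ - ∫ s in 0..t, eulerPair (u s) l φ

theorem ofFun_sub_apply {d : ℕ} {f g : Space d → Space d} (hf : MemLp f 2 (weightMeasure d))
    (hg : MemLp g 2 (weightMeasure d)) (l : Fin d) (φ : 𝓢(Space d, ℂ)) :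
    ofFun (fun x => (((f x - g x) l : ℝ) : ℂ)) φ =
      pairing (fun x => f x l) (fun _ => 1) φ - pairing (fun x => g x l) (fun _ => 1) φ := by
  have hfl := memLp_component hf l
  have hgl := memLp_component hg l
  rw [ofFun_apply, ← pairing_sub_left hfl hgl memLp_one φ.continuous
    (norm_le_schwartzDecay (d + 1) φ), pairing]
  · refine integral_congr_ae (Eventually.of_forall fun x => ?_)
    simp [mul_comm]
  · refine hasPolyIntegrability_of_weight (N := d + 1) ?_
    refine (integrable_weight_mul (hfl.sub hgl) memLp_one).ofReal.congr
      (Eventually.of_forall fun x => ?_)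
    simp

theorem locallyIntegrable_of_memLp {d : ℕ} {f : Space d → ℝ}
    (hf : MemLp f 2 (weightMeasure d)) : LocallyIntegrable f volume := by
  have h1 := (integrable_weight_mul hf memLp_one).locallyIntegrable
  have hc : Continuous fun x : Space d => (decayWeight (d + 1) x)⁻¹ :=
    (continuous_decayWeight _).inv₀ fun x => (decayWeight_pos _ x).ne'
  refine (h1.continuous_smul hc).congr (Eventually.of_forall fun x => ?_)
  have := (decayWeight_pos (d + 1) x).ne'
  simp only [smul_eq_mul]
  field_simp

theorem ae_eq_of_pairing_eq {d : ℕ} {f g : Space d → Space d}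
    (hf : MemLp f 2 (weightMeasure d)) (hg : MemLp g 2 (weightMeasure d))
    (h : ∀ l, ∀ b : 𝓓((⊤ : TopologicalSpace.Opens (Space d)), ℝ),
      pairing (fun x => f x l) (fun _ => 1) (schwartzOfTest b) =
        pairing (fun x => g x l) (fun _ => 1) (schwartzOfTest b)) : f =ᵐ[volume] g := by
  have key : ∀ l, ∀ᵐ x, f x l - g x l = 0 := by
    intro l
    have hfl := memLp_component hf l
    have hgl := memLp_component hg l
    refine ae_eq_zero_of_integral_contDiff_smul_eq_zero
      (locallyIntegrable_of_memLp (hfl.sub hgl)) fun b hb hbc => ?_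
    have h1 := h l ⟨b, hb, hbc, by simp⟩
    set φ := schwartzOfTest (⟨b, hb, hbc, by simp⟩ :
      𝓓((⊤ : TopologicalSpace.Opens (Space d)), ℝ)) with hφ
    rw [← sub_eq_zero, ← pairing_sub_left hfl hgl memLp_one φ.continuous
      (norm_le_schwartzDecay (d + 1) φ), pairing] at h1
    rw [← Complex.ofReal_inj, ← integral_complex_ofReal, Complex.ofReal_zero, ← h1]
    refine integral_congr_ae (Eventually.of_forall fun x => ?_)
    have e : φ x = (b x : ℂ) := rfl
    simp [e, mul_comm]
  filter_upwards [ae_all_iff.2 key] with x hx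
  ext l
  exact sub_eq_zero.1 (hx l)

theorem schwartzField_single {d : ℕ} (l : Fin d)
    (b : 𝓓((⊤ : TopologicalSpace.Opens (Space d)), ℝ)) :
    schwartzField (Pi.single l b) = Pi.single l (schwartzOfTest b) := by
  funext m
  rw [schwartzField]
  by_cases h : m = l
  · subst h; simp
  · rw [Pi.single_eq_of_ne h, Pi.single_eq_of_ne h]
    ext x; simp

theorem sum_single {d : ℕ} (Φ : Fin d → 𝓢(Space d, ℂ) → ℂ) (hΦ : ∀ l, Φ l 0 = 0) (l : Fin d)
    (φ : 𝓢(Space d, ℂ)) :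
    ∑ m, Φ m ((Pi.single l φ : Fin d → 𝓢(Space d, ℂ)) m) = Φ l φ := by
  rw [Finset.sum_eq_single l (fun m _ hm => by rw [Pi.single_eq_of_ne hm, hΦ]) (by simp),
    Pi.single_eq_same]

theorem pairing_apply_zero {d : ℕ} (f g : Space d → ℝ) :
    pairing f g (0 : 𝓢(Space d, ℂ)) = 0 := by
  simp [pairing]

theorem sum_pairing_eq_velocityPair_sub {d : ℕ} (f g : Space d → Space d)
    (φ : Fin d → 𝓢(Space d, ℂ)) :
    ∑ l, (pairing (fun x => f x l) (fun _ => 1) (φ l) -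
      pairing (fun x => g x l) (fun _ => 1) (φ l)) = velocityPair f φ - velocityPair g φ := by
  rw [Finset.sum_sub_distrib]; rfl

/-- The difference `u(t) - u(0)` plus the time integral of the right-hand side, as a tempered
distribution. -/
theorem exists_residual {d : ℕ} (hd : 2 ≤ d) {χ : Space d → ℝ} (hχ : IsCutoff χ) {T : ℝ}
    {u : ℝ → Space d → Space d} (hu : ContinuousInWeight T u) {t : ℝ} (ht : t ∈ Ico 0 T)
    (l : Fin d) : ∃ W : 𝓢'(Space d, ℂ),
      (∀ φ, W φ = pairing (fun x => u t x l) (fun _ => 1) φ -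
        pairing (fun x => u 0 x l) (fun _ => 1) φ + ∫ s in 0..t, eulerPair (u s) l φ) ∧
      (MemSh χ (ofFun fun x => (((u t x - u 0 x) l : ℝ) : ℂ)) ↔ MemSh χ W) := by
  obtain ⟨A, hA, hA0⟩ := exists_integral_eulerPair_clm hd hχ hu ht l
  have h0 : (0 : ℝ) ∈ Ico 0 T := ⟨le_rfl, ht.1.trans_lt ht.2⟩
  set D : 𝓢'(Space d, ℂ) := ofFun fun x => (((u t x - u 0 x) l : ℝ) : ℂ) with hD
  let A' : 𝓢'(Space d, ℂ) := A
  have hA' : ∀ φ, A' φ = A φ := fun φ => rfl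
  refine ⟨D + A', fun φ => ?_, ?_⟩
  · rw [add_apply, hD, ofFun_sub_apply (hu.1 t ht) (hu.1 0 h0), hA', hA]
  · rw [memSh_iff, memSh_iff]
    refine forall_congr' fun φ => ⟨fun h => ?_, fun h => ?_⟩
    · simpa [hA'] using h.add (hA0 φ)
    · simpa [hA'] using h.sub (hA0 φ)

/-- Separated fields with one nonzero component yield the integrated equation starting from `u₀`. At
`t = 0` it identifies `u 0` with `u₀`; density then passes from test functions to Schwartz
functions. -/
theorem PressureForceEq.solvesIntegrated {d : ℕ} (hd : 2 ≤ d) {χ χ' θ : Space d → ℝ}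
    (hχ : IsCutoff χ) (hχ' : IsCutoff χ') (hθ : IsCutoff θ) {T : ℝ} (hT : 0 < T)
    {u : ℝ → Space d → Space d} {u₀ : Space d → Space d} (hu : ContinuousInWeight T u)
    (hu₀ : MemLp u₀ 2 (weightMeasure d))
    (h : PressureForceEq T u u₀ fun t => pressureOp χ' θ (u t) (u t)) :
    u 0 =ᵐ[volume] u₀ ∧ SolvesIntegrated T u := by
  have h0 : (0 : ℝ) ∈ Ico 0 T := ⟨le_rfl, hT⟩
  have key : ∀ t ∈ Ico 0 T, ∀ l, ∀ b : 𝓓((⊤ : TopologicalSpace.Opens (Space d)), ℝ),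
      pairing (fun x => u t x l) (fun _ => 1) (schwartzOfTest b) =
        pairing (fun x => u₀ x l) (fun _ => 1) (schwartzOfTest b) -
          ∫ s in 0..t, eulerPair (u s) l (schwartzOfTest b) := by
    intro t ht l b
    have hc : ContinuousOn (fun s => ∑ m, pressureOp χ' θ (u s) (u s) m
        (schwartzField (Pi.single l b) m)) (Ico 0 T) :=
      (hu.continuousOn_pressurePair hd hχ (φ := fun _ => schwartzField (Pi.single l b))
        fun _ => continuous_const).congr fun s hs => sum_pressureOp hd hχ' hθ (hu.1 s hs) _
    have h1 := h.velocityPair_eq hT hu hu₀ (Pi.single l b) hc t ht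
    have h2 : ∀ f : Space d → Space d, velocityPair f (schwartzField (Pi.single l b)) =
        pairing (fun x => f x l) (fun _ => 1) (schwartzOfTest b) := fun f => by
      rw [schwartzField_single]
      exact sum_single (fun m φ => pairing (fun x => f x m) (fun _ => 1) φ)
        (fun m => pairing_apply_zero _ _) l _
    rw [h2, h2] at h1
    rw [h1, sub_eq_add_neg, ← intervalIntegral.integral_neg]
    congr 1
    refine intervalIntegral.integral_congr fun s hs => ?_
    rw [uIcc_of_le ht.1] at hs
    have hs' := hu.1 s ⟨hs.1, hs.2.trans_lt ht.2⟩
    rw [sum_pressureOp hd hχ' hθ hs', ← neg_sub, ← sum_eulerPair hd hχ hs', schwartzField_single,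
      sum_single (fun m φ => eulerPair (u s) m φ) fun m => eulerPair_zero _ _]
  have hae : u 0 =ᵐ[volume] u₀ :=
    ae_eq_of_pairing_eq (hu.1 0 h0) hu₀ fun l b => by simpa using key 0 h0 l b
  refine ⟨hae, fun t ht l φ => ?_⟩
  obtain ⟨W, hW, -⟩ := exists_residual hd hχ hu ht l
  have hW0 : W φ = 0 := by
    refine map_eq_zero_of_test hχ (f := (W : 𝓢(Space d, ℂ) →ₗ[ℂ] ℂ))
      (ContinuousLinearMap.continuous W) (fun b => ?_) φ
    change W (schwartzOfTest b) = 0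
    rw [hW, key t ht l b]
    have h1 := key 0 h0 l b
    rw [intervalIntegral.integral_same, sub_zero] at h1
    rw [h1]; ring
  rw [hW] at hW0
  linear_combination hW0

theorem SolvesIntegrated.memSh {d : ℕ} (hd : 2 ≤ d) {χ : Space d → ℝ} (hχ : IsCutoff χ) {T : ℝ}
    {u : ℝ → Space d → Space d} (hu : ContinuousInWeight T u) (h : SolvesIntegrated T u) :
    ∀ t ∈ Ico 0 T, ∀ l, MemSh χ (ofFun fun x => (((u t x - u 0 x) l : ℝ) : ℂ)) := by
  intro t ht l
  obtain ⟨W, hW, hWS⟩ := exists_residual hd hχ hu ht l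
  refine hWS.2 (memSh_iff.2 fun φ => ?_)
  have : ∀ φ, W φ = 0 := fun φ => by rw [hW, h t ht l φ]; ring
  simp [this]

/-- The residual `W` lies in `S'_h`. It annihilates divergence-free fields by the momentum equation,
where `u 0 = u₀` is needed to match the initial terms, and gradients because `u` is divergence-free
and pressure balances stress. Hence it vanishes. -/
theorem solvesIntegrated_of_memSh {d : ℕ} (hd : 2 ≤ d) {χ : Space d → ℝ} (hχ : IsCutoff χ)
    {T : ℝ} (hT : 0 < T) {u : ℝ → Space d → Space d} {u₀ : Space d → Space d}
    (hu : ContinuousInWeight T u) (hu₀ : MemLp u₀ 2 (weightMeasure d))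
    (hsol : IsWeakEulerSolution T u u₀) (h0 : u 0 =ᵐ[volume] u₀)
    (h : ∀ t ∈ Ico 0 T, ∀ l, MemSh χ (ofFun fun x => (((u t x - u 0 x) l : ℝ) : ℂ))) :
    SolvesIntegrated T u := by
  intro t ht
  have hT0 : (0 : ℝ) ∈ Ico 0 T := ⟨le_rfl, hT⟩
  choose W hW hWS using fun l => exists_residual hd hχ hu ht l
  have hsum : ∀ φ : Fin d → 𝓢(Space d, ℂ), ∑ l, W l (φ l) = velocityPair (u t) φ -
      velocityPair (u 0) φ + ∫ s in 0..t, (pressurePair (u s) φ - stressPair (u s) φ) := by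
    intro φ
    simp_rw [hW]
    rw [Finset.sum_add_distrib, sum_pairing_eq_velocityPair_sub,
      ← intervalIntegral.integral_finsetSum fun l _ => intervalIntegrable_of_continuousOn_Ico
        (hu.continuousOn_eulerPair hd hχ l (φ l)) ht]
    congr 1
    refine intervalIntegral.integral_congr fun s hs => ?_
    rw [uIcc_of_le ht.1] at hs
    exact sum_eulerPair hd hχ (hu.1 s ⟨hs.1, hs.2.trans_lt ht.2⟩) φ
  have hW0 : ∀ l, W l = 0 := by
    refine eq_zero_of_annihilates hχ (fun b hb => ?_) (fun q => ?_) fun l => (hWS l).1 (h t ht l)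
    · have e : ∫ s in 0..t, (pressurePair (u s) (schwartzField b) -
          stressPair (u s) (schwartzField b)) = ∫ s in 0..t, -stressPair (u s) (schwartzField b) := by
        refine intervalIntegral.integral_congr fun s hs => ?_
        rw [uIcc_of_le ht.1] at hs
        rw [pressurePair_of_divFree hd hχ (hu.1 s ⟨hs.1, hs.2.trans_lt ht.2⟩) hb, zero_sub]
      rw [hsum, hsol.velocityPair_eq hT hu hu₀ hb t ht, velocityPair_congr_ae h0,
        add_sub_cancel_left, e, intervalIntegral.integral_neg, add_neg_cancel]
    · rw [hsum, hsol.div_free.velocityPair_eq_zero hT hu q t ht,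
        hsol.div_free.velocityPair_eq_zero hT hu q 0 hT0, sub_zero, zero_add,
        ← intervalIntegral.integral_zero (a := 0) (b := t) (μ := volume) (E := ℂ)]
      refine intervalIntegral.integral_congr fun s hs => ?_
      rw [uIcc_of_le ht.1] at hs
      rw [schwartzField_gradField,
        pressurePair_gradient hd hχ (hu.1 s ⟨hs.1, hs.2.trans_lt ht.2⟩), sub_self]
  intro l φ
  have h1 := hW l φ
  rw [hW0 l, zero_apply] at h1
  linear_combination -h1

theorem eq_pressureOp_of_memSh {d : ℕ} (hd : 2 ≤ d) {χ χ' θ : Space d → ℝ}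
    (hχ : IsCutoff χ) (hχ' : IsCutoff χ') (hθ : IsCutoff θ) {T : ℝ} (hT : 0 < T)
    {u : ℝ → Space d → Space d} {u₀ : Space d → Space d} (hu : ContinuousInWeight T u)
    (hu₀ : MemLp u₀ 2 (weightMeasure d)) (hdiv₀ : WeaklyDivFree u₀)
    (hsol : IsWeakEulerSolution T u u₀) {F : ℝ → Fin d → 𝓢'(Space d, ℂ)}
    (hFc : ContinuousOn F (Ico 0 T)) (hF : PressureForceEq T u u₀ F)
    (hFS : ∀ t ∈ Ico 0 T, ∀ l, MemSh χ (F t l)) :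
    ∀ t ∈ Ico 0 T, ∀ l, F t l = pressureOp χ' θ (u t) (u t) l := by
  have hc : ∀ b, ContinuousOn (fun s => ∑ l, F s l (schwartzField b l)) (Ico 0 T) := fun b => by
    refine continuousOn_finsetSum _ fun l _ t ht => ?_
    have h1 := (continuousOn_pi.1 hFc l) t ht
    rw [ContinuousWithinAt, PointwiseConvergenceCLM.tendsto_iff_forall_tendsto] at h1
    exact h1 _
  have hS : ∀ b, ContinuousOn (fun s => stressPair (u s) (schwartzField b)) (Ico 0 T) := fun b =>
    hu.continuousOn_stressPair (φ := fun _ => schwartzField b) fun l => continuous_const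
  -- The equation with force `F` and the weak Euler equation have the same velocity and stress
  -- terms, so the primitive of `F` against a divergence-free field is zero.
  have hdf : ∀ b, ∑ l, schwartzPderiv l (schwartzField b l) = 0 → ∀ t ∈ Ico 0 T,
      ∑ l, F t l (schwartzField b l) = 0 := by
    intro b hb
    refine eq_zero_of_primitive_eq_zero hT (hc b) fun t ht => ?_
    have h1 := hF.velocityPair_eq hT hu hu₀ b (hc b) t ht
    rw [hsol.velocityPair_eq hT hu hu₀ hb t ht, add_right_inj, intervalIntegral.integral_sub
      (intervalIntegrable_of_continuousOn_Ico (hS b) ht)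
      (intervalIntegrable_of_continuousOn_Ico (hc b) ht)] at h1
    linear_combination h1
  -- Against a gradient the velocity terms at time `t` and at the initial datum vanish, so `F` must
  -- balance the stress, as the pressure operator does.
  have hgr : ∀ q, ∀ t ∈ Ico 0 T, stressPair (u t) (schwartzField (gradField q)) -
      ∑ l, F t l (schwartzField (gradField q) l) = 0 := by
    intro q
    refine eq_zero_of_primitive_eq_zero hT ((hS _).sub (hc _)) fun t ht => ?_
    have h1 := hF.velocityPair_eq hT hu hu₀ (gradField q) (hc _) t ht
    rw [hsol.div_free.velocityPair_eq_zero hT hu q t ht, hdiv₀.velocityPair_eq_zero hu₀ q,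
      zero_add] at h1
    exact h1.symm
  intro t ht l
  have hut := hu.1 t ht
  refine sub_eq_zero.1 ?_
  refine eq_zero_of_annihilates hχ (H := fun l => F t l - pressureOp χ' θ (u t) (u t) l)
    (fun b hb => ?_) (fun q => ?_) (fun l => ?_) l
  · simp only [sub_apply]
    rw [Finset.sum_sub_distrib, hdf b hb t ht, sum_pressureOp hd hχ' hθ hut,
      pressurePair_of_divFree hd hχ hut hb, sub_zero]
  · simp only [sub_apply]
    rw [Finset.sum_sub_distrib, sum_pressureOp hd hχ' hθ hut]
    have h1 := hgr q t ht
    rw [schwartzField_gradField] at h1 ⊢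
    rw [pressurePair_gradient hd hχ hut]
    linear_combination -h1
  · have h1 := memSh_iff.1 (hFS t ht l)
    have h2 := memSh_iff.1 (memSh_pressureOp hd hχ hχ' hθ hut l)
    refine memSh_iff.2 fun φ => ?_
    simpa using (h1 φ).sub (h2 φ)

/-! ### Recovering the equation from its integrated form -/

theorem exists_weight_bound_testSlice {d : ℕ} {T : ℝ} (φ : 𝓓(beforeTime d T, Space d))
    (l : Fin d) : ∃ M, 0 ≤ M ∧ ∀ t x, ‖testSlice φ t l x‖ ≤ M * decayWeight (d + 1) x := by
  have hc : Continuous fun p : ℝ × Space d =>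
      (decayWeight (d + 1) p.2)⁻¹ • testComponent φ l p := by
    have h1 : Continuous fun p : ℝ × Space d => (decayWeight (d + 1) p.2)⁻¹ :=
      ((continuous_decayWeight _).comp continuous_snd).inv₀ fun p => (decayWeight_pos _ _).ne'
    exact h1.smul (contDiff_testComponent φ l).continuous
  have hs : HasCompactSupport fun p : ℝ × Space d =>
      (decayWeight (d + 1) p.2)⁻¹ • testComponent φ l p := by
    refine (hasCompactSupport_testComponent φ l).mono fun p hp h => hp ?_
    simp only
    rw [h, smul_zero]
  obtain ⟨M, hM⟩ := hs.exists_bound_of_continuous hc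
  have hM' : ∀ t x, ‖testSlice φ t l x‖ ≤ M * decayWeight (d + 1) x := fun t x => by
    have h1 := hM (t, x)
    have h2 := decayWeight_pos (d + 1) x
    rw [norm_smul, norm_inv, Real.norm_of_nonneg h2.le, inv_mul_le_iff₀ h2, mul_comm] at h1
    exact h1
  exact ⟨M, (norm_nonneg _).trans (hM (0, 0)), hM'⟩

theorem hasDerivAt_testSlice_apply {d : ℕ} {T : ℝ} (φ : 𝓓(beforeTime d T, Space d)) (l : Fin d)
    (t : ℝ) (x : Space d) :
    HasDerivAt (fun s => testSlice φ s l x) (testSlice (timeDeriv φ) t l x) t := by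
  have h1 := (EuclideanSpace.proj (𝕜 := ℝ) l).hasFDerivAt.comp_hasDerivAt t (hasDerivAt_time φ t x)
  exact h1.ofReal_comp

/-- Two applications of the mean value inequality, starting from a bound on the second time
derivative that carries the spatial weight. -/
theorem exists_taylor_bound_testSlice {d : ℕ} {T : ℝ} (φ : 𝓓(beforeTime d T, Space d))
    (l : Fin d) : ∃ M, 0 ≤ M ∧ ∀ s t x,
      ‖testSlice φ s l x - testSlice φ t l x - (s - t) • testSlice (timeDeriv φ) t l x‖ ≤
        M * |s - t| * decayWeight (d + 1) x * |s - t| := by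
  obtain ⟨M, hM, hb⟩ := exists_weight_bound_testSlice (timeDeriv (timeDeriv φ)) l
  refine ⟨M, hM, fun s t x => ?_⟩
  have h1 : ∀ r, ‖testSlice (timeDeriv φ) r l x - testSlice (timeDeriv φ) t l x‖ ≤
      M * decayWeight (d + 1) x * |r - t| := fun r =>
    convex_univ.norm_image_sub_le_of_norm_hasDerivWithin_le
      (fun r _ => (hasDerivAt_testSlice_apply (timeDeriv φ) l r x).hasDerivWithinAt)
      (fun r _ => hb r x) (mem_univ t) (mem_univ r)
  have h2 : ∀ r, HasDerivAt
      (fun r => testSlice φ r l x - (r - t) • testSlice (timeDeriv φ) t l x)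
      (testSlice (timeDeriv φ) r l x - testSlice (timeDeriv φ) t l x) r := fun r => by
    have := (hasDerivAt_testSlice_apply φ l r x).fun_sub
      (((hasDerivAt_id r).sub_const t).smul_const (testSlice (timeDeriv φ) t l x))
    simpa using this
  have h3 := (convex_uIcc t s).norm_image_sub_le_of_norm_hasDerivWithin_le
    (C := M * |s - t| * decayWeight (d + 1) x)
    (fun r _ => (h2 r).hasDerivWithinAt) (fun r hr => by
      refine (h1 r).trans ?_
      have h4 := abs_sub_left_of_mem_uIcc hr
      have h5 := decayWeight_nonneg (d + 1) x
      calc M * decayWeight (d + 1) x * |r - t| ≤ M * decayWeight (d + 1) x * |s - t| := by gcongr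
        _ = _ := by ring) left_mem_uIcc right_mem_uIcc
  rw [sub_self, zero_smul, sub_zero, Real.norm_eq_abs] at h3
  rwa [sub_right_comm]

/-- The test function vanishes at `s = t`, so no differentiability of `f` is needed: the difference
quotient falls entirely on `φ`, and `f` only has to be continuous. -/
theorem ContinuousInWeight.hasDerivAt_pairing_testSlice_sub {d : ℕ} {T : ℝ}
    {f : ℝ → Space d → ℝ} (hf : ContinuousInWeight T f) (φ : 𝓓(beforeTime d T, Space d))
    (l : Fin d) {t : ℝ} (ht : t ∈ Ioo 0 T) :
    HasDerivAt (fun s => pairing (f s) (fun _ => 1) ⇑(testSlice φ s l - testSlice φ t l))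
      (pairing (f t) (fun _ => 1) (testSlice (timeDeriv φ) t l)) t := by
  obtain ⟨M, hM, hb⟩ := exists_taylor_bound_testSlice φ l
  rw [hasDerivAt_iff_tendsto_slope]
  have hnhds : Ico 0 T ∈ 𝓝 t := Ico_mem_nhds ht.1 ht.2
  have hle : 𝓝[≠] t ≤ 𝓝[Ico 0 T] t := by
    rw [nhdsWithin_eq_nhds.2 hnhds]
    exact nhdsWithin_le_nhds
  have ht' : t ∈ Ico 0 T := ⟨ht.1.le, ht.2⟩
  have hs : Tendsto (fun s : ℝ => |s - t|) (𝓝[≠] t) (𝓝 0) := by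
    have h1 : Continuous fun s : ℝ => |s - t| := by fun_prop
    have h2 := h1.tendsto t
    simp only [sub_self, abs_zero] at h2
    exact h2.mono_left nhdsWithin_le_nhds
  have key : Tendsto (fun s => pairing (f s) (fun _ => 1)
      ⇑((((s - t)⁻¹ : ℝ) : ℂ) • (testSlice φ s l - testSlice φ t l))) (𝓝[≠] t)
      (𝓝 (pairing (f t) (fun _ => 1) (testSlice (timeDeriv φ) t l))) := by
    refine tendsto_pairing (q := fun s => M * |s - t|)
      (hle (eventually_mem_nhdsWithin.mono hf.1)) (Eventually.of_forall fun _ => memLp_one)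
      (hf.1 t ht') memLp_one ((hf.2 t ht').mono_left hle) ?_
      (fun s => SchwartzMap.continuous _) (SchwartzMap.continuous _)
      (norm_le_schwartzDecay (d + 1) _) ?_ ?_
    · exact (continuousInWeight_const memLp_one).2 t ht' |>.mono_left hle
    · filter_upwards [self_mem_nhdsWithin] with s hs y
      have hne : s - t ≠ 0 := sub_ne_zero.2 hs
      have hpos : 0 < |s - t| := abs_pos.2 hne
      have e : (((((s - t)⁻¹ : ℝ) : ℂ) • (testSlice φ s l - testSlice φ t l) :
          𝓢(Space d, ℂ)) y) - testSlice (timeDeriv φ) t l y =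
          (((s - t)⁻¹ : ℝ) : ℂ) * (testSlice φ s l y - testSlice φ t l y -
            (s - t) • testSlice (timeDeriv φ) t l y) := by
        have hne' : (((s - t : ℝ)) : ℂ) ≠ 0 := by exact_mod_cast hne
        rw [smul_apply, sub_apply, smul_eq_mul, Complex.real_smul, mul_sub _ (_ - _),
          Complex.ofReal_inv, inv_mul_cancel_left₀ hne']
      rw [e, norm_mul, Complex.norm_real, norm_inv, Real.norm_eq_abs, inv_mul_le_iff₀ hpos,
        mul_comm |s - t|]
      exact hb s t y
    · simpa using hs.const_mul M
  refine key.congr fun s => ?_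
  have h1 := pairing_map_smul (coeMap (ContinuousLinearMap.id ℂ _)) (f s) (fun _ => 1)
    (((s - t)⁻¹ : ℝ) : ℂ) (testSlice φ s l - testSlice φ t l)
  rw [slope_def_module, sub_self, pairing_apply_zero, sub_zero, Complex.real_smul]
  exact h1

/-- Split `φ(s) = φ(t) + (φ(s) - φ(t))`: the integrated equation differentiates the pairing with the
frozen `φ(t)`, and the previous lemma handles the remainder. -/
theorem SolvesIntegrated.hasDerivAt {d : ℕ} (hd : 2 ≤ d) {χ : Space d → ℝ} (hχ : IsCutoff χ)
    {T : ℝ} {u : ℝ → Space d → Space d} (hu : ContinuousInWeight T u) (h : SolvesIntegrated T u)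
    (φ : 𝓓(beforeTime d T, Space d)) (l : Fin d) {t : ℝ} (ht : t ∈ Ioo 0 T) :
    HasDerivAt (fun s => pairing (fun x => u s x l) (fun _ => 1) (testSlice φ s l))
      (pairing (fun x => u t x l) (fun _ => 1) (testSlice (timeDeriv φ) t l) -
        eulerPair (u t) l (testSlice φ t l)) t := by
  have h1 : HasDerivAt (fun s => pairing (fun x => u 0 x l) (fun _ => 1) (testSlice φ t l) -
      ∫ r in 0..s, eulerPair (u r) l (testSlice φ t l)) (-eulerPair (u t) l (testSlice φ t l)) t :=
    (hasDerivAt_primitive_Ico (hu.continuousOn_eulerPair hd hχ l (testSlice φ t l)) ht).const_sub _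
  have h2 := (hu.component l).hasDerivAt_pairing_testSlice_sub φ l ht
  have h3 := h1.add h2
  rw [neg_add_eq_sub] at h3
  refine h3.congr_of_eventuallyEq ?_
  filter_upwards [Ico_mem_nhds ht.1 ht.2] with s hs
  have h4 := pairing_map_add (isWeightBounded_coeMap (ContinuousLinearMap.id ℂ _))
    ((hu.component l).1 s hs) memLp_one (testSlice φ t l) (testSlice φ s l - testSlice φ t l)
  rw [add_sub_cancel] at h4
  rw [Pi.add_apply, ← h s hs l]
  exact h4

theorem exists_testSlice_eq_zero {d : ℕ} {T : ℝ} (φ : 𝓓(beforeTime d T, Space d)) :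
    ∃ S < T, ∀ t, S < t → testSlice φ t = 0 := by
  obtain ⟨S, hS, h⟩ := exists_lt_of_isCompact_subset_Iio
    (φ.hasCompactSupport.isCompact.image continuous_fst) (T := T) (by
      rintro _ ⟨p, hp, rfl⟩
      exact φ.tsupport_subset hp)
  refine ⟨S, hS, fun t ht => ?_⟩
  funext l
  ext x
  have : φ (t, x) = 0 := image_eq_zero_of_notMem_tsupport fun hm =>
    absurd (h ⟨_, hm, rfl⟩) (not_le.2 ht)
  rw [testSlice_apply, this]
  simp

theorem velocityPair_zero {d : ℕ} (f : Space d → Space d) : velocityPair f 0 = 0 := by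
  simpa using velocityPair_smul f 0 0

theorem stressPair_zero {d : ℕ} (f : Space d → Space d) : stressPair f 0 = 0 := by
  simpa using stressPair_smul f 0 0

theorem SolvesIntegrated.pressureForceEq {d : ℕ} (hd : 2 ≤ d) {χ χ' θ : Space d → ℝ}
    (hχ : IsCutoff χ) (hχ' : IsCutoff χ') (hθ : IsCutoff θ) {T : ℝ} (hT : 0 < T)
    {u : ℝ → Space d → Space d} {u₀ : Space d → Space d} (hu : ContinuousInWeight T u)
    (hu₀ : MemLp u₀ 2 (weightMeasure d)) (h0 : u 0 =ᵐ[volume] u₀) (h : SolvesIntegrated T u) :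
    PressureForceEq T u u₀ fun t => pressureOp χ' θ (u t) (u t) := by
  intro φ
  obtain ⟨S₁, hS₁, z₁⟩ := exists_testSlice_eq_zero φ
  obtain ⟨S₂, hS₂, z₂⟩ := exists_testSlice_eq_zero (timeDeriv φ)
  have hS : max S₁ S₂ < T := max_lt hS₁ hS₂
  have z1 : ∀ t, max S₁ S₂ < t → testSlice φ t = 0 := fun t ht =>
    z₁ t ((le_max_left _ _).trans_lt ht)
  have z2 : ∀ t, max S₁ S₂ < t → testSlice (timeDeriv φ) t = 0 := fun t ht =>
    z₂ t ((le_max_right _ _).trans_lt ht)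
  have hV := hu.continuousOn_velocityPair (φ := testSlice φ) (continuous_testSlice φ)
  have hV' := hu.continuousOn_velocityPair (φ := testSlice (timeDeriv φ))
    (continuous_testSlice (timeDeriv φ))
  have hQ := hu.continuousOn_stressPair (φ := testSlice φ) (continuous_testSlice φ)
  have hP := hu.continuousOn_pressurePair hd hχ (φ := testSlice φ) (continuous_testSlice φ)
  have hP0 : ∀ f : Space d → Space d, pressurePair f 0 = 0 := fun f => by
    simp only [pressurePair, Pi.zero_apply]
    refine Finset.sum_eq_zero fun l _ => Finset.sum_eq_zero fun j _ =>
      Finset.sum_eq_zero fun k _ => ?_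
    have h := pairing_map_smul (pressureMap l j k) (fun x => f x j) (fun x => f x k) 0 0
    rw [zero_smul, zero_mul] at h
    exact h
  -- The derivative of `∫ u(t) · φ(t)` is integrated over `[0,T)`. Nothing remains near `T`, and the
  -- boundary term at 0 cancels the contribution of the initial datum.
  have h1 : ∫ t in Ico 0 T, (velocityPair (u t) (testSlice (timeDeriv φ) t) -
      (pressurePair (u t) (testSlice φ t) - stressPair (u t) (testSlice φ t))) =
      -velocityPair (u 0) (testSlice φ 0) := by
    refine setIntegral_Ico_deriv (F := fun t => velocityPair (u t) (testSlice φ t)) hT hS hV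
      (hV'.sub (hP.sub hQ)) (fun t ht => ?_) (fun t ht _ => ?_) fun t ht _ => ?_
    · rw [← sum_eulerPair hd hχ (hu.1 t ⟨ht.1.le, ht.2⟩), velocityPair, ← Finset.sum_sub_distrib]
      exact HasDerivAt.fun_sum fun l _ => h.hasDerivAt hd hχ hu φ l ht
    · rw [z1 t ht, velocityPair_zero]
    · rw [z1 t ht, z2 t ht, velocityPair_zero, stressPair_zero, hP0, sub_zero, sub_zero]
  have i1 : IntegrableOn (fun t => velocityPair (u t) (testSlice (timeDeriv φ) t) -
      (pressurePair (u t) (testSlice φ t) - stressPair (u t) (testSlice φ t))) (Ico 0 T) :=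
    integrableOn_Ico_of_eq_zero hS (hV'.sub (hP.sub hQ)) fun t ht _ => by
      rw [z1 t ht, z2 t ht, velocityPair_zero, stressPair_zero, hP0, sub_zero, sub_zero]
  have i2 : IntegrableOn (fun t => pressurePair (u t) (testSlice φ t)) (Ico 0 T) :=
    integrableOn_Ico_of_eq_zero hS hP fun t ht _ => by rw [z1 t ht, hP0]
  have h2 := integral_add i1 i2
  rw [h1] at h2
  have h3 : ∫ t in Ico 0 T, ∑ l, pressureOp χ' θ (u t) (u t) l (testSlice φ t l) =
      ∫ t in Ico 0 T, pressurePair (u t) (testSlice φ t) :=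
    setIntegral_congr_fun measurableSet_Ico fun t ht => sum_pressureOp hd hχ' hθ (hu.1 t ht) _
  have h4 : ∫ t in Ico 0 T, (velocityPair (u t) (testSlice (timeDeriv φ) t) +
        stressPair (u t) (testSlice φ t)) = -velocityPair (u 0) (testSlice φ 0) +
      ∫ t in Ico 0 T, pressurePair (u t) (testSlice φ t) := by
    rw [← h2]
    congr 1; ext t
    ring
  rw [pressureForce_eq hu.1 hu₀, h3, h4, velocityPair_congr_ae h0]
  ring

/-! ### The equivalence -/

theorem theorem6p1 (d : ℕ) (hd : 2 ≤ d) (T α : ℝ) (hT : 0 < T) (hα₀ : 0 ≤ α) (hα : α < 1 / 2)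
    (χ χ' θ : Space d → ℝ) (hχ : IsCutoff χ) (hχ' : IsCutoff χ') (hθ : IsCutoff θ)
    (u₀ : Space d → Space d) (hu₀ : MemMorrey α u₀) (hdiv₀ : WeaklyDivFree u₀)
    (u : ℝ → Space d → Space d) (hu : ContinuousInMorrey T α u)
    (hsol : IsWeakEulerSolution T u u₀) :
    List.TFAE [
      PressureForceEq T u u₀ (fun t => pressureOp χ' θ (u t) (u t)),
      (∀ t ∈ Ico 0 T, ∀ l, MemSh χ (ofFun fun x => (((u t x - u 0 x) l : ℝ) : ℂ))) ∧
        u 0 =ᵐ[volume] u₀,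
      ∃ F : ℝ → Fin d → 𝓢'(Space d, ℂ),
        ContinuousOn F (Ico 0 T) ∧ PressureForceEq T u u₀ F ∧
          ∀ t ∈ Ico 0 T, ∀ l, MemSh χ (F t l)] := by
  -- From here on only the weighted `L²` space enters; the exponent `α` plays no further role.
  have hw := hu.continuousInWeight hα
  have hw0 := hu₀.memLp hα
  tfae_have 1 → 3 := fun h =>
    ⟨fun t => pressureOp χ' θ (u t) (u t), continuousOn_pressureOp hd hχ' hθ hw, h,
      fun t ht l => memSh_pressureOp hd hχ hχ' hθ (hw.1 t ht) l⟩
  tfae_have 3 → 1 := fun ⟨F, hFc, hF, hFS⟩ φ => by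
    have he := eq_pressureOp_of_memSh hd hχ hχ' hθ hT hw hw0 hdiv₀ hsol hFc hF hFS
    refine (hF φ).trans (setIntegral_congr_fun measurableSet_Ico fun t ht => ?_)
    exact Finset.sum_congr rfl fun l _ => by rw [he t ht l]
  tfae_have 1 → 2 := fun h =>
    have hs := h.solvesIntegrated hd hχ hχ' hθ hT hw hw0
    ⟨hs.2.memSh hd hχ hw, hs.1⟩
  tfae_have 2 → 1 := fun ⟨h, h0⟩ =>
    (solvesIntegrated_of_memSh hd hχ hT hw hw0 hsol h0 h).pressureForceEq hd hχ hχ' hθ hT hw hw0 h0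
  tfae_finish

end
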